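/- Let $f^{pre}, f^{fault}, f^{post}:\mathbb R^n\times P\to\mathbb R^n$ be $C^1$, where $P\subset\mathbb R$ is an open set of parameters, and let $p_0\in P$. For each of the systems $\dot x=f(x,p)$ let $\varphi(x_0,t,p)$ denote the value at time $t$ of the trajectory that starts from $x_0$ at time $0$. For an equilibrium $e$ of $f^{post}(\cdot,p)$ let $W^s_p(e)$ be the set of all points whose forward trajectory under $f^{post}(\cdot,p)$ exists for all times and converges to $e$. Assume: * $x_{pre}(p)$ is a family of equilibria of $f^{pre}(\cdot,p)$, defined for $p$ near $p_0$ and continuous at $p_0$, and $\frac{\partial f^{pre}}{\partial x}(x_{pre}(p_0),p_0)$ is invertible; * $x_s$ is a (hyperbolic) stable equilibrium point of $f^{post}(\cdot,p_0)$, with stability region $A(x_s)=W^s_{p_0}(x_s)$; * $x_{cu}(p)$ is a family of equilibria of $f^{post}(\cdot,p)$, defined for $p$ near $p_0$ and continuous at $p_0$, and $x_{cu}(p_0)$ (the controlling UEP) is hyperbolic of type 1, i.e. its Jacobian has no eigenvalue on the imaginary axis and exactly one (with multiplicity) in the open right half plane; $w\neq0$ is a left (row) eigenvector of $\frac{\partial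 f^{post}}{\partial x}(x_{cu}(p_0),p_0)$ for this unstable eigenvalue $\lambda>0$; * $t_{cr}>0$ is the critical clearing time of the base case $p=p_0$: $\varphi^{fault}(x_{pre}(p_0),t,p_0)\in A(x_s)$ for $0\le t<t_{cr}$, and $x_{cr}=\varphi^{fault}(x_{pre}(p_0),t_{cr},p_0)\in\partial A(x_s)$; * the fault-on trajectory exits through the stable manifold of the controlling UEP, transversally: $x_{cr}\in W^s_{p_0}(x_{cu}(p_0))$, and $f^{fault}(x_{cr},p_0)$ is not tangent to $W^s_{p_0}(x_{cu}(p_0))$ at $x_{cr}$. (A vector is tangent to $W^s$ at $x$ if it is $c'(0)$ for a map $c$ from a neighbourhood of $0\in\mathbb R$ into $W^s$ that is continuous near $0$, differentiable at $0$, and has $c(0)=x$.) Put $$M_1=\frac{\partial\varphi^{fault}}{\partial x_0},\quad M_2=\frac{\partial\varphi^{fault}}{\partial t},\quad M_3=\frac{\partial\varphi^{fault}}{\partial p}\quad\text{at }(x_{pre}(p_0),t_{cr},p_0),$$ $$O_1(T)=\frac{\partial\varphi^{post}}{\partial x_0},\quad O_3(T)=\frac{\partial\varphi^{post}}{\partial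 p}\quad\text{at }(x_{cr},T,p_0),$$ $$M_4=-\Big[\frac{\partial f^{pre}}{\partial x}\Big]^{-1}\frac{\partial f^{pre}}{\partial p}\ \text{ at }(x_{pre}(p_0),p_0),\qquad O_6=-\Big[\frac{\partial f^{post}}{\partial x}\Big]^{-1}\frac{\partial f^{post}}{\partial p}\ \text{ at }(x_{cu}(p_0),p_0).$$ Then there is a function $t_{cl}(p)$, unique up to its values outside a neighbourhood of $p_0$, that gives the clearing time for which the trajectory remains critical when the parameter varies, in the following sense: $t_{cl}(p_0)=t_{cr}$; $t_{cl}$ is continuous at $p_0$; for $p$ near $p_0$ the state at clearing $x_{cl}(p)=\varphi^{fault}(x_{pre}(p),t_{cl}(p),p)$ exists and lies on $W^s_p(x_{cu}(p))$; and for every neighbourhood $B$ of $x_{cu}(p_0)$ there is $T$ such that, for all $p$ close enough to $p_0$, $\varphi^{post}(x_{cl}(p),t,p)\in B$ for all $t\ge T$. This function is differentiable at $p_0$, the number $w\,O_1(T)M_2$ is nonzero for all sufficiently large $T$, and $$\frac{dt_{cl}}{dp}\Big|_{p_0}=\lim_{T\to\infty}\frac{w\,\big(O_6-O_3(T)-O_1(T)(M_1M_4+M_3)\big)}{w\,O_1(T)\,M_2}.$$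 -/

import Mathlib

open Set Filter Topology

/-- The state space `ℝⁿ`. -/
abbrev State (n : ℕ) : Type := EuclideanSpace ℝ (Fin n)

/-- The system `ẋ = f(x, p)` with frozen parameter `p` has a solution starting from `x₀` at time `0`
that exists up to time `t`. -/
def HasTrajectory {n : ℕ} (f : State n → ℝ → State n) (x₀ : State n) (t p : ℝ) : Prop :=
  ∃ γ : ℝ → State n, γ 0 = x₀ ∧ IsIntegralCurveOn γ (fun _ y => f y p) (uIcc 0 t)

open Classical in
/-- The trajectory `φ(x₀, t, p)`: the value at time `t` of the solution of `ẋ = f(x, p)` that starts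
from `x₀` at time `0` (for locally Lipschitz `f(·, p)` that solution is unique).  If the solution
does not exist up to time `t`, the value is `x₀` by convention. -/
noncomputable def trajectory {n : ℕ} (f : State n → ℝ → State n) (x₀ : State n) (t p : ℝ) :
    State n :=
  if h : HasTrajectory f x₀ t p then h.choose t else x₀

/-- The stable manifold `W^s(e)` of an equilibrium `e` of `ẋ = f(x, p)`: the set of all points whose
forward trajectory exists for all times and converges to `e`. -/
def stableManifold {n : ℕ} (f : State n → ℝ → State n) (p : ℝ) (e : State n) : Set (State n) :=
  {x | ∃ γ : ℝ → State n, γ 0 = x ∧ IsIntegralCurveOn γ (fun _ y => f y p) (Ici 0) ∧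
    Tendsto γ atTop (𝓝 e)}

/-- The stability region `A(x_s)` of a stable equilibrium `x_s` is its stable manifold, i.e. its
region of attraction. -/
abbrev stabilityRegion {n : ℕ} (f : State n → ℝ → State n) (p : ℝ) (xs : State n) :
    Set (State n) :=
  stableManifold f p xs

/-- The tangent space of `W^s(e)` at one of its points `x`: the velocities at `x` of the curves that
run in `W^s(e)`. -/
def stableManifoldTangent {n : ℕ} (f : State n → ℝ → State n) (p : ℝ) (e x : State n) :
    Set (State n) :=
  {v | ∃ c : ℝ → State n, c 0 = x ∧ HasDerivAt c v 0 ∧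
    ∀ᶠ s in 𝓝 (0 : ℝ), ContinuousAt c s ∧ c s ∈ stableManifold f p e}

/-- The Jacobian `∂f/∂x` at `(x, p)`. -/
noncomputable def stateJacobian {n : ℕ} (f : State n → ℝ → State n) (x : State n) (p : ℝ) :
    State n →L[ℝ] State n :=
  fderiv ℝ (fun y => f y p) x

/-- The eigenvalues of `∂f/∂x` at `(x, p)`: complex, with algebraic multiplicity. -/
noncomputable def eigenvaluesAt {n : ℕ} (f : State n → ℝ → State n) (x : State n) (p : ℝ) :
    Multiset ℂ :=
  (LinearMap.charpoly (stateJacobian f x p : State n →ₗ[ℝ] State n)).aroots ℂ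

/-- `x` is a (hyperbolic) stable equilibrium point. -/
def IsSEP {n : ℕ} (f : State n → ℝ → State n) (x : State n) (p : ℝ) : Prop :=
  f x p = 0 ∧ ∀ z ∈ eigenvaluesAt f x p, z.re < 0

/-- `x` is a type-1 unstable equilibrium point: hyperbolic, with exactly one eigenvalue (counted
with multiplicity) in the open right half plane. -/
def IsTypeOneUEP {n : ℕ} (f : State n → ℝ → State n) (x : State n) (p : ℝ) : Prop :=
  f x p = 0 ∧ (∀ z ∈ eigenvaluesAt f x p, z.re ≠ 0) ∧
    (eigenvaluesAt f x p).countP (fun z => 0 < z.re) = 1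

/-- The sensitivity `-(∂f/∂x)⁻¹ (∂f/∂p)` of a nondegenerate equilibrium `x` with respect to `p`. -/
noncomputable def equilibriumSensitivity {n : ℕ} (f : State n → ℝ → State n) (x : State n) (p : ℝ) :
    State n :=
  -((stateJacobian f x p).inverse (deriv (fun q => f x q) p))

/-- The trajectory sensitivity `∂φ/∂x₀` at `(x₀, t, p)`. -/
noncomputable def sensitivityState {n : ℕ} (f : State n → ℝ → State n) (x₀ : State n) (t p : ℝ) :
    State n →L[ℝ] State n :=
  fderiv ℝ (fun y => trajectory f y t p) x₀

/-- The trajectory sensitivity `∂φ/∂t` at `(x₀, t, p)`. -/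
noncomputable def sensitivityTime {n : ℕ} (f : State n → ℝ → State n) (x₀ : State n) (t p : ℝ) :
    State n :=
  deriv (fun s => trajectory f x₀ s p) t

/-- The trajectory sensitivity `∂φ/∂p` at `(x₀, t, p)`. -/
noncomputable def sensitivityParam {n : ℕ} (f : State n → ℝ → State n) (x₀ : State n) (t p : ℝ) :
    State n :=
  deriv (fun q => trajectory f x₀ t q) p

/-- For the fault-on system `ffault` started from `x₀` and the post-fault system `fpost` with stable
equilibrium `xs`, the time `t` is the critical clearing time: the fault-on trajectory
stays in the stability region of `xs` before `t` and meets the stability boundary at time `t`. -/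
def IsCriticalClearingTime {n : ℕ} (ffault fpost : State n → ℝ → State n) (x₀ xs : State n)
    (p t : ℝ) : Prop :=
  0 < t ∧ HasTrajectory ffault x₀ t p ∧
    (∀ s ∈ Ico 0 t, trajectory ffault x₀ s p ∈ stabilityRegion fpost p xs) ∧
    trajectory ffault x₀ t p ∈ frontier (stabilityRegion fpost p xs)

/-- `tcl` is the clearing time, as a function of the parameter near `p₀`, for which the trajectory
remains critical: it continues the base clearing time `tcr`, the state
`x_cl(p) = φ^fault(x_pre(p), tcl(p), p)` at clearing lies on the stable manifold of `x_cu(p)`, and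
the post-fault trajectory from `x_cl(p)` approaches the equilibrium uniformly for `p` near `p₀`:
for each neighbourhood `B` of `x_cu(p₀)` there is `T` such that for all `p` close to `p₀` it is
in `B` from time `T` on (so `x_cl(p)` belongs to the sheet of the stable manifold that is the
extension along the flow of its local part in `B`). -/
def IsCriticalClearingBranch {n : ℕ} (ffault fpost : State n → ℝ → State n)
    (xpre xcu : ℝ → State n) (p₀ tcr : ℝ) (tcl : ℝ → ℝ) : Prop :=
  tcl p₀ = tcr ∧ ContinuousAt tcl p₀ ∧
    (∀ᶠ p in 𝓝 p₀, HasTrajectory ffault (xpre p) (tcl p) p ∧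
      trajectory ffault (xpre p) (tcl p) p ∈ stableManifold fpost p (xcu p)) ∧
    ∀ B ∈ 𝓝 (xcu p₀), ∃ T : ℝ, ∀ᶠ p in 𝓝 p₀, ∀ t ≥ T,
      trajectory fpost (trajectory ffault (xpre p) (tcl p) p) t p ∈ B

/-! ### Exponential decay on the stable subspace of a type-one equilibrium -/

/-! The condition "the state at clearing lies on the stable manifold" is turned into one scalar
equation, which the implicit function theorem solves for the clearing time.

Let `γ` be the base post-fault trajectory from `x_cr`. After some time `T₀` it stays so close to
`x_cu(p₀)` that the Jacobian along it is a small perturbation of the Jacobian `A` at the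
equilibrium. Type 1 splits the state space into `ker w`, where the flow of `A` decays exponentially,
and a line `ℝ r` expanding at rate `λ` (`exists_unstableSplitting`). Hence `ẏ = A y + h` with `h`
bounded has exactly one bounded solution on `[0, ∞)` with prescribed initial component in `ker w`
(`exists_solutionOperator`). The Lyapunov-Perron method then produces a differentiable family `Y(x,
p)` of bounded solutions near `γ(T₀ + ·)`, where `Y(x, p)(0)` and `x` differ only along `r`
(`exists_perronChart`). So `w x = w Y(x, p)(0)` is an equation of the local stable manifold,
differentiable also in `p` (`exists_smooth_stableManifold`).

Let `Z(x, p, t)` be the state reached after fault-on motion for time `t` from `x` and post-fault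
motion for time `T₀`. The clearing time solves `g = w Z - w Y(Z, p)(0) = 0`. If `∂g/∂t` vanished at
the base point, `O₁(T₀) M₂` would be tangent to the stable manifold, and pulling back by the flow
would make `M₂ = f^fault(x_cr, p₀)` tangent as well, against transversality. This gives `t_cl`, with
derivative `D`. The uniform convergence required of a branch keeps the trajectories of any other
branch close to `γ`, so they satisfy the same equation; this is uniqueness.

For the formula, `φ^post(x_cl(p), T, p) = Y(Z, p)(T - T₀)` is differentiated in `p`: `O₁(T)(M₁ M₄ +
M₃ + D M₂) + O₃(T)` is a value of one bounded curve, hence bounded in `T`. On the other hand `|w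
O₁(T) M₂| → ∞`, since a solution of the variational equation whose unstable coordinate does not
escape is bounded (`exists_bounded_of_frequently`), which would again force `∂g/∂t = 0`. Applying
`w` and dividing by `w O₁(T) M₂` leaves `D` in the limit; the constant `O₆` does not affect it. -/

theorem exists_norm_le_mul_exp_of_hasDerivAt {c d : ℝ → ℂ} {μ : ℂ} {α C : ℝ} (hα : α < -μ.re)
    (hc : ∀ t, HasDerivAt c (μ * c t + d t) t)
    (hd : ∀ t, 0 ≤ t → ‖d t‖ ≤ C * Real.exp (-α * t)) :
    ∃ C', ∀ t, 0 ≤ t → ‖c t‖ ≤ C' * Real.exp (-α * t) := by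
  have hβ : 0 < -μ.re - α := by linarith
  set β := -μ.re - α with hβdef
  have hC : 0 ≤ C := by simpa using (norm_nonneg _).trans (hd 0 le_rfl)
  refine ⟨‖c 0‖ + C / β, fun t ht => ?_⟩
  have hexp : ∀ s : ℝ, HasDerivAt (fun s : ℝ => Complex.exp (-μ * s)) (-μ * Complex.exp (-μ * s)) s := by
    intro s
    have h1 : HasDerivAt (fun s : ℝ => -μ * (s : ℂ)) (-μ) s := by
      simpa using (Complex.ofRealCLM.hasDerivAt (x := s)).const_mul (-μ)
    simpa [mul_comm] using h1.cexp
  -- Integrating factor: `e^{-μs} c(s)` has derivative `e^{-μs} d(s)`, of norm at most `C e^{βs}`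
  -- for `s ≥ 0`.
  have hg : ∀ s : ℝ, HasDerivAt (fun s : ℝ => Complex.exp (-μ * s) * c s)
      (Complex.exp (-μ * s) * d s) s := by
    intro s
    refine ((hexp s).mul (hc s)).congr_deriv ?_
    ring
  have hnexp : ∀ s : ℝ, ‖Complex.exp (-μ * s)‖ = Real.exp (-μ.re * s) := by
    intro s
    rw [Complex.norm_exp]; simp
  have key := image_norm_le_of_norm_deriv_right_le_deriv_boundary
    (f := fun s : ℝ => Complex.exp (-μ * s) * c s) (a := 0) (b := t)
    (f' := fun s => Complex.exp (-μ * s) * d s)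
    (B := fun s => ‖c 0‖ + C / β * (Real.exp (β * s) - 1)) (B' := fun s => C * Real.exp (β * s))
    (fun s _ => (hg s).continuousAt.continuousWithinAt) (fun s _ => (hg s).hasDerivWithinAt)
    (by simp)
    (fun s => by
      have h1 : HasDerivAt (fun s : ℝ => Real.exp (β * s)) (Real.exp (β * s) * β) s := by
        simpa using ((hasDerivAt_id s).const_mul β).exp
      refine (((h1.sub_const 1).const_mul (C / β)).const_add _).congr_deriv ?_
      field_simp)
    (fun s hs => by
      rw [norm_mul, hnexp]
      calc Real.exp (-μ.re * s) * ‖d s‖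
          ≤ Real.exp (-μ.re * s) * (C * Real.exp (-α * s)) := by gcongr; exact hd s hs.1
        _ = C * Real.exp (β * s) := by
          rw [show β * s = -μ.re * s + -α * s by rw [hβdef]; ring, Real.exp_add]; ring)
    ⟨ht, le_rfl⟩
  simp only [norm_mul, hnexp] at key
  have h1 : ‖c t‖ = Real.exp (μ.re * t) * (Real.exp (-μ.re * t) * ‖c t‖) := by
    rw [← mul_assoc, ← Real.exp_add]; simp
  have h2 : Real.exp (μ.re * t) ≤ Real.exp (-α * t) := by
    apply Real.exp_le_exp.2; nlinarith
  have h3 : Real.exp (μ.re * t) * Real.exp (β * t) = Real.exp (-α * t) := by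
    rw [← Real.exp_add]; congr 1; rw [hβdef]; ring
  have h4 : 0 ≤ C / β := by positivity
  calc ‖c t‖ = Real.exp (μ.re * t) * (Real.exp (-μ.re * t) * ‖c t‖) := h1
    _ ≤ Real.exp (μ.re * t) * (‖c 0‖ + C / β * (Real.exp (β * t) - 1)) := by gcongr
    _ = Real.exp (μ.re * t) * ‖c 0‖ + C / β * (Real.exp (μ.re * t) * Real.exp (β * t))
        - C / β * Real.exp (μ.re * t) := by ring
    _ ≤ Real.exp (-α * t) * ‖c 0‖ + C / β * Real.exp (-α * t) := by
        rw [h3]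
        have := mul_le_mul_of_nonneg_right h2 (norm_nonneg (c 0))
        have := mul_nonneg h4 (Real.exp_pos (μ.re * t)).le
        linarith
    _ = (‖c 0‖ + C / β) * Real.exp (-α * t) := by ring

section ComplexPolynomials

open Polynomial

variable {E : Type*} [NormedAddCommGroup E] [NormedSpace ℝ E]

/-- The value `∑ sⱼ ℓ(Aʲ x)` of the complex polynomial `s` at the real operator `A`, applied to the
vector `x` and read off by the real functional `ℓ`. -/
noncomputable def complexEval (A : E →L[ℝ] E) (ℓ : E →L[ℝ] ℝ) (x : E) : ℂ[X] →ₗ[ℂ] ℂ :=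
  Polynomial.lsum fun j => LinearMap.toSpanSingleton ℂ ℂ ((ℓ ((A ^ j) x) : ℝ) : ℂ)

variable (A : E →L[ℝ] E) (ℓ : E →L[ℝ] ℝ)

theorem complexEval_monomial (x : E) (j : ℕ) (a : ℂ) :
    complexEval A ℓ x (monomial j a) = a * ((ℓ ((A ^ j) x) : ℝ) : ℂ) := by
  simp [complexEval, Polynomial.lsum_apply]

theorem complexEval_X_mul (x : E) (s : ℂ[X]) :
    complexEval A ℓ x (X * s) = complexEval A ℓ (A x) s := by
  induction s using Polynomial.induction_on' with
  | add p q hp hq => rw [mul_add, map_add, map_add, hp, hq]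
  | monomial j a =>
    rw [X_mul_monomial, complexEval_monomial, complexEval_monomial, pow_succ]
    rfl

theorem complexEval_map (x : E) (q : ℝ[X]) :
    complexEval A ℓ x (q.map (algebraMap ℝ ℂ)) = ((ℓ (aeval A q x) : ℝ) : ℂ) := by
  induction q using Polynomial.induction_on' with
  | add p q hp hq => rw [Polynomial.map_add, map_add, hp, hq]; simp
  | monomial j a =>
    rw [map_monomial, complexEval_monomial]
    simp [aeval_monomial, Algebra.algebraMap_eq_smul_one]

theorem hasDerivAt_complexEval {x : ℝ → E} (hx : ∀ t, HasDerivAt x (A (x t)) t) (s : ℂ[X]) (t : ℝ) :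
    HasDerivAt (fun t => complexEval A ℓ (x t) s) (complexEval A ℓ (x t) (X * s)) t := by
  induction s using Polynomial.induction_on' with
  | add p q hp hq =>
    simp only [mul_add, map_add]
    exact hp.add hq
  | monomial j a =>
    simp only [complexEval_X_mul, complexEval_monomial]
    have h1 : HasDerivAt (fun t => ℓ ((A ^ j) (x t))) (ℓ ((A ^ j) (A (x t)))) t :=
      (ℓ.comp (A ^ j)).hasFDerivAt.comp_hasDerivAt t (hx t)
    exact h1.ofReal_comp.const_mul a

/-- If `u` is the value at `s`, then `u' - z u` is the value at `(X - z) s`, so each linear factor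
is removed by one scalar inhomogeneous equation. The strict inequality `Re z < -α` absorbs the
polynomial factors that repeated roots create. -/
theorem exists_norm_complexEval_le {x : ℝ → E} (hx : ∀ t, HasDerivAt x (A (x t)) t) {α : ℝ}
    (m : Multiset ℂ) (hm : ∀ z ∈ m, z.re < -α) (s : ℂ[X])
    (h : ∀ t, complexEval A ℓ (x t) ((m.map fun z => X - C z).prod * s) = 0) :
    ∃ K, ∀ t, 0 ≤ t → ‖complexEval A ℓ (x t) s‖ ≤ K * Real.exp (-α * t) := by
  induction m using Multiset.induction_on generalizing s with
  | empty => exact ⟨0, fun t _ => by simpa using h t⟩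
  | cons z m ih =>
    obtain ⟨K, hK⟩ := ih (fun y hy => hm y (Multiset.mem_cons_of_mem hy)) ((X - C z) * s)
      (fun t => by
        have := h t
        rw [Multiset.map_cons, Multiset.prod_cons] at this
        rw [← this]; congr 1; ring)
    refine exists_norm_le_mul_exp_of_hasDerivAt (μ := z) (d := fun t =>
      complexEval A ℓ (x t) ((X - C z) * s)) ?_ (fun t => ?_) hK
    · have := hm z (Multiset.mem_cons_self _ _); linarith
    · refine (hasDerivAt_complexEval A ℓ hx s t).congr_deriv ?_
      have : X * s = z • s + (X - C z) * s := by rw [smul_eq_C_mul]; ring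
      rw [this, map_add, map_smul, smul_eq_mul]

end ComplexPolynomials

section Dichotomy

variable {E : Type*} [NormedAddCommGroup E] [NormedSpace ℝ E]

/-- `A` has the simple positive eigenvalue `lam`, with left eigenvector `w` and right eigenvector
`r`, and the flow of `A` decays exponentially on the complementary invariant subspace `ker w`. -/
structure UnstableSplitting (A : E →L[ℝ] E) (w : E →L[ℝ] ℝ) (r : E) (lam α K : ℝ) : Prop where
  lam_pos : 0 < lam
  α_pos : 0 < α
  K_nonneg : 0 ≤ K
  left_eig : w.comp A = lam • w
  right_eig : A r = lam • r
  normalized : w r = 1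
  decay : ∀ t, 0 ≤ t → ∀ v, w v = 0 → ‖NormedSpace.exp (t • A) v‖ ≤ K * Real.exp (-α * t) * ‖v‖

-- No Jordan form and no complexification of `E` is needed. For `v` in `ker q(A)`, every coordinate
-- of `e^{tA} v` is annihilated by `q(d/dt)`, and the complex roots of `q` are removed one at a
-- time. Bases of `E` and of `ker q(A)` turn these finitely many scalar bounds into a norm bound.
open Polynomial in
theorem exists_norm_exp_smul_le [FiniteDimensional ℝ E] (A : E →L[ℝ] E) (q : ℝ[X]) (hq : q.Monic)
    (hroots : ∀ z ∈ q.aroots ℂ, z.re < 0) :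
    ∃ α K : ℝ, 0 < α ∧ 0 ≤ K ∧ ∀ t, 0 ≤ t → ∀ v, aeval A q v = 0 →
      ‖NormedSpace.exp (t • A) v‖ ≤ K * Real.exp (-α * t) * ‖v‖ := by
  have : CompleteSpace E := FiniteDimensional.complete ℝ E
  obtain ⟨α, hα, hαm⟩ : ∃ α : ℝ, 0 < α ∧ ∀ z ∈ q.aroots ℂ, z.re < -α := by
    have : ∀ m : Multiset ℂ, (∀ z ∈ m, z.re < 0) → ∃ α : ℝ, 0 < α ∧ ∀ z ∈ m, z.re < -α := by
      intro m
      induction m using Multiset.induction_on with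
      | empty => exact fun _ => ⟨1, one_pos, by simp⟩
      | cons z m ih =>
        intro h
        obtain ⟨α, hα, h1⟩ := ih fun y hy => h y (Multiset.mem_cons_of_mem hy)
        have hz := h z (Multiset.mem_cons_self _ _)
        refine ⟨min α (-z.re / 2), lt_min hα (by linarith), fun y hy => ?_⟩
        rcases Multiset.mem_cons.1 hy with rfl | hy
        · have := min_le_right α (-y.re / 2); linarith
        · have := min_le_left α (-z.re / 2); have := h1 y hy; linarith
    exact this _ hroots
  let F := (LinearMap.ker ((aeval A q : E →L[ℝ] E) : E →ₗ[ℝ] E))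
  have hder : ∀ v t, HasDerivAt (fun t : ℝ => NormedSpace.exp (t • A) v)
      (A (NormedSpace.exp (t • A) v)) t := by
    intro v t
    exact (hasDerivAt_exp_smul_const' A t).clm_apply (hasDerivAt_const t v) |>.congr_deriv
      (by simp)
  have hdecomp : (((q.aroots ℂ).map fun z => X - C z).prod : ℂ[X]) = q.map (algebraMap ℝ ℂ) := by
    rw [aroots, ← (IsAlgClosed.splits (q.map (algebraMap ℝ ℂ))).eq_prod_roots_of_monic (hq.map _)]
  have hpt : ∀ (ℓ : E →L[ℝ] ℝ) (v : E), aeval A q v = 0 → ∃ K : ℝ, ∀ t : ℝ, 0 ≤ t →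
      |ℓ (NormedSpace.exp (t • A) v)| ≤ K * Real.exp (-α * t) := by
    intro ℓ v hv
    obtain ⟨K, hK⟩ := exists_norm_complexEval_le A ℓ (hder v) (q.aroots ℂ) hαm 1 (fun t => by
      rw [hdecomp, mul_one, complexEval_map]
      have hc : Commute (aeval A q) (NormedSpace.exp (t • A)) := by
        refine Commute.exp_right ?_
        exact ((Polynomial.aeval_algHom_apply (AlgHom.id ℝ _) A q ▸
          (Algebra.commute_of_mem_adjoin_self (aeval_mem_adjoin_singleton ℝ A)).symm)).smul_right t
      have : aeval A q (NormedSpace.exp (t • A) v) = NormedSpace.exp (t • A) (aeval A q v) :=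
        congrArg (fun L : E →L[ℝ] E => L v) hc.eq
      rw [this, hv]; simp)
    refine ⟨K, fun t ht => ?_⟩
    have := hK t ht
    rw [show (1 : ℂ[X]) = monomial 0 1 from rfl, complexEval_monomial] at this
    simpa using this
  let b := Module.finBasis ℝ E
  let bF := Module.finBasis ℝ F
  have h1 : ∀ i j, ∃ K : ℝ, ∀ t : ℝ, 0 ≤ t →
      |b.coord i (NormedSpace.exp (t • A) (bF j : E))| ≤ K * Real.exp (-α * t) := fun i j =>
    hpt (LinearMap.toContinuousLinearMap (b.coord i)) (bF j) (bF j).2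
  choose K hK using h1
  have hK0 : ∀ i j, 0 ≤ K i j := fun i j => by simpa using (abs_nonneg _).trans (hK i j 0 le_rfl)
  let cF : ∀ j, F →L[ℝ] ℝ := fun j => LinearMap.toContinuousLinearMap (bF.coord j)
  refine ⟨α, ∑ i, ∑ j, K i j * ‖cF j‖ * ‖b i‖, hα, ?_, fun t ht v hv => ?_⟩
  · exact Finset.sum_nonneg fun i _ => Finset.sum_nonneg fun j _ =>
      mul_nonneg (mul_nonneg (hK0 i j) (ContinuousLinearMap.opNorm_nonneg _)) (norm_nonneg _)
  let v' : F := ⟨v, hv⟩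
  have hv' : v = ∑ j, cF j v' • (bF j : E) := by
    have h := congrArg F.subtype (bF.sum_repr v').symm
    rw [map_sum] at h
    simp only [map_smul] at h
    exact h
  have h2 : NormedSpace.exp (t • A) v = ∑ i, b.coord i (NormedSpace.exp (t • A) v) • b i :=
    (b.sum_repr _).symm
  rw [h2, Finset.sum_mul, Finset.sum_mul]
  refine (norm_sum_le _ _).trans (Finset.sum_le_sum fun i _ => ?_)
  have h3 : |b.coord i (NormedSpace.exp (t • A) v)|
      ≤ ∑ j, ‖cF j‖ * ‖v‖ * (K i j * Real.exp (-α * t)) := by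
    conv_lhs => rw [hv']
    rw [map_sum, map_sum]
    refine (Finset.abs_sum_le_sum_abs _ _).trans (Finset.sum_le_sum fun j _ => ?_)
    rw [map_smul, map_smul, smul_eq_mul, abs_mul]
    exact mul_le_mul ((cF j).le_opNorm v') (hK i j t ht) (abs_nonneg _) (by positivity)
  rw [norm_smul, Real.norm_eq_abs, Finset.sum_mul, Finset.sum_mul]
  refine (mul_le_mul_of_nonneg_right h3 (norm_nonneg _)).trans_eq ?_
  rw [Finset.sum_mul]
  exact Finset.sum_congr rfl fun j _ => by ring

-- The left eigenvector makes `λ` a root of the characteristic polynomial, `χ = (X - λ) q`, and the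
-- count of unstable roots leaves `q` with roots in the open left half plane only. So `λ` is simple
-- and its eigenspace has dimension at most one. By Cayley-Hamilton the range of `q(A)` lies in that
-- eigenspace, which supplies `r`. If `w v = 0`, then `q(A) v` is a multiple of `r` killed by `w`,
-- hence zero: `ker w` lies in `ker q(A)`, where `exists_norm_exp_smul_le` applies.
open Polynomial in
theorem exists_unstableSplitting [FiniteDimensional ℝ E] (A : E →L[ℝ] E) (w : E →L[ℝ] ℝ)
    {lam : ℝ} (hw : w ≠ 0) (hlam : 0 < lam) (heig : w.comp A = lam • w)
    (hre : ∀ z ∈ (LinearMap.charpoly (A : E →ₗ[ℝ] E)).aroots ℂ, z.re ≠ 0)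
    (hcount : ((LinearMap.charpoly (A : E →ₗ[ℝ] E)).aroots ℂ).countP (fun z => 0 < z.re) = 1) :
    ∃ r α K, UnstableSplitting A w r lam α K := by
  set χ := LinearMap.charpoly (A : E →ₗ[ℝ] E) with hχ
  have hmonic : χ.Monic := LinearMap.charpoly_monic _
  have hw_aeval : ∀ (p : ℝ[X]) (v : E), w (aeval A p v) = p.eval lam * w v := by
    intro p
    induction p using Polynomial.induction_on' with
    | add p q hp hq => intro v; simp [add_mul, hp, hq]
    | monomial j a =>
      have : ∀ v, w ((A ^ j) v) = lam ^ j * w v := by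
        induction j with
        | zero => simp
        | succ j ih =>
          intro v
          rw [pow_succ, mul_apply_eq_comp, ih]
          have := congrArg (fun L : E →L[ℝ] ℝ => L v) heig
          simp only [ContinuousLinearMap.comp_apply, smul_apply, smul_eq_mul]
            at this
          rw [this]; ring
      intro v
      rw [aeval_monomial, mul_apply_eq_comp, Algebra.algebraMap_eq_smul_one, smul_apply,
        one_apply_eq_self, map_smul, this, eval_monomial, smul_eq_mul, mul_assoc]
  have hCH : aeval A χ = 0 := by
    ext v
    have h1 := LinearMap.aeval_self_charpoly (A : E →ₗ[ℝ] E)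
    have h2 := Polynomial.hom_eval₂ χ (algebraMap ℝ (E →L[ℝ] E))
      (ContinuousLinearMap.toLinearMapRingHom (R₁ := ℝ) (M₁ := E)) A
    have h3 : ((aeval A χ : E →L[ℝ] E) : E →ₗ[ℝ] E) = 0 := by
      rw [← h1]; exact h2
    exact congrArg (fun L : E →ₗ[ℝ] E => L v) h3
  obtain ⟨v₀, hv₀⟩ : ∃ v, w v ≠ 0 := by
    by_contra! h; exact hw (ContinuousLinearMap.ext h)
  have hroot : χ.IsRoot lam := by
    have := hw_aeval χ v₀
    rw [hCH] at this
    simpa [hv₀] using this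
  obtain ⟨q, hq⟩ := dvd_iff_isRoot.2 hroot
  have hqmonic : q.Monic := by
    rw [hq] at hmonic; exact (monic_X_sub_C lam).of_mul_monic_left hmonic
  have hχ0 : χ ≠ 0 := hmonic.ne_zero
  have haroots : χ.aroots ℂ = (lam : ℂ) ::ₘ q.aroots ℂ := by
    rw [hq, aroots_mul (hq ▸ hχ0), aroots_X_sub_C]; simp
  have hqneg : ∀ z ∈ q.aroots ℂ, z.re < 0 := by
    rw [haroots, Multiset.countP_cons_of_pos _ (by simpa using hlam)] at hcount
    have h0 : (q.aroots ℂ).countP (fun z => 0 < z.re) = 0 := by omega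
    rw [Multiset.countP_eq_zero] at h0
    intro z hz
    exact lt_of_le_of_ne (not_lt.1 (h0 z hz)) (hre z (haroots ▸ Multiset.mem_cons_of_mem hz))
  have hqlam : q.eval lam ≠ 0 := by
    intro h
    have : (lam : ℂ) ∈ q.aroots ℂ := by
      rw [mem_aroots]
      refine ⟨hqmonic.ne_zero, ?_⟩
      have := Polynomial.aeval_algebraMap_apply ℂ lam q
      simp only [Complex.coe_algebraMap] at this
      rw [this, coe_aeval_eq_eval, h]; simp
    have := hqneg _ this
    simp at this; linarith
  have hmult : χ.rootMultiplicity lam = 1 := by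
    rw [hq, rootMultiplicity_mul (hq ▸ hχ0), rootMultiplicity_X_sub_C_self,
      rootMultiplicity_eq_zero hqlam]
  have hkerq : ∀ v, A (aeval A q v) = lam • aeval A q v := by
    intro v
    have : (aeval A χ) v = 0 := by rw [hCH]; rfl
    rw [hq, map_mul, mul_apply_eq_comp] at this
    simpa [Algebra.algebraMap_eq_smul_one, sub_eq_zero] using this
  set r := ((q.eval lam * w v₀)⁻¹) • aeval A q v₀ with hr
  have hwr : w r = 1 := by
    rw [hr, map_smul, hw_aeval, smul_eq_mul, inv_mul_cancel₀ (mul_ne_zero hqlam hv₀)]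
  have hAr : A r = lam • r := by rw [hr, map_smul, hkerq, smul_comm]
  have hr0 : r ≠ 0 := fun h => by simp [h] at hwr
  have hfin := LinearMap.finrank_eigenspace_le (A : E →ₗ[ℝ] E) lam
  rw [← hχ, hmult] at hfin
  have hzero : ∀ v, w v = 0 → aeval A q v = 0 := by
    intro v hv
    have hr_mem : r ∈ Module.End.eigenspace (A : E →ₗ[ℝ] E) lam :=
      Module.End.mem_eigenspace_iff.2 hAr
    have hv_mem : aeval A q v ∈ Module.End.eigenspace (A : E →ₗ[ℝ] E) lam :=
      Module.End.mem_eigenspace_iff.2 (hkerq v)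
    obtain ⟨g, hg⟩ := finrank_le_one_iff.1 hfin
    obtain ⟨a, ha⟩ := hg ⟨r, hr_mem⟩
    obtain ⟨b, hb⟩ := hg ⟨_, hv_mem⟩
    have ha' : a • (g : E) = r := congrArg Subtype.val ha
    have hb' : b • (g : E) = aeval A q v := congrArg Subtype.val hb
    have h1 : a * w g = 1 := by rw [← hwr, ← ha', map_smul, smul_eq_mul]
    have h2 : b * w g = 0 := by
      have := hw_aeval q v
      rw [← hb', map_smul, hv, mul_zero, smul_eq_mul] at this
      exact this
    have h3 : b = 0 := by
      rcases mul_eq_zero.1 h2 with h | h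
      · exact h
      · rw [h, mul_zero] at h1; exact absurd h1 zero_ne_one
    rw [← hb', h3, zero_smul]
  obtain ⟨α, K, hα, hK, hdecay⟩ := exists_norm_exp_smul_le A q hqmonic hqneg
  exact ⟨r, α, K, hlam, hα, hK, heig, hAr, hwr, fun t ht v hv => hdecay t ht v (hzero v hv)⟩

end Dichotomy

/-! ### A priori estimates for perturbed linear equations with one unstable direction. -/

section LinearEstimates

open scoped BoundedContinuousFunction

variable {E : Type*} [NormedAddCommGroup E] [NormedSpace ℝ E]

theorem HasDerivWithinAt.comp_const_add_Ici {f : ℝ → E} {f' : E} {a s : ℝ}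
    (h : HasDerivWithinAt f f' (Ici 0) (a + s)) (ha : 0 ≤ a) :
    HasDerivWithinAt (fun s => f (a + s)) f' (Ici 0) s := by
  have h1 := HasDerivWithinAt.scomp (t' := Ici 0) (s := Ici 0) s h
    ((hasDerivWithinAt_id s (Ici 0)).const_add a) (fun x hx => add_nonneg ha hx)
  exact h1.congr_deriv (one_smul _ _)

/-- The projection `v ↦ v - w(v) r` onto the stable subspace `ker w` along `r`. -/
noncomputable def stableProj (w : E →L[ℝ] ℝ) (r : E) : E →L[ℝ] E :=
  ContinuousLinearMap.id ℝ E - w.smulRight r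

theorem stableProj_apply (w : E →L[ℝ] ℝ) (r v : E) : stableProj w r v = v - w v • r := by
  simp [stableProj]

theorem stableProj_add_smul (w : E →L[ℝ] ℝ) (r v : E) : stableProj w r v + w v • r = v := by
  rw [stableProj_apply, sub_add_cancel]

/-- The unstable coordinate is controlled from the right end point, because it contracts at rate `λ`
backwards in time. -/
theorem abs_le_of_hasDerivWithinAt_unstable {a b : ℝ → ℝ} {lam B t₁ : ℝ} (hlam : 0 < lam)
    (hB : 0 ≤ B) (hc : ContinuousOn a (Icc 0 t₁))
    (ha : ∀ t ∈ Ico 0 t₁, HasDerivWithinAt a (lam * a t + b t) (Ici t) t)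
    (hb : ∀ t ∈ Ico 0 t₁, |b t| ≤ B) {t : ℝ} (ht : t ∈ Icc 0 t₁) :
    |a t| ≤ Real.exp (-lam * (t₁ - t)) * |a t₁| + B / lam := by
  have hexp : ∀ s : ℝ, HasDerivAt (fun s : ℝ => Real.exp (-lam * s)) (-lam * Real.exp (-lam * s)) s := by
    intro s
    simpa [mul_comm] using ((hasDerivAt_id s).const_mul (-lam)).exp
  have hsub : Icc t t₁ ⊆ Icc 0 t₁ := Icc_subset_Icc_left ht.1
  have key := image_norm_le_of_norm_deriv_right_le_deriv_boundary
    (f := fun s : ℝ => Real.exp (-lam * s) * a s - Real.exp (-lam * t) * a t) (a := t) (b := t₁)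
    (f' := fun s => Real.exp (-lam * s) * b s)
    (B := fun s => B / lam * (Real.exp (-lam * t) - Real.exp (-lam * s)))
    (B' := fun s => B * Real.exp (-lam * s))
    (((Continuous.continuousOn (by fun_prop)).mul (hc.mono hsub)).sub continuousOn_const)
    (fun s hs => by
      refine (((hexp s).hasDerivWithinAt.mul (ha s ⟨ht.1.trans hs.1, hs.2⟩)).sub_const _).congr_deriv ?_
      ring)
    (by simp)
    (fun s => by
      refine (((hexp s).const_sub _).const_mul (B / lam)).congr_deriv ?_
      field_simp)
    (fun s hs => by
      rw [norm_mul, Real.norm_eq_abs, Real.norm_eq_abs, Real.abs_exp, mul_comm]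
      exact mul_le_mul_of_nonneg_right (hb s ⟨ht.1.trans hs.1, hs.2⟩) (Real.exp_pos _).le)
    ⟨ht.2, le_rfl⟩
  simp only [Real.norm_eq_abs] at key
  have h0 : 0 ≤ B / lam := by positivity
  have h1 : Real.exp (-lam * t) * |a t| ≤ Real.exp (-lam * t₁) * |a t₁|
      + B / lam * Real.exp (-lam * t) := by
    have h2 : |Real.exp (-lam * t) * a t| ≤ |Real.exp (-lam * t₁) * a t₁| +
        |Real.exp (-lam * t₁) * a t₁ - Real.exp (-lam * t) * a t| := by
      have := abs_sub_abs_le_abs_sub (Real.exp (-lam * t) * a t) (Real.exp (-lam * t₁) * a t₁)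
      rw [abs_sub_comm] at this
      linarith
    rw [abs_mul, abs_mul, Real.abs_exp, Real.abs_exp] at h2
    have h3 := mul_nonneg h0 (Real.exp_pos (-lam * t₁)).le
    linarith
  have h2 := mul_le_mul_of_nonneg_left h1 (Real.exp_pos (lam * t)).le
  have e1 : Real.exp (lam * t) * Real.exp (-lam * t) = 1 := by rw [← Real.exp_add]; simp
  have e2 : Real.exp (lam * t) * Real.exp (-lam * t₁) = Real.exp (-lam * (t₁ - t)) := by
    rw [← Real.exp_add]; congr 1; ring
  calc |a t| = (Real.exp (lam * t) * Real.exp (-lam * t)) * |a t| := by rw [e1, one_mul]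
    _ = Real.exp (lam * t) * (Real.exp (-lam * t) * |a t|) := by ring
    _ ≤ _ := h2
    _ = (Real.exp (lam * t) * Real.exp (-lam * t₁)) * |a t₁|
        + B / lam * (Real.exp (lam * t) * Real.exp (-lam * t)) := by ring
    _ = _ := by rw [e1, e2, mul_one]

theorem continuous_exp_smul [CompleteSpace E] (A : E →L[ℝ] E) :
    Continuous fun t : ℝ => NormedSpace.exp (t • A) :=
  continuous_iff_continuousAt.2 fun t => (hasDerivAt_exp_smul_const A t).continuousAt

variable {A : E →L[ℝ] E} {w : E →L[ℝ] ℝ} {r : E} {lam α K : ℝ}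

namespace UnstableSplitting

theorem left_eig_apply (H : UnstableSplitting A w r lam α K) (v : E) : w (A v) = lam * w v :=
  congrArg (fun L : E →L[ℝ] ℝ => L v) H.left_eig

theorem w_stableProj (H : UnstableSplitting A w r lam α K) (v : E) : w (stableProj w r v) = 0 := by
  rw [stableProj_apply, map_sub, map_smul, H.normalized, smul_eq_mul, mul_one, sub_self]

theorem stableProj_right (H : UnstableSplitting A w r lam α K) : stableProj w r r = 0 := by
  rw [stableProj_apply, H.normalized, one_smul, sub_self]

theorem stableProj_of_w_eq_zero {v : E} (hv : w v = 0) : stableProj w r v = v := by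
  rw [stableProj_apply, hv, zero_smul, sub_zero]

theorem stableProj_map (H : UnstableSplitting A w r lam α K) (v : E) :
    stableProj w r (A v) = A (stableProj w r v) := by
  rw [stableProj_apply, stableProj_apply, map_sub, map_smul, H.left_eig_apply, H.right_eig,
    smul_smul, mul_comm]

/-- Variation of constants: for fixed `t`, the curve `τ ↦ e^{(t-τ)A} s(τ)` has derivative
`e^{(t-τ)A} k(τ)`, and decay on `ker w` bounds this by `K B e^{-α(t-τ)}`. -/
theorem norm_le_stable [CompleteSpace E] (H : UnstableSplitting A w r lam α K) {s k : ℝ → E}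
    {B t : ℝ} (ht : 0 ≤ t) (hB : 0 ≤ B)
    (hc : ContinuousOn s (Icc 0 t))
    (hs : ∀ τ ∈ Ico 0 t, HasDerivWithinAt s (A (s τ) + k τ) (Ici τ) τ)
    (hs0 : w (s 0) = 0) (hwk : ∀ τ ∈ Ico 0 t, w (k τ) = 0) (hk : ∀ τ ∈ Ico 0 t, ‖k τ‖ ≤ B) :
    ‖s t‖ ≤ K * Real.exp (-α * t) * ‖s 0‖ + K * B / α := by
  have hK := H.K_nonneg
  have hα := H.α_pos
  have hE : ∀ τ : ℝ, HasDerivAt (fun τ : ℝ => NormedSpace.exp ((t - τ) • A))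
      (-(NormedSpace.exp ((t - τ) • A) * A)) τ := by
    intro τ
    exact ((hasDerivAt_exp_smul_const A (t - τ)).scomp τ ((hasDerivAt_id τ).const_sub t)).congr_deriv
      (by simp)
  have hexp : ∀ τ : ℝ, HasDerivAt (fun τ : ℝ => Real.exp (-α * (t - τ)))
      (α * Real.exp (-α * (t - τ))) τ := by
    intro τ
    simpa [mul_comm] using (((hasDerivAt_id τ).const_sub t).const_mul (-α)).exp
  have key := image_norm_le_of_norm_deriv_right_le_deriv_boundary
    (f := fun τ : ℝ => NormedSpace.exp ((t - τ) • A) (s τ)) (a := 0) (b := t)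
    (f' := fun τ => NormedSpace.exp ((t - τ) • A) (k τ))
    (B := fun τ => K * Real.exp (-α * t) * ‖s 0‖
      + K * B / α * (Real.exp (-α * (t - τ)) - Real.exp (-α * t)))
    (B' := fun τ => K * B * Real.exp (-α * (t - τ)))
    (ContinuousOn.clm_apply (fun τ _ => (hE τ).continuousAt.continuousWithinAt) hc)
    (fun τ hτ => by
      refine ((hE τ).hasDerivWithinAt.clm_apply (hs τ hτ)).congr_deriv ?_
      simp)
    (by simpa using H.decay t ht (s 0) hs0)
    (fun τ => by
      refine ((((hexp τ).sub_const _).const_mul (K * B / α)).const_add _).congr_deriv ?_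
      field_simp)
    (fun τ hτ => by
      refine (H.decay (t - τ) (sub_nonneg.2 hτ.2.le) _ (hwk τ hτ)).trans ?_
      calc K * Real.exp (-α * (t - τ)) * ‖k τ‖ ≤ K * Real.exp (-α * (t - τ)) * B := by
            gcongr; exact hk τ hτ
        _ = _ := by ring)
    ⟨ht, le_rfl⟩
  simp only [sub_self, zero_smul, NormedSpace.exp_zero, mul_zero, Real.exp_zero] at key
  have h1 : 0 ≤ K * B / α * Real.exp (-α * t) := by positivity
  refine (show ‖s t‖ ≤ _ from key).trans ?_
  linarith

/-- A priori estimate on `[0, t₁]` for the inhomogeneous linear equation, in terms of the initial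
stable part and the final unstable part. -/
theorem exists_norm_le [CompleteSpace E] (H : UnstableSplitting A w r lam α K) :
    ∃ M : ℝ, 0 < M ∧ ∀ (y h : ℝ → E) (B t₁ : ℝ), 0 ≤ B → ContinuousOn y (Icc 0 t₁) →
      (∀ t ∈ Ico 0 t₁, HasDerivWithinAt y (A (y t) + h t) (Ici t) t) →
      (∀ t ∈ Ico 0 t₁, ‖h t‖ ≤ B) → ∀ t ∈ Icc 0 t₁,
      ‖y t‖ ≤ M * (Real.exp (-α * t) * ‖stableProj w r (y 0)‖
        + Real.exp (-lam * (t₁ - t)) * |w (y t₁)| + B) := by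
  have hK := H.K_nonneg
  have hα := H.α_pos
  have hlam := H.lam_pos
  have n1 := norm_nonneg r
  have n2 := norm_nonneg w
  have n3 := norm_nonneg (stableProj w r)
  refine ⟨K + ‖r‖ + K * ‖stableProj w r‖ / α + ‖w‖ * ‖r‖ / lam + 1, by positivity, ?_⟩
  intro y h B t₁ hB hc hy hh t ht
  have hsub : Ico 0 t ⊆ Ico 0 t₁ := Ico_subset_Ico_right ht.2
  have h1 := H.norm_le_stable (s := fun τ => stableProj w r (y τ))
    (k := fun τ => stableProj w r (h τ)) (B := ‖stableProj w r‖ * B) ht.1 (by positivity)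
    ((stableProj w r).continuous.comp_continuousOn (hc.mono (Icc_subset_Icc_right ht.2)))
    (fun τ hτ => by
      refine ((stableProj w r).hasFDerivAt.comp_hasDerivWithinAt τ (hy τ (hsub hτ))).congr_deriv ?_
      rw [map_add, H.stableProj_map])
    (H.w_stableProj _) (fun τ _ => H.w_stableProj _)
    (fun τ hτ => (ContinuousLinearMap.le_opNorm _ _).trans
      (mul_le_mul_of_nonneg_left (hh τ (hsub hτ)) n3))
  have h2 := abs_le_of_hasDerivWithinAt_unstable (a := fun τ => w (y τ)) (b := fun τ => w (h τ))
    (B := ‖w‖ * B) hlam (by positivity) (w.continuous.comp_continuousOn hc)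
    (fun τ hτ => by
      refine (w.hasFDerivAt.comp_hasDerivWithinAt τ (hy τ hτ)).congr_deriv ?_
      rw [map_add, H.left_eig_apply])
    (fun τ hτ => by
      rw [← Real.norm_eq_abs]
      exact (ContinuousLinearMap.le_opNorm _ _).trans (mul_le_mul_of_nonneg_left (hh τ hτ) n2)) ht
  have h3 : ‖y t‖ ≤ ‖stableProj w r (y t)‖ + |w (y t)| * ‖r‖ := by
    conv_lhs => rw [← stableProj_add_smul w r (y t)]
    refine (norm_add_le _ _).trans ?_
    rw [norm_smul, Real.norm_eq_abs]
  set X := Real.exp (-α * t) * ‖stableProj w r (y 0)‖ with hX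
  set Y := Real.exp (-lam * (t₁ - t)) * |w (y t₁)| with hY
  have hX0 : 0 ≤ X := by positivity
  have hY0 : 0 ≤ Y := by positivity
  have h1' : ‖stableProj w r (y t)‖ ≤ K * X + K * ‖stableProj w r‖ / α * B := by
    refine h1.trans_eq ?_
    rw [hX]; ring
  have h2' : |w (y t)| * ‖r‖ ≤ ‖r‖ * Y + ‖w‖ * ‖r‖ / lam * B := by
    refine (mul_le_mul_of_nonneg_right h2 n1).trans_eq ?_
    ring
  have p1 : 0 ≤ K * ‖stableProj w r‖ / α := by positivity
  have p2 : 0 ≤ ‖w‖ * ‖r‖ / lam := by positivity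
  generalize K * ‖stableProj w r‖ / α = c₁ at *
  generalize ‖w‖ * ‖r‖ / lam = c₂ at *
  have q1 := mul_nonneg hK hY0
  have q2 := mul_nonneg hK hB
  have q3 := mul_nonneg n1 hX0
  have q4 := mul_nonneg n1 hB
  have q5 := mul_nonneg p1 hX0
  have q6 := mul_nonneg p1 hY0
  have q7 := mul_nonneg p2 hX0
  have q8 := mul_nonneg p2 hY0
  nlinarith

/-- A priori estimate for bounded solutions on `[0, ∞)`. -/
theorem exists_norm_le_of_bounded [CompleteSpace E] (H : UnstableSplitting A w r lam α K) :
    ∃ M : ℝ, 0 < M ∧ ∀ (y h : ℝ → E) (B Q : ℝ), 0 ≤ B →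
      (∀ t, 0 ≤ t → HasDerivWithinAt y (A (y t) + h t) (Ici 0) t) →
      (∀ t, 0 ≤ t → ‖y t‖ ≤ Q) → (∀ t, 0 ≤ t → ‖h t‖ ≤ B) → ∀ t, 0 ≤ t →
      ‖y t‖ ≤ M * (Real.exp (-α * t) * ‖stableProj w r (y 0)‖ + B) := by
  obtain ⟨M, hM, h⟩ := H.exists_norm_le
  refine ⟨M, hM, fun y k B Q hB hy hQ hk t ht => ?_⟩
  have hlam := H.lam_pos
  -- Since `y` is bounded, the term from the end point `t₁` disappears as `t₁ → ∞`.
  have h1 : ∀ᶠ t₁ in atTop, ‖y t‖ ≤ M * (Real.exp (-α * t) * ‖stableProj w r (y 0)‖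
        + Real.exp (-lam * (t₁ - t)) * (‖w‖ * Q) + B) := by
    filter_upwards [eventually_ge_atTop t] with t₁ ht₁
    refine (h y k B t₁ hB (fun τ hτ => ((hy τ hτ.1).continuousWithinAt).mono Icc_subset_Ici_self)
      (fun τ hτ => (hy τ hτ.1).mono (Ici_subset_Ici.2 hτ.1)) (fun τ hτ => hk τ hτ.1) t
      ⟨ht, ht₁⟩).trans ?_
    have : |w (y t₁)| ≤ ‖w‖ * Q := by
      rw [← Real.norm_eq_abs]
      exact (w.le_opNorm _).trans
        (mul_le_mul_of_nonneg_left (hQ t₁ (ht.trans ht₁)) (norm_nonneg w))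
    gcongr
  have h2 : Tendsto (fun t₁ => M * (Real.exp (-α * t) * ‖stableProj w r (y 0)‖
        + Real.exp (-lam * (t₁ - t)) * (‖w‖ * Q) + B)) atTop
      (𝓝 (M * (Real.exp (-α * t) * ‖stableProj w r (y 0)‖ + 0 * (‖w‖ * Q) + B))) := by
    have h3 : Tendsto (fun t₁ => Real.exp (-lam * (t₁ - t))) atTop (𝓝 0) := by
      refine Real.tendsto_exp_atBot.comp ?_
      exact (tendsto_atTop_add_const_right _ (-t) tendsto_id).const_mul_atTop_of_neg (neg_lt_zero.2 hlam)
    exact (((h3.mul_const _).const_add _).add_const _).const_mul _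
  have := ge_of_tendsto h2 h1
  simpa using this

/-- A perturbed linear equation has only decaying bounded solutions. -/
theorem exists_tendsto_zero [CompleteSpace E] (H : UnstableSplitting A w r lam α K) :
    ∃ ε : ℝ, 0 < ε ∧ ∀ (d h : ℝ → E) (Q : ℝ),
      (∀ t, 0 ≤ t → HasDerivWithinAt d (A (d t) + h t) (Ici 0) t) →
      (∀ t, 0 ≤ t → ‖d t‖ ≤ Q) → (∀ t, 0 ≤ t → ‖h t‖ ≤ ε * ‖d t‖) → Tendsto d atTop (𝓝 0) := by
  obtain ⟨M, hM, hest⟩ := H.exists_norm_le_of_bounded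
  refine ⟨1 / (4 * M), by positivity, fun d h Q hd hQ hh => ?_⟩
  have hQ0 : 0 ≤ Q := (norm_nonneg _).trans (hQ 0 le_rfl)
  have hα := H.α_pos
  obtain ⟨τ, hτ0, hτ⟩ : ∃ τ : ℝ, 0 ≤ τ ∧ ∀ t, τ ≤ t →
      Real.exp (-α * t) * ‖stableProj w r‖ ≤ 1 / (4 * M) := by
    have h3 : Tendsto (fun t => Real.exp (-α * t) * ‖stableProj w r‖) atTop
        (𝓝 (0 * ‖stableProj w r‖)) := by
      refine (Real.tendsto_exp_atBot.comp ?_).mul_const _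
      exact tendsto_id.const_mul_atTop_of_neg (neg_lt_zero.2 hα)
    rw [zero_mul] at h3
    have h4 : ∀ᶠ t in atTop, Real.exp (-α * t) * ‖stableProj w r‖ ≤ 1 / (4 * M) :=
      (h3.eventually_lt_const (by positivity)).mono fun _ h => h.le
    obtain ⟨τ, hτ⟩ := eventually_atTop.1 h4
    exact ⟨max τ 0, le_max_right _ _, fun t ht => hτ t ((le_max_left _ _).trans ht)⟩
  -- Restarting the estimate at `kτ` halves the bound each time: after a further time `τ` the
  -- initial data contribute at most `q/4`, and so does the perturbation, because `ε = 1/(4M)`.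
  have hstep : ∀ k : ℕ, ∀ t, k * τ ≤ t → 0 ≤ t → ‖d t‖ ≤ Q / 2 ^ k := by
    intro k
    induction k with
    | zero => intro t _ ht; simpa using hQ t ht
    | succ k ih =>
      intro t ht ht0
      set t₀ := k * τ with ht₀
      have ht₀0 : 0 ≤ t₀ := by positivity
      have htt : t₀ + τ ≤ t := by rw [ht₀]; push_cast at ht; linarith
      set q := Q / 2 ^ k with hq
      have hq0 : 0 ≤ q := by positivity
      have hb : ∀ s, 0 ≤ s → ‖d (t₀ + s)‖ ≤ q := fun s hs =>
        ih _ (by linarith) (by linarith)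
      have h1 := hest (fun s => d (t₀ + s)) (fun s => h (t₀ + s)) (1 / (4 * M) * q) q
        (by positivity)
        (fun s hs => (hd (t₀ + s) (by linarith)).comp_const_add_Ici ht₀0)
        hb
        (fun s hs => (hh _ (by linarith)).trans
          (mul_le_mul_of_nonneg_left (hb s hs) (by positivity)))
        (t - t₀) (by linarith)
      simp only [add_sub_cancel, add_zero] at h1
      have h2 : Real.exp (-α * (t - t₀)) * ‖stableProj w r (d t₀)‖ ≤ 1 / (4 * M) * q := by
        calc Real.exp (-α * (t - t₀)) * ‖stableProj w r (d t₀)‖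
            ≤ Real.exp (-α * (t - t₀)) * (‖stableProj w r‖ * q) := by
              gcongr
              refine (ContinuousLinearMap.le_opNorm _ _).trans ?_
              have := hb 0 le_rfl
              rw [add_zero] at this
              gcongr
          _ = Real.exp (-α * (t - t₀)) * ‖stableProj w r‖ * q := by ring
          _ ≤ _ := by gcongr; exact hτ _ (by linarith)
      calc ‖d t‖ ≤ _ := h1
        _ ≤ M * (1 / (4 * M) * q + 1 / (4 * M) * q) := by gcongr
        _ = Q / 2 ^ (k + 1) := by rw [hq, pow_succ]; field_simp; ring
  rw [Metric.tendsto_atTop]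
  intro ε hε
  obtain ⟨k, hk⟩ : ∃ k : ℕ, Q / 2 ^ k < ε := by
    obtain ⟨k, hk⟩ := exists_pow_lt_of_lt_one (show 0 < ε / (Q + 1) by positivity)
      (by norm_num : (1 / 2 : ℝ) < 1)
    refine ⟨k, ?_⟩
    rw [one_div, inv_pow, lt_div_iff₀ (by positivity)] at hk
    rw [div_eq_inv_mul]
    have : 0 < ((2 : ℝ) ^ k)⁻¹ := by positivity
    nlinarith
  refine ⟨k * τ, fun t ht => ?_⟩
  rw [dist_zero_right]
  exact (hstep k t ht ((by positivity : (0:ℝ) ≤ k * τ).trans ht)).trans_lt hk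

/-- A solution of a perturbed linear equation whose unstable coordinate does not tend to infinity is
bounded. -/
theorem exists_bounded_of_frequently [CompleteSpace E] (H : UnstableSplitting A w r lam α K) :
    ∃ ε : ℝ, 0 < ε ∧ ∀ (v h : ℝ → E) (Q : ℝ),
      (∀ t, 0 ≤ t → HasDerivWithinAt v (A (v t) + h t) (Ici 0) t) →
      (∀ t, 0 ≤ t → ‖h t‖ ≤ ε * ‖v t‖) → (∃ᶠ t in atTop, |w (v t)| ≤ Q) →
      ∃ Q', ∀ t, 0 ≤ t → ‖v t‖ ≤ Q' := by
  obtain ⟨M, hM, hest⟩ := H.exists_norm_le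
  refine ⟨1 / (2 * M), by positivity, fun v h Q hv hh hfreq => ?_⟩
  refine ⟨2 * M * (‖stableProj w r (v 0)‖ + Q), fun t ht => ?_⟩
  obtain ⟨t₁, ht₁, hQ⟩ := frequently_atTop.1 hfreq t
  have hc : ContinuousOn v (Icc 0 t₁) := fun τ hτ =>
    ((hv τ hτ.1).continuousWithinAt).mono Icc_subset_Ici_self
  -- At a maximum of `‖v‖` on `[0, t₁]` the perturbation contributes at most half of that maximum,
  -- by the choice `ε = 1/(2M)`, and is absorbed. The remaining bound does not depend on `t₁`.
  obtain ⟨τ, hτ, hmax⟩ := isCompact_Icc.exists_isMaxOn ⟨t, ht, ht₁⟩ hc.norm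
  have hmax' : ∀ s ∈ Icc 0 t₁, ‖v s‖ ≤ ‖v τ‖ := fun s hs => hmax hs
  have h1 := hest v h (1 / (2 * M) * ‖v τ‖) t₁ (by positivity) hc
    (fun s hs => (hv s hs.1).mono (Ici_subset_Ici.2 hs.1))
    (fun s hs => (hh s hs.1).trans (mul_le_mul_of_nonneg_left (hmax' s ⟨hs.1, hs.2.le⟩)
      (by positivity))) τ hτ
  have e1 : Real.exp (-α * τ) ≤ 1 := Real.exp_le_one_iff.2 (by nlinarith [H.α_pos, hτ.1])
  have e2 : Real.exp (-lam * (t₁ - τ)) ≤ 1 :=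
    Real.exp_le_one_iff.2 (by nlinarith [H.lam_pos, hτ.2])
  have h2 : ‖v τ‖ ≤ M * (1 * ‖stableProj w r (v 0)‖ + 1 * Q + 1 / (2 * M) * ‖v τ‖) := by
    refine h1.trans ?_
    gcongr
  have h3 : M * (1 / (2 * M) * ‖v τ‖) = ‖v τ‖ / 2 := by field_simp
  have := hmax' t ⟨ht, ht₁⟩
  nlinarith

end UnstableSplitting

end LinearEstimates

/-! ### The Lyapunov-Perron operator for bounded solutions of the linear equation. -/

section SolutionOperator

open scoped BoundedContinuousFunction
open MeasureTheory

variable {E : Type*} [NormedAddCommGroup E] [NormedSpace ℝ E]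

/-- The bounded curve `y` has velocity `g` on `[0, ∞)`, and is extended to the left by a constant. -/
def HasVelocity (y : ℝ →ᵇ E) (g : ℝ → E) : Prop :=
  (∀ t, 0 ≤ t → HasDerivWithinAt y (g t) (Ici 0) t) ∧ ∀ t, t ≤ 0 → y t = y 0

/-- The curve on `[0, ∞)` extended to the left by a constant. -/
noncomputable def extendLeft (Y : ℝ → E) (hc : ContinuousOn Y (Ici 0)) (C : ℝ)
    (hb : ∀ t, 0 ≤ t → ‖Y t‖ ≤ C) : ℝ →ᵇ E :=
  BoundedContinuousFunction.ofNormedAddCommGroup (fun t => Y (max t 0))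
    (hc.comp_continuous (continuous_id.max continuous_const) fun t => le_max_right t 0) C
    fun t => hb _ (le_max_right t 0)

theorem extendLeft_apply {Y : ℝ → E} (hc : ContinuousOn Y (Ici 0)) {C : ℝ}
    (hb : ∀ t, 0 ≤ t → ‖Y t‖ ≤ C) {t : ℝ} (ht : 0 ≤ t) : extendLeft Y hc C hb t = Y t := by
  change Y (max t 0) = Y t
  rw [max_eq_left ht]

theorem extendLeft_apply_of_nonpos {Y : ℝ → E} (hc : ContinuousOn Y (Ici 0)) {C : ℝ}
    (hb : ∀ t, 0 ≤ t → ‖Y t‖ ≤ C) {t : ℝ} (ht : t ≤ 0) :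
    extendLeft Y hc C hb t = extendLeft Y hc C hb 0 := by
  change Y (max t 0) = Y (max 0 0)
  rw [max_eq_right ht, max_self]

theorem hasVelocity_extendLeft {Y g : ℝ → E} (hc : ContinuousOn Y (Ici 0)) {C : ℝ}
    (hb : ∀ t, 0 ≤ t → ‖Y t‖ ≤ C) (hY : ∀ t, 0 ≤ t → HasDerivWithinAt Y (g t) (Ici 0) t) :
    HasVelocity (extendLeft Y hc C hb) g :=
  ⟨fun t ht => (hY t ht).congr (fun _ hs => extendLeft_apply hc hb hs) (extendLeft_apply hc hb ht),
    fun _ ht => extendLeft_apply_of_nonpos hc hb ht⟩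

variable {A : E →L[ℝ] E} {w : E →L[ℝ] ℝ} {r : E} {lam α K : ℝ}

namespace UnstableSplitting

/-- The stable component is integrated forward from its initial value. The unstable coordinate must
be `-∫_t^∞ e^{λ(t-s)} w(h(s)) ds`, since any other choice adds a multiple of `e^{λt}`. -/
theorem exists_boundedSolution [CompleteSpace E] (H : UnstableSplitting A w r lam α K) (ξ : E)
    (h : ℝ →ᵇ E) : ∃ y : ℝ →ᵇ E, HasVelocity y (fun t => A (y t) + h t) ∧
      stableProj w r (y 0) = stableProj w r ξ := by
  have hlam := H.lam_pos
  set P := stableProj w r with hP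
  have hwP : ∀ v, w (P v) = 0 := H.w_stableProj
  -- the stable component
  let φ : ℝ → E := fun s => NormedSpace.exp ((-s) • A) (P (h s))
  have hφ : Continuous φ :=
    ((continuous_exp_smul A).comp continuous_neg).clm_apply (P.continuous.comp h.continuous)
  let s : ℝ → E := fun t => NormedSpace.exp (t • A) (P ξ + ∫ τ in (0:ℝ)..t, φ τ)
  have hs : ∀ t, HasDerivAt s (A (s t) + P (h t)) t := by
    intro t
    have h1 := (intervalIntegral.integral_hasDerivAt_right (hφ.intervalIntegrable 0 t)
      (hφ.stronglyMeasurableAtFilter _ _) hφ.continuousAt).const_add (P ξ)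
    have h2 := (hasDerivAt_exp_smul_const' A t).clm_apply h1
    refine h2.congr_deriv ?_
    have h3 : NormedSpace.exp (t • A) (φ t) = P (h t) := by
      have : NormedSpace.exp (t • A) * NormedSpace.exp ((-t) • A) = 1 := by
        let _ : NormedAlgebra ℚ (E →L[ℝ] E) := NormedAlgebra.restrictScalars ℚ ℝ _
        rw [← NormedSpace.exp_add_of_commute, ← add_smul, add_neg_cancel, zero_smul,
          NormedSpace.exp_zero]
        exact ((Commute.refl A).smul_left _).smul_right _
      exact congrArg (fun L : E →L[ℝ] E => L (P (h t))) this
    rw [h3]; rfl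
  have hs0 : s 0 = P ξ := by simp [s]
  have hsb : ∀ t, 0 ≤ t → ‖s t‖ ≤ K * ‖P ξ‖ + K * (‖P‖ * ‖h‖) / α := by
    intro t ht
    refine (H.norm_le_stable (k := fun τ => P (h τ)) (B := ‖P‖ * ‖h‖) ht (by positivity)
      (fun τ _ => (hs τ).continuousAt.continuousWithinAt) (fun τ _ => (hs τ).hasDerivWithinAt)
      (by rw [hs0, hwP]) (fun τ _ => hwP _)
      (fun τ _ => (P.le_opNorm _).trans (by gcongr; exact h.norm_coe_le_norm τ))).trans ?_
    rw [hs0]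
    have e1 : Real.exp (-α * t) ≤ 1 := Real.exp_le_one_iff.2 (by nlinarith [H.α_pos])
    have := H.K_nonneg
    gcongr
    nlinarith
  -- the unstable component
  let ψ : ℝ → ℝ := fun s => Real.exp (-lam * s) * w (h s)
  have hψ : Continuous ψ := by
    have := h.continuous
    fun_prop
  have hψb : ∀ s, ‖ψ s‖ ≤ Real.exp (-lam * s) * (‖w‖ * ‖h‖) := by
    intro s
    rw [norm_mul, Real.norm_eq_abs, Real.abs_exp]
    gcongr
    exact (w.le_opNorm _).trans (by gcongr; exact h.norm_coe_le_norm s)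
  have hdom : ∀ t : ℝ, IntegrableOn (fun s => Real.exp (-lam * s) * (‖w‖ * ‖h‖)) (Ioi t) :=
    fun t => (exp_neg_integrableOn_Ioi t hlam).mul_const _
  have hψi : ∀ t : ℝ, IntegrableOn ψ (Ioi t) := fun t =>
    (hdom t).mono' hψ.aestronglyMeasurable (Eventually.of_forall hψb)
  let J : ℝ := ∫ s in Ioi (0:ℝ), ψ s
  let a : ℝ → ℝ := fun t => -(Real.exp (lam * t) * (J - ∫ s in (0:ℝ)..t, ψ s))
  have ha : ∀ t, HasDerivAt a (lam * a t + w (h t)) t := by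
    intro t
    have h1 := (intervalIntegral.integral_hasDerivAt_right (hψ.intervalIntegrable 0 t)
      (hψ.stronglyMeasurableAtFilter _ _) hψ.continuousAt).const_sub J
    have h2 : HasDerivAt (fun s : ℝ => Real.exp (lam * s)) (lam * Real.exp (lam * t)) t := by
      simpa [mul_comm] using ((hasDerivAt_id t).const_mul lam).exp
    refine (h2.mul h1).neg.congr_deriv ?_
    have h3 : Real.exp (lam * t) * ψ t = w (h t) := by
      simp only [ψ]
      rw [← mul_assoc, ← Real.exp_add]; simp
    have h4 : a t = -(Real.exp (lam * t) * (J - ∫ s in (0:ℝ)..t, ψ s)) := rfl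
    rw [h4]
    linear_combination h3
  have hab : ∀ t, |a t| ≤ ‖w‖ * ‖h‖ / lam := by
    intro t
    have h1 : J - ∫ s in (0:ℝ)..t, ψ s = ∫ s in Ioi t, ψ s := by
      rw [sub_eq_iff_eq_add', intervalIntegral.integral_interval_add_Ioi (hψi 0) (hψi t)]
    have h2 : ‖∫ s in Ioi t, ψ s‖ ≤ Real.exp (-lam * t) / lam * (‖w‖ * ‖h‖) := by
      refine (norm_integral_le_of_norm_le (hdom t) (Eventually.of_forall hψb)).trans_eq ?_
      rw [integral_mul_const, integral_exp_mul_Ioi (neg_lt_zero.2 hlam)]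
      rw [neg_div_neg_eq]
    have h3 : |a t| = Real.exp (lam * t) * ‖∫ s in Ioi t, ψ s‖ := by
      change |-(Real.exp (lam * t) * (J - ∫ s in (0:ℝ)..t, ψ s))| = _
      rw [h1, abs_neg, abs_mul, Real.abs_exp, Real.norm_eq_abs]
    rw [h3]
    refine (mul_le_mul_of_nonneg_left h2 (Real.exp_pos _).le).trans_eq ?_
    have h4 : Real.exp (lam * t) * Real.exp (-lam * t) = 1 := by rw [← Real.exp_add]; simp
    calc _ = (Real.exp (lam * t) * Real.exp (-lam * t)) * (‖w‖ * ‖h‖ / lam) := by ring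
      _ = _ := by rw [h4, one_mul]
  let Y : ℝ → E := fun t => s t + a t • r
  have hY : ∀ t, HasDerivAt Y (A (Y t) + h t) t := by
    intro t
    refine ((hs t).add ((ha t).smul_const r)).congr_deriv ?_
    have h1 : P (h t) + w (h t) • r = h t := stableProj_add_smul w r (h t)
    have h2 : A (Y t) = A (s t) + (lam * a t) • r := by
      simp only [Y]
      rw [map_add, map_smul, H.right_eig, smul_smul, mul_comm]
    rw [h2, add_smul]
    nth_rewrite 3 [← h1]
    abel
  have hYb : ∀ t, 0 ≤ t → ‖Y t‖ ≤ K * ‖P ξ‖ + K * (‖P‖ * ‖h‖) / α + ‖w‖ * ‖h‖ / lam * ‖r‖ := by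
    intro t ht
    refine (norm_add_le _ _).trans (add_le_add (hsb t ht) ?_)
    rw [norm_smul, Real.norm_eq_abs]
    exact mul_le_mul_of_nonneg_right (hab t) (norm_nonneg r)
  have hYc : ContinuousOn Y (Ici 0) := fun t _ => (hY t).continuousAt.continuousWithinAt
  refine ⟨extendLeft Y hYc _ hYb, ?_, ?_⟩
  · have h1 := hasVelocity_extendLeft hYc hYb (fun t _ => (hY t).hasDerivWithinAt)
    refine ⟨fun t ht => ?_, h1.2⟩
    have := h1.1 t ht
    simp only [← extendLeft_apply hYc hYb ht] at this
    exact this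
  · rw [extendLeft_apply hYc hYb le_rfl]
    simp only [Y]
    rw [map_add, map_smul, H.stableProj_right, smul_zero, add_zero, hs0, hP,
      stableProj_of_w_eq_zero (H.w_stableProj ξ)]

/-- The bounded solutions of `ẏ = A y + h` on `[0, ∞)` are parametrized by their initial stable
component, through a continuous linear operator. -/
theorem exists_solutionOperator [CompleteSpace E] (H : UnstableSplitting A w r lam α K) :
    ∃ S : (E × (ℝ →ᵇ E)) →L[ℝ] (ℝ →ᵇ E), ∀ ξ h y, S (ξ, h) = y ↔
      HasVelocity y (fun t => A (y t) + h t) ∧ stableProj w r (y 0) = stableProj w r ξ := by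
  obtain ⟨M, hM, hest⟩ := H.exists_norm_le_of_bounded
  have hbound : ∀ (y h : ℝ →ᵇ E), HasVelocity y (fun t => A (y t) + h t) →
      ‖y‖ ≤ M * (‖stableProj w r (y 0)‖ + ‖h‖) := by
    intro y h hy
    have key : ∀ t, 0 ≤ t → ‖y t‖ ≤ M * (‖stableProj w r (y 0)‖ + ‖h‖) := by
      intro t ht
      refine (hest y h ‖h‖ ‖y‖ (norm_nonneg _) hy.1 (fun t _ => y.norm_coe_le_norm t)
        (fun t _ => h.norm_coe_le_norm t) t ht).trans ?_
      have e1 : Real.exp (-α * t) ≤ 1 := Real.exp_le_one_iff.2 (by nlinarith [H.α_pos])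
      gcongr
      nlinarith [norm_nonneg (stableProj w r (y 0))]
    refine (BoundedContinuousFunction.norm_le (by positivity)).2 fun t => ?_
    rcases le_total 0 t with ht | ht
    · exact key t ht
    · rw [hy.2 t ht]; exact key 0 le_rfl
  -- A difference of two solutions solves the homogeneous equation with zero initial stable
  -- component, so `hbound` makes it vanish. The same uniqueness yields linearity of the chosen
  -- solution map below.
  have huniq : ∀ (y z h : ℝ →ᵇ E), HasVelocity y (fun t => A (y t) + h t) →
      HasVelocity z (fun t => A (z t) + h t) → stableProj w r (y 0) = stableProj w r (z 0) →
      y = z := by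
    intro y z h hy hz h0
    have h1 : HasVelocity (y - z) (fun t => A ((y - z) t) + (0 : ℝ →ᵇ E) t) := by
      refine ⟨fun t ht => ((hy.1 t ht).sub (hz.1 t ht)).congr_deriv ?_, fun t ht => ?_⟩
      · simp
      · simp [hy.2 t ht, hz.2 t ht]
    have h2 := hbound _ _ h1
    simp only [BoundedContinuousFunction.sub_apply, map_sub, h0, sub_self, norm_zero, add_zero,
      mul_zero] at h2
    exact sub_eq_zero.1 (norm_le_zero_iff.1 h2)
  choose S hS hS0 using fun q : E × (ℝ →ᵇ E) => H.exists_boundedSolution q.1 q.2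
  let L : (E × (ℝ →ᵇ E)) →ₗ[ℝ] (ℝ →ᵇ E) :=
    { toFun := S
      map_add' := fun p q => huniq _ _ (p + q).2 (hS _)
        ⟨fun t ht => (((hS p).1 t ht).add ((hS q).1 t ht)).congr_deriv (by simp; abel),
          fun t ht => by simp [(hS p).2 t ht, (hS q).2 t ht]⟩
        (by simp [hS0])
      map_smul' := fun c q => huniq _ _ (c • q).2 (hS _)
        ⟨fun t ht => (((hS q).1 t ht).const_smul c).congr_deriv (by simp),
          fun t ht => by simp [(hS q).2 t ht]⟩
        (by simp [hS0]) }
  refine ⟨L.mkContinuous (M * (‖stableProj w r‖ + 1)) fun q => ?_, fun ξ h y => ⟨?_, ?_⟩⟩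
  · refine (hbound _ _ (hS q)).trans ?_
    rw [hS0, mul_assoc]
    gcongr
    rw [add_mul, one_mul]
    exact add_le_add ((ContinuousLinearMap.le_opNorm _ _).trans (by gcongr; exact norm_fst_le q))
      (norm_snd_le q)
  · rintro rfl
    exact ⟨hS (ξ, h), hS0 (ξ, h)⟩
  · rintro ⟨h1, h2⟩
    exact huniq _ _ h (hS (ξ, h)) h1 ((hS0 (ξ, h)).trans h2.symm)

end UnstableSplitting

end SolutionOperator

/-! ### Superposition operators on bounded curves and their strict derivatives. -/

section Superposition

open scoped BoundedContinuousFunction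

variable {V W : Type*} [NormedAddCommGroup V] [NormedSpace ℝ V] [NormedAddCommGroup W]
  [NormedSpace ℝ W]

/-- The constant functions, as a continuous linear map into the bounded continuous functions. -/
noncomputable def constCLM (V : Type*) [NormedAddCommGroup V] [NormedSpace ℝ V] :
    V →L[ℝ] (ℝ →ᵇ V) :=
  LinearMap.mkContinuous
    { toFun := BoundedContinuousFunction.const ℝ
      map_add' := fun _ _ => rfl
      map_smul' := fun _ _ => rfl } 1
    fun v => by
      rw [one_mul]; exact BoundedContinuousFunction.norm_const_le (α := ℝ) v

@[simp] theorem constCLM_apply (v : V) (t : ℝ) : constCLM V v t = v := rfl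

theorem norm_pointwise_apply_le (L : ℝ →ᵇ (V →L[ℝ] W)) (h : ℝ →ᵇ V) (t : ℝ) :
    ‖L t (h t)‖ ≤ ‖L‖ * ‖h‖ :=
  ((L t).le_opNorm _).trans (mul_le_mul (L.norm_coe_le_norm t) (h.norm_coe_le_norm t)
    (norm_nonneg _) (norm_nonneg L))

/-- Pointwise application of a bounded continuous family of operators. -/
noncomputable def pointwiseApply (L : ℝ →ᵇ (V →L[ℝ] W)) : (ℝ →ᵇ V) →L[ℝ] (ℝ →ᵇ W) :=
  LinearMap.mkContinuous
    { toFun := fun h => BoundedContinuousFunction.ofNormedAddCommGroup (fun t => L t (h t))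
        (L.continuous.clm_apply h.continuous) (‖L‖ * ‖h‖) (norm_pointwise_apply_le L h)
      map_add' := fun _ _ => by ext t; simp
      map_smul' := fun _ _ => by ext t; simp } ‖L‖
    fun h => BoundedContinuousFunction.norm_ofNormedAddCommGroup_le
      (L.continuous.clm_apply h.continuous) (mul_nonneg (norm_nonneg L) (norm_nonneg h))
      (norm_pointwise_apply_le L h)

@[simp] theorem pointwiseApply_apply (L : ℝ →ᵇ (V →L[ℝ] W)) (h : ℝ →ᵇ V) (t : ℝ) :
    pointwiseApply L h t = L t (h t) := rfl

theorem norm_pointwiseApply_le (L : ℝ →ᵇ (V →L[ℝ] W)) : ‖pointwiseApply L‖ ≤ ‖L‖ :=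
  ContinuousLinearMap.opNorm_le_bound _ (norm_nonneg L) fun h =>
    (BoundedContinuousFunction.norm_le (mul_nonneg (norm_nonneg L) (norm_nonneg h))).2
      (norm_pointwise_apply_le L h)

theorem exists_bound_comp [ProperSpace V] {f : V → W} (hf : Continuous f) (y : ℝ →ᵇ V) :
    ∃ C, ∀ t, ‖f (y t)‖ ≤ C := by
  obtain ⟨C, hC⟩ := (isCompact_closedBall (0 : V) ‖y‖).exists_bound_of_continuousOn
    hf.continuousOn
  exact ⟨C, fun t => hC _ (mem_closedBall_zero_iff.2 (y.norm_coe_le_norm t))⟩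

/-- The superposition operator `y ↦ f ∘ y` on bounded continuous functions. -/
noncomputable def superpose [ProperSpace V] (f : V → W) (hf : Continuous f) (y : ℝ →ᵇ V) :
    ℝ →ᵇ W :=
  BoundedContinuousFunction.ofNormedAddCommGroup (fun t => f (y t)) (hf.comp y.continuous) _
    (exists_bound_comp hf y).choose_spec

@[simp] theorem superpose_apply [ProperSpace V] {f : V → W} (hf : Continuous f) (y : ℝ →ᵇ V)
    (t : ℝ) : superpose f hf y t = f (y t) := rfl

/-- All curves within distance 1 of `y₀` take values in one compact ball, where the derivative of
`f` is uniformly continuous. The mean value inequality then bounds the remainder uniformly in `t`.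
-/
theorem hasStrictFDerivAt_superpose [ProperSpace V] {f : V → W} (hf : ContDiff ℝ 1 f)
    (y₀ : ℝ →ᵇ V) :
    HasStrictFDerivAt (superpose f hf.continuous)
      (pointwiseApply (superpose (fderiv ℝ f) (hf.continuous_fderiv one_ne_zero) y₀)) y₀ := by
  refine HasStrictFDerivAt.of_isLittleO (Asymptotics.isLittleO_iff.2 fun c hc => ?_)
  have huc := (isCompact_closedBall (0 : V) (‖y₀‖ + 1)).uniformContinuousOn_of_continuous
    (hf.continuous_fderiv one_ne_zero).continuousOn
  obtain ⟨δ, hδ, h⟩ := Metric.uniformContinuousOn_iff.1 huc c hc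
  have hball : Metric.ball (y₀, y₀) (min δ 1) ∈ 𝓝 (y₀, y₀) :=
    Metric.ball_mem_nhds _ (lt_min hδ one_pos)
  filter_upwards [hball] with q hq
  rw [← ball_prod_same, mem_prod] at hq
  refine (BoundedContinuousFunction.norm_le (by positivity)).2 fun t => ?_
  have hmem : ∀ y : ℝ →ᵇ V, y ∈ Metric.ball y₀ (min δ 1) → y t ∈ Metric.ball (y₀ t) (min δ 1) :=
    fun y hy => (BoundedContinuousFunction.dist_coe_le_dist t).trans_lt hy
  have hsub : ∀ x ∈ Metric.ball (y₀ t) (min δ 1), x ∈ Metric.closedBall (0 : V) (‖y₀‖ + 1) := by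
    intro x hx
    rw [mem_closedBall_zero_iff]
    have h1 : ‖x - y₀ t‖ < 1 := by
      rw [← dist_eq_norm]; exact lt_of_lt_of_le hx (min_le_right _ _)
    have h2 := norm_sub_norm_le x (y₀ t)
    have h3 := y₀.norm_coe_le_norm t
    linarith
  have key := (convex_ball (y₀ t) (min δ 1)).norm_image_sub_le_of_norm_hasFDerivWithin_le'
    (f := f) (f' := fderiv ℝ f) (φ := fderiv ℝ f (y₀ t)) (C := c)
    (fun x _ => (hf.differentiable one_ne_zero x).hasFDerivAt.hasFDerivWithinAt)
    (fun x hx => by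
      rw [← dist_eq_norm]
      exact (h x (hsub x hx) (y₀ t) (hsub _ (Metric.mem_ball_self (lt_min hδ one_pos)))
        (lt_of_lt_of_le hx (min_le_left _ _))).le)
    (hmem _ hq.2) (hmem _ hq.1)
  refine (le_trans (le_of_eq ?_) key).trans ?_
  · rfl
  · gcongr
    exact (q.1 - q.2).norm_coe_le_norm t

/-- The curve `t ↦ (y t, p)`. -/
noncomputable def pairConst (V : Type*) [NormedAddCommGroup V] [NormedSpace ℝ V] :
    ((ℝ →ᵇ V) × ℝ) →L[ℝ] (ℝ →ᵇ (V × ℝ)) :=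
  ((ContinuousLinearMap.inl ℝ V ℝ).compLeftContinuousBounded ℝ).comp (ContinuousLinearMap.fst ℝ _ _)
    + (constCLM (V × ℝ)).comp ((ContinuousLinearMap.inr ℝ V ℝ).comp (ContinuousLinearMap.snd ℝ _ _))

@[simp] theorem pairConst_apply (q : (ℝ →ᵇ V) × ℝ) (t : ℝ) :
    pairConst V q t = (q.1 t, q.2) := by
  simp [pairConst]

end Superposition

section ParametrizedField

open scoped BoundedContinuousFunction

variable {V : Type*} [NormedAddCommGroup V] [NormedSpace ℝ V] [ProperSpace V]

/-- The superposition operator `(y, p) ↦ f(y(·), p)` of a parametrized vector field. -/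
noncomputable def fieldAlong (f : V → ℝ → V) (hf : ContDiff ℝ 1 fun z : V × ℝ => f z.1 z.2)
    (q : (ℝ →ᵇ V) × ℝ) : ℝ →ᵇ V :=
  superpose (fun z : V × ℝ => f z.1 z.2) hf.continuous (pairConst V q)

/-- The derivative of `fieldAlong`. -/
noncomputable def fieldAlongDeriv (f : V → ℝ → V) (hf : ContDiff ℝ 1 fun z : V × ℝ => f z.1 z.2)
    (q : (ℝ →ᵇ V) × ℝ) : ((ℝ →ᵇ V) × ℝ) →L[ℝ] (ℝ →ᵇ V) :=
  (pointwiseApply (superpose (fderiv ℝ fun z : V × ℝ => f z.1 z.2)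
    (hf.continuous_fderiv one_ne_zero) (pairConst V q))).comp (pairConst V)

variable {f : V → ℝ → V} (hf : ContDiff ℝ 1 fun z : V × ℝ => f z.1 z.2)

@[simp] theorem fieldAlong_apply (q : (ℝ →ᵇ V) × ℝ) (t : ℝ) :
    fieldAlong f hf q t = f (q.1 t) q.2 := by
  simp [fieldAlong]

theorem hasStrictFDerivAt_fieldAlong (q : (ℝ →ᵇ V) × ℝ) :
    HasStrictFDerivAt (fieldAlong f hf) (fieldAlongDeriv f hf q) q :=
  (hasStrictFDerivAt_superpose hf (pairConst V q)).comp q (pairConst V).hasStrictFDerivAt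

include hf in
theorem contDiff_field (p : ℝ) : ContDiff ℝ 1 fun x => f x p :=
  hf.comp (contDiff_id.prodMk contDiff_const)

include hf in
theorem fderiv_field (x : V) (p : ℝ) :
    fderiv ℝ (fun x => f x p) x
      = (fderiv ℝ (fun z : V × ℝ => f z.1 z.2) (x, p)).comp (ContinuousLinearMap.inl ℝ V ℝ) :=
  (HasFDerivAt.comp (g := fun z : V × ℝ => f z.1 z.2) (f := fun x => (x, p)) x
    (hf.differentiable one_ne_zero (x, p)).hasFDerivAt (hasFDerivAt_prodMk_left x p)).fderiv

/-- The Jacobian of the vector field along a bounded curve. -/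
noncomputable def jacobianAlong (y : ℝ →ᵇ V) (p : ℝ) : ℝ →ᵇ (V →L[ℝ] V) :=
  superpose (fderiv ℝ fun x => f x p) ((contDiff_field hf p).continuous_fderiv one_ne_zero) y

@[simp] theorem jacobianAlong_apply (y : ℝ →ᵇ V) (p t : ℝ) :
    jacobianAlong hf y p t = fderiv ℝ (fun x => f x p) (y t) := rfl

theorem fieldAlongDeriv_inl (q : (ℝ →ᵇ V) × ℝ) :
    (fieldAlongDeriv f hf q).comp (ContinuousLinearMap.inl ℝ _ _)
      = pointwiseApply (jacobianAlong hf q.1 q.2) := by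
  ext v t
  simp [fieldAlongDeriv, fderiv_field hf]

end ParametrizedField

/-! ### The implicit function theorem in Banach spaces. -/

section ImplicitSolution

variable {X Y Z : Type*} [NormedAddCommGroup X] [NormedSpace ℝ X] [CompleteSpace X]
  [NormedAddCommGroup Y] [NormedSpace ℝ Y] [CompleteSpace Y]
  [NormedAddCommGroup Z] [NormedSpace ℝ Z] [CompleteSpace Z]

/-- The implicit function theorem, in the form in which it is used below. -/
theorem HasStrictFDerivAt.exists_implicit {G : X × Y → Z} {G' : X × Y →L[ℝ] Z} {u : X × Y}
    (hG : HasStrictFDerivAt G G' u) (hinv : (G'.comp (ContinuousLinearMap.inr ℝ X Y)).IsInvertible)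
    (h0 : G u = 0) :
    ∃ (ψ : X → Y) (ψ' : X →L[ℝ] Y), HasStrictFDerivAt ψ ψ' u.1 ∧ ψ u.1 = u.2 ∧
      (∀ᶠ x in 𝓝 u.1, G (x, ψ x) = 0) ∧ (∀ᶠ v in 𝓝 u, G v = 0 → ψ v.1 = v.2) ∧
      ∀ x, G' (x, ψ' x) = 0 := by
  have h1 := hG.eventually_apply_eq_iff_implicitFunctionOfProdDomain hinv
  refine ⟨_, _, hG.hasStrictFDerivAt_implicitFunctionOfProdDomain hinv, h1.self_of_nhds.1 rfl,
    ?_, ?_, fun x => ?_⟩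
  · filter_upwards [hG.eventually_apply_implicitFunctionOfProdDomain hinv] with x hx
    rw [hx, h0]
  · filter_upwards [h1] with v hv hv0
    exact hv.1 (hv0.trans h0.symm)
  · obtain ⟨e, he⟩ := hinv
    rw [← G'.comp_inl_add_comp_inr]
    simp only [← he, ContinuousLinearMap.inverse_equiv]
    simp

end ImplicitSolution

/-! ### Volterra operators and differentiable dependence of solutions on their data. -/

section Volterra

open scoped BoundedContinuousFunction Nat

/-- The nearest point of `[0, 1]`. -/
noncomputable def clamp (t : ℝ) : ℝ := max 0 (min t 1)

theorem clamp_nonneg (t : ℝ) : 0 ≤ clamp t := le_max_left _ _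

theorem clamp_le_one (t : ℝ) : clamp t ≤ 1 := max_le zero_le_one (min_le_right _ _)

theorem clamp_mem (t : ℝ) : clamp t ∈ Icc (0 : ℝ) 1 := ⟨clamp_nonneg t, clamp_le_one t⟩

theorem clamp_of_mem {t : ℝ} (ht : t ∈ Icc (0 : ℝ) 1) : clamp t = t := by
  rw [clamp, min_eq_left ht.2, max_eq_right ht.1]

theorem continuous_clamp : Continuous clamp :=
  continuous_const.max (continuous_id.min continuous_const)

variable {V : Type*} [NormedAddCommGroup V] [NormedSpace ℝ V]

theorem norm_integral_clamp_le (h : ℝ →ᵇ V) (t : ℝ) :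
    ‖∫ s in (0 : ℝ)..clamp t, h s‖ ≤ 1 * ‖h‖ := by
  refine (intervalIntegral.norm_integral_le_of_norm_le_const
    fun s _ => h.norm_coe_le_norm s).trans ?_
  rw [sub_zero, abs_of_nonneg (clamp_nonneg t), mul_comm]
  exact mul_le_mul_of_nonneg_right (clamp_le_one t) (norm_nonneg h)

theorem continuous_integral_clamp (h : ℝ →ᵇ V) :
    Continuous fun t => ∫ s in (0 : ℝ)..clamp t, h s :=
  (intervalIntegral.continuous_primitive (fun a b => h.continuous.intervalIntegrable a b) 0).comp
    continuous_clamp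

/-- Integration from `0`, stopped at the end points of `[0, 1]`. -/
noncomputable def unitIntegral (V : Type*) [NormedAddCommGroup V] [NormedSpace ℝ V] :
    (ℝ →ᵇ V) →L[ℝ] (ℝ →ᵇ V) :=
  LinearMap.mkContinuous
    { toFun := fun h => BoundedContinuousFunction.ofNormedAddCommGroup
        (fun t => ∫ s in (0 : ℝ)..clamp t, h s) (continuous_integral_clamp h) (1 * ‖h‖)
        (norm_integral_clamp_le h)
      map_add' := fun g h => by
        ext t
        exact intervalIntegral.integral_add (g.continuous.intervalIntegrable _ _)
          (h.continuous.intervalIntegrable _ _)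
      map_smul' := fun c h => by
        ext t
        exact intervalIntegral.integral_smul c _ } 1
    fun h => BoundedContinuousFunction.norm_ofNormedAddCommGroup_le
      (continuous_integral_clamp h) (mul_nonneg zero_le_one (norm_nonneg h))
      (norm_integral_clamp_le h)

theorem unitIntegral_apply (h : ℝ →ᵇ V) (t : ℝ) :
    unitIntegral V h t = ∫ s in (0 : ℝ)..clamp t, h s := rfl

theorem unitIntegral_zero (h : ℝ →ᵇ V) : unitIntegral V h 0 = 0 := by
  rw [unitIntegral_apply, clamp_of_mem ⟨le_rfl, zero_le_one⟩, intervalIntegral.integral_same]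

theorem hasDerivWithinAt_unitIntegral [CompleteSpace V] (h : ℝ →ᵇ V) {t : ℝ}
    (ht : t ∈ Icc (0 : ℝ) 1) : HasDerivWithinAt (unitIntegral V h) (h t) (Icc 0 1) t := by
  have h1 := (intervalIntegral.integral_hasDerivAt_right (h.continuous.intervalIntegrable 0 t)
    (h.continuous.stronglyMeasurableAtFilter _ _) h.continuous.continuousAt).hasDerivWithinAt
    (s := Icc (0 : ℝ) 1)
  refine h1.congr (fun s hs => ?_) ?_
  · rw [unitIntegral_apply, clamp_of_mem hs]
  · rw [unitIntegral_apply, clamp_of_mem ht]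

/-- The bound is kept pointwise in `t`, so that integrating `s ^ k` produces the next factor of the
factorial. -/
theorem norm_volterra_pow_apply_le (L : ℝ →ᵇ (V →L[ℝ] V)) (v : ℝ →ᵇ V) (k : ℕ) (t : ℝ) :
    ‖(((unitIntegral V).comp (pointwiseApply L)) ^ k) v t‖ ≤ ‖L‖ ^ k * clamp t ^ k / k ! * ‖v‖ := by
  induction k generalizing t with
  | zero => simpa using v.norm_coe_le_norm t
  | succ k ih =>
    rw [pow_succ', mul_apply_eq_comp, ContinuousLinearMap.comp_apply, unitIntegral_apply]
    have hL := norm_nonneg L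
    have hb : ∀ s ∈ Ioc 0 (clamp t), ‖pointwiseApply L
        ((((unitIntegral V).comp (pointwiseApply L)) ^ k) v) s‖
        ≤ ‖L‖ ^ (k + 1) / k ! * ‖v‖ * s ^ k := by
      intro s hs
      rw [pointwiseApply_apply]
      refine ((L s).le_opNorm _).trans ?_
      have h1 := ih s
      rw [clamp_of_mem ⟨hs.1.le, hs.2.trans (clamp_le_one t)⟩] at h1
      refine (mul_le_mul (L.norm_coe_le_norm s) h1 (norm_nonneg _) hL).trans_eq ?_
      ring
    refine (intervalIntegral.norm_integral_le_of_norm_le (clamp_nonneg t)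
      (Eventually.of_forall hb) (Continuous.intervalIntegrable (by fun_prop) _ _)).trans_eq ?_
    rw [intervalIntegral.integral_const_mul, integral_pow, Nat.factorial_succ]
    push_cast
    have : (k ! : ℝ) ≠ 0 := by positivity
    field_simp
    simp

/-- No smallness of `L` is required: some power `T ^ k` has norm below 1, so `1 - T ^ k` is
invertible, and its factor `1 - T` commutes with the geometric sum that is the other factor. -/
theorem isUnit_one_sub_volterra [CompleteSpace V] (L : ℝ →ᵇ (V →L[ℝ] V)) :
    IsUnit (1 - (unitIntegral V).comp (pointwiseApply L)) := by
  set T := (unitIntegral V).comp (pointwiseApply L) with hT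
  obtain ⟨k, hk⟩ : ∃ k : ℕ, ‖L‖ ^ k / k ! < 1 :=
    ((FloorSemiring.tendsto_pow_div_factorial_atTop ‖L‖).eventually_lt_const one_pos).exists
  have hL := norm_nonneg L
  have h1 : ‖T ^ k‖ < 1 := by
    refine lt_of_le_of_lt (ContinuousLinearMap.opNorm_le_bound _ (by positivity) fun v => ?_) hk
    refine (BoundedContinuousFunction.norm_le (by positivity)).2 fun t => ?_
    refine (norm_volterra_pow_apply_le L v k t).trans ?_
    gcongr
    exact mul_le_of_le_one_right (by positivity) (pow_le_one₀ (clamp_nonneg t) (clamp_le_one t))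
  have h2 := isUnit_one_sub_of_norm_lt_one h1
  rw [← mul_neg_geom_sum] at h2
  refine ((Commute.isUnit_mul_iff ?_).1 h2).1
  exact (Commute.sum_right _ _ _ fun i _ => (Commute.sub_left (Commute.one_left _)
    (Commute.self_pow T i)))

theorem IsUnit.isInvertible {L : V →L[ℝ] V} (h : IsUnit L) : L.IsInvertible := by
  obtain ⟨u, rfl⟩ := h
  exact ⟨ContinuousLinearEquiv.unitsEquiv ℝ V u, rfl⟩

end Volterra

section Flow

open scoped BoundedContinuousFunction

variable {V : Type*} [NormedAddCommGroup V] [NormedSpace ℝ V] [ProperSpace V]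
  {f : V → ℝ → V} (hf : ContDiff ℝ 1 fun z : V × ℝ => f z.1 z.2)

/-- Solutions of the integral equation of `ẏ = τ f(y, p)` on `[0, 1]` depend smoothly on the initial
value, the parameter and the time scale. -/
theorem exists_unitFlow {x₀ : V} {p₀ τ₀ : ℝ} {y₀ : ℝ →ᵇ V}
    (hy₀ : y₀ = constCLM V x₀ + τ₀ • unitIntegral V (fieldAlong f hf (y₀, p₀))) :
    ∃ (S : V × ℝ × ℝ → (ℝ →ᵇ V)) (S' : (V × ℝ × ℝ) →L[ℝ] (ℝ →ᵇ V)),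
      HasStrictFDerivAt S S' (x₀, p₀, τ₀) ∧ S (x₀, p₀, τ₀) = y₀ ∧
      (∀ᶠ q in 𝓝 (x₀, p₀, τ₀),
        S q = constCLM V q.1 + q.2.2 • unitIntegral V (fieldAlong f hf (S q, q.2.1))) ∧
      ∀ v, S' (v, 0, 0) = constCLM V v
        + τ₀ • unitIntegral V (pointwiseApply (jacobianAlong hf y₀ p₀) (S' (v, 0, 0))) := by
  let BC := ℝ →ᵇ V
  let Q := V × ℝ × ℝ
  let ex : (Q × BC) →L[ℝ] V := (ContinuousLinearMap.fst ℝ V (ℝ × ℝ)).comp (ContinuousLinearMap.fst ℝ Q BC)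
  let ep : (Q × BC) →L[ℝ] ℝ := ((ContinuousLinearMap.fst ℝ ℝ ℝ).comp
    (ContinuousLinearMap.snd ℝ V (ℝ × ℝ))).comp (ContinuousLinearMap.fst ℝ Q BC)
  let et : (Q × BC) →L[ℝ] ℝ := ((ContinuousLinearMap.snd ℝ ℝ ℝ).comp
    (ContinuousLinearMap.snd ℝ V (ℝ × ℝ))).comp (ContinuousLinearMap.fst ℝ Q BC)
  let ey : (Q × BC) →L[ℝ] BC := ContinuousLinearMap.snd ℝ Q BC
  let u₀ : Q × BC := ((x₀, p₀, τ₀), y₀)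
  let G : Q × BC → BC := fun u =>
    ey u - constCLM V (ex u) - et u • unitIntegral V (fieldAlong f hf (ey u, ep u))
  let D : (Q × BC) →L[ℝ] BC := ((unitIntegral V).comp (fieldAlongDeriv f hf (y₀, p₀))).comp (ey.prod ep)
  let G' : (Q × BC) →L[ℝ] BC := ey - (constCLM V).comp ex
    - (τ₀ • D + et.smulRight (unitIntegral V (fieldAlong f hf (y₀, p₀))))
  have hG : HasStrictFDerivAt G G' u₀ := by
    have h1 : HasStrictFDerivAt (fun u : Q × BC => unitIntegral V (fieldAlong f hf (ey u, ep u))) D u₀ :=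
      ((unitIntegral V).hasStrictFDerivAt.comp u₀ ((hasStrictFDerivAt_fieldAlong hf (y₀, p₀)).comp u₀
        (ey.prod ep).hasStrictFDerivAt))
    exact (ey.hasStrictFDerivAt.sub ((constCLM V).comp ex).hasStrictFDerivAt).sub
      (et.hasStrictFDerivAt.smul h1)
  -- The partial derivative in the curve is the identity minus a Volterra operator, hence invertible
  -- for every time scale `τ₀`.
  have hinr : G'.comp (ContinuousLinearMap.inr ℝ Q BC)
      = 1 - (unitIntegral V).comp (pointwiseApply (τ₀ • jacobianAlong hf y₀ p₀)) := by
    have h2 := fieldAlongDeriv_inl hf (y₀, p₀)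
    refine ContinuousLinearMap.ext fun v => ?_
    have h3 : fieldAlongDeriv f hf (y₀, p₀) (v, 0) = pointwiseApply (jacobianAlong hf y₀ p₀) v :=
      congrArg (fun L : BC →L[ℝ] BC => L v) h2
    have h4 : pointwiseApply (τ₀ • jacobianAlong hf y₀ p₀) v
        = τ₀ • pointwiseApply (jacobianAlong hf y₀ p₀) v := by
      ext t; simp
    simp [G', D, ex, ep, et, ey, h3, h4]
  obtain ⟨S, S', h1, h2, h3, -, h4⟩ := hG.exists_implicit
    (hinr ▸ (isUnit_one_sub_volterra _).isInvertible) (by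
      simp only [G, u₀, ex, ep, et, ey, ContinuousLinearMap.comp_apply, ContinuousLinearMap.coe_fst',
        ContinuousLinearMap.coe_snd']
      rw [sub_sub, sub_eq_zero]
      exact hy₀)
  refine ⟨S, S', h1, h2, ?_, fun v => ?_⟩
  · filter_upwards [h3] with q hq
    simp only [G, ex, ep, et, ey, ContinuousLinearMap.comp_apply, ContinuousLinearMap.coe_fst',
        ContinuousLinearMap.coe_snd', sub_sub, sub_eq_zero] at hq
    exact hq
  · have h5 := h4 (v, 0, 0)
    have h3 : fieldAlongDeriv f hf (y₀, p₀) (S' (v, 0, 0), 0)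
        = pointwiseApply (jacobianAlong hf y₀ p₀) (S' (v, 0, 0)) :=
      congrArg (fun L : BC →L[ℝ] BC => L (S' (v, 0, 0))) (fieldAlongDeriv_inl hf (y₀, p₀))
    simp only [G', D, ex, ep, et, ey, sub_apply, add_apply, smul_apply,
      ContinuousLinearMap.comp_apply, ContinuousLinearMap.coe_fst', ContinuousLinearMap.coe_snd',
      ContinuousLinearMap.prod_apply, ContinuousLinearMap.smulRight_apply, zero_smul, add_zero,
      h3, sub_sub, sub_eq_zero] at h5
    exact h5

end Flow

/-! ### Trajectories rescaled to unit time, their uniqueness and their flow. -/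

section UnitCurve

open scoped BoundedContinuousFunction NNReal

variable {V : Type*} [NormedAddCommGroup V] [NormedSpace ℝ V]

/-- `η` is the solution of `ẏ = f(y, p)` from `x` up to time `t`, with time scaled to `[0, 1]`. -/
def IsUnitCurve (f : V → ℝ → V) (x : V) (t p : ℝ) (η : ℝ → V) : Prop :=
  η 0 = x ∧ ∀ s ∈ Icc (0 : ℝ) 1, HasDerivWithinAt η (t • f (η s) p) (Icc 0 1) s

variable {f : V → ℝ → V}

theorem IsUnitCurve.continuousOn {x : V} {t p : ℝ} {η : ℝ → V} (h : IsUnitCurve f x t p η) :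
    ContinuousOn η (Icc 0 1) := fun s hs => (h.2 s hs).continuousWithinAt

/-- Both curves stay in a common ball, on which the field is Lipschitz, so the uniqueness theorem
for Lipschitz fields applies. -/
theorem IsUnitCurve.eqOn [ProperSpace V] (hf : ContDiff ℝ 1 fun z : V × ℝ => f z.1 z.2) {x : V}
    {t p : ℝ} {η θ : ℝ → V} (hη : IsUnitCurve f x t p η) (hθ : IsUnitCurve f x t p θ) :
    EqOn η θ (Icc 0 1) := by
  obtain ⟨R, hR⟩ := isCompact_Icc.exists_bound_of_continuousOn hη.continuousOn
  obtain ⟨R', hR'⟩ := isCompact_Icc.exists_bound_of_continuousOn hθ.continuousOn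
  have hg : ContDiff ℝ 1 fun y => t • f y p := (contDiff_field hf p).const_smul t
  obtain ⟨C, hC⟩ := (isCompact_closedBall (0 : V) (max R R')).exists_bound_of_continuousOn
    (hg.continuous_fderiv one_ne_zero).continuousOn
  have hlip : LipschitzOnWith C.toNNReal (fun y => t • f y p) (Metric.closedBall 0 (max R R')) :=
    (convex_closedBall _ _).lipschitzOnWith_of_nnnorm_fderiv_le
      (fun y _ => hg.differentiable one_ne_zero y)
      (fun y hy => by
        rw [← NNReal.coe_le_coe, coe_nnnorm]
        exact (hC y hy).trans (Real.le_coe_toNNReal C))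
  have hder : ∀ {η : ℝ → V}, IsUnitCurve f x t p η → ∀ s ∈ Ico (0 : ℝ) 1,
      HasDerivWithinAt η (t • f (η s) p) (Ici s) s := fun h s hs =>
    (h.2 s ⟨hs.1, hs.2.le⟩).mono_of_mem_nhdsWithin
      (mem_of_superset (Icc_mem_nhdsGE hs.2) (Icc_subset_Icc_left hs.1))
  refine ODE_solution_unique_of_mem_Icc_right (v := fun _ y => t • f y p)
    (s := fun _ => Metric.closedBall 0 (max R R')) (fun _ _ => hlip)
    hη.continuousOn (hder hη) (fun s hs => ?_) hθ.continuousOn (hder hθ) (fun s hs => ?_)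
    (hη.1.trans hθ.1.symm)
  · exact mem_closedBall_zero_iff.2 ((hR s ⟨hs.1, hs.2.le⟩).trans (le_max_left _ _))
  · exact mem_closedBall_zero_iff.2 ((hR' s ⟨hs.1, hs.2.le⟩).trans (le_max_right _ _))

theorem mul_mem_uIcc_zero {s : ℝ} (t : ℝ) (hs : s ∈ Icc (0 : ℝ) 1) : t * s ∈ uIcc 0 t := by
  rcases le_total 0 t with h | h
  · rw [uIcc_of_le h]; exact ⟨mul_nonneg h hs.1, mul_le_of_le_one_right h hs.2⟩
  · rw [uIcc_of_ge h]; constructor <;> nlinarith [hs.1, hs.2]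

theorem isUnitCurve_of_isIntegralCurveOn {x : V} {t p : ℝ} {γ : ℝ → V} (h0 : γ 0 = x)
    (h : IsIntegralCurveOn γ (fun _ y => f y p) (uIcc 0 t)) :
    IsUnitCurve f x t p fun s => γ (t * s) := by
  refine ⟨by simpa using h0, fun s hs => ?_⟩
  have h1 : HasDerivWithinAt (fun s : ℝ => t * s) t (Icc 0 1) s := by
    simpa using ((hasDerivAt_id s).const_mul t).hasDerivWithinAt
  exact HasDerivWithinAt.scomp s (h (t * s) (mul_mem_uIcc_zero t hs)) h1
    fun y hy => mul_mem_uIcc_zero t hy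

theorem IsUnitCurve.rescale {x : V} {t p : ℝ} {η : ℝ → V} (h : IsUnitCurve f x t p η) {a : ℝ}
    (ha : a ∈ Icc (0 : ℝ) 1) : IsUnitCurve f x (t * a) p fun s => η (a * s) := by
  refine ⟨by simpa using h.1, fun s hs => ?_⟩
  have h1 : HasDerivWithinAt (fun s : ℝ => a * s) a (Icc 0 1) s := by
    simpa using ((hasDerivAt_id s).const_mul a).hasDerivWithinAt
  have hm : ∀ y ∈ Icc (0 : ℝ) 1, a * y ∈ Icc (0 : ℝ) 1 := fun y hy =>
    ⟨mul_nonneg ha.1 hy.1, mul_le_one₀ ha.2 hy.1 hy.2⟩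
  refine (HasDerivWithinAt.scomp s (h.2 (a * s) (hm s hs)) h1 hm).congr_deriv ?_
  rw [smul_smul, mul_comm]

theorem IsUnitCurve.isIntegralCurveOn {x : V} {t p : ℝ} {η : ℝ → V} (h : IsUnitCurve f x t p η)
    (ht : t ≠ 0) : IsIntegralCurveOn (fun s => η (t⁻¹ * s)) (fun _ y => f y p) (uIcc 0 t) := by
  intro s hs
  have hm : ∀ y ∈ uIcc 0 t, t⁻¹ * y ∈ Icc (0 : ℝ) 1 := by
    intro y hy
    rcases lt_or_gt_of_ne ht with h | h
    · rw [uIcc_of_ge h.le] at hy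
      have := inv_lt_zero.2 h
      refine ⟨by nlinarith [hy.2], ?_⟩
      rw [← inv_mul_cancel₀ ht]; nlinarith [hy.1]
    · rw [uIcc_of_le h.le] at hy
      have := inv_pos.2 h
      refine ⟨by nlinarith [hy.1], ?_⟩
      rw [← inv_mul_cancel₀ ht]; nlinarith [hy.2]
  have h1 : HasDerivWithinAt (fun s : ℝ => t⁻¹ * s) t⁻¹ (uIcc 0 t) s := by
    simpa using ((hasDerivAt_id s).const_mul t⁻¹).hasDerivWithinAt
  refine (HasDerivWithinAt.scomp s (h.2 (t⁻¹ * s) (hm s hs)) h1 hm).congr_deriv ?_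
  rw [smul_smul, inv_mul_cancel₀ ht, one_smul]

end UnitCurve

section Trajectory

open scoped BoundedContinuousFunction

variable {n : ℕ} {f : State n → ℝ → State n}

theorem HasTrajectory.exists_isUnitCurve {x : State n} {t p : ℝ} (h : HasTrajectory f x t p) :
    ∃ η, IsUnitCurve f x t p η :=
  let ⟨_, h0, h1⟩ := h
  ⟨_, isUnitCurve_of_isIntegralCurveOn h0 h1⟩

theorem IsUnitCurve.hasTrajectory {x : State n} {t p : ℝ} {η : ℝ → State n}
    (h : IsUnitCurve f x t p η) : HasTrajectory f x t p := by
  -- For `t = 0` time cannot be scaled back, but the interval is a single point, within which every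
  -- derivative is admissible.
  by_cases ht : t = 0
  · refine ⟨fun _ => x, rfl, fun s hs => ?_⟩
    rw [ht, uIcc_self] at hs ⊢
    rw [mem_singleton_iff.1 hs]
    exact hasDerivWithinAt_iff_hasFDerivWithinAt.2 (.of_subsingleton subsingleton_singleton)
  · exact ⟨_, by simpa using h.1, h.isIntegralCurveOn ht⟩

variable (hf : ContDiff ℝ 1 fun z : State n × ℝ => f z.1 z.2)

include hf

theorem IsUnitCurve.trajectory_eq_one {x : State n} {t p : ℝ} {η : ℝ → State n}
    (h : IsUnitCurve f x t p η) : trajectory f x t p = η 1 := by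
  have hT := h.hasTrajectory
  rw [trajectory, dif_pos hT]
  have h1 := isUnitCurve_of_isIntegralCurveOn hT.choose_spec.1 hT.choose_spec.2
  have h2 := h1.eqOn hf h (right_mem_Icc.2 zero_le_one)
  simpa using h2

theorem IsUnitCurve.trajectory_eq {x : State n} {t p : ℝ} {η : ℝ → State n}
    (h : IsUnitCurve f x t p η) {s : ℝ} (hs : s ∈ Icc (0 : ℝ) 1) :
    trajectory f x (t * s) p = η s := by
  simpa using (h.rescale hs).trajectory_eq_one hf

theorem trajectory_eq_of_isIntegralCurveOn {x : State n} {t p : ℝ} {γ : ℝ → State n} (h0 : γ 0 = x)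
    (h : IsIntegralCurveOn γ (fun _ y => f y p) (uIcc 0 t)) : trajectory f x t p = γ t := by
  simpa using (isUnitCurve_of_isIntegralCurveOn h0 h).trajectory_eq_one hf

theorem trajectory_eq_of_isIntegralCurveOn_Ici {x : State n} {p : ℝ} {γ : ℝ → State n} (h0 : γ 0 = x)
    (h : IsIntegralCurveOn γ (fun _ y => f y p) (Ici 0)) {t : ℝ} (ht : 0 ≤ t) :
    trajectory f x t p = γ t :=
  trajectory_eq_of_isIntegralCurveOn hf h0 (h.mono (by
    rw [uIcc_of_le ht]; exact Icc_subset_Ici_self))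

/-- The final time enters as a scale factor of the field, so it is varied on the same footing as
initial value and parameter. The rescaled trajectory, frozen outside `[0, 1]`, solves the integral
equation of `exists_unitFlow`, and the last clause is the derivative of that equation in the initial
value. -/
theorem exists_trajectory_flow {x₀ : State n} {T p₀ : ℝ} (hT : HasTrajectory f x₀ T p₀) :
    ∃ (S : State n × ℝ × ℝ → (ℝ →ᵇ State n)) (S' : (State n × ℝ × ℝ) →L[ℝ] (ℝ →ᵇ State n)),
      HasStrictFDerivAt S S' (x₀, p₀, T) ∧
      (∀ᶠ q in 𝓝 (x₀, p₀, T), HasTrajectory f q.1 q.2.2 q.2.1 ∧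
        ∀ s ∈ Icc (0 : ℝ) 1, trajectory f q.1 (q.2.2 * s) q.2.1 = S q s) ∧
      ∀ v, S' (v, 0, 0) 0 = v ∧ ∀ s ∈ Icc (0 : ℝ) 1, HasDerivWithinAt (S' (v, 0, 0))
        (T • fderiv ℝ (fun x => f x p₀) (trajectory f x₀ (T * s) p₀) (S' (v, 0, 0) s))
        (Icc 0 1) s := by
  obtain ⟨η, hη⟩ := hT.exists_isUnitCurve
  have hc : Continuous fun t => η (clamp t) :=
    hη.continuousOn.comp_continuous continuous_clamp clamp_mem
  obtain ⟨C, hC⟩ := isCompact_Icc.exists_bound_of_continuousOn hη.continuousOn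
  let y₀ : ℝ →ᵇ State n := BoundedContinuousFunction.ofNormedAddCommGroup
    (fun t => η (clamp t)) hc C fun t => hC _ (clamp_mem t)
  have hy₀a : ∀ t, y₀ t = η (clamp t) := fun _ => rfl
  have hy₀ : y₀ = constCLM (State n) x₀ + T • unitIntegral (State n) (fieldAlong f hf (y₀, p₀)) := by
    ext1 t
    have h1 : ∫ s in (0 : ℝ)..clamp t, T • (fieldAlong f hf (y₀, p₀)) s = η (clamp t) - η 0 := by
      refine intervalIntegral.integral_eq_sub_of_hasDeriv_right_of_le (clamp_nonneg t)
        (hη.continuousOn.mono (Icc_subset_Icc_right (clamp_le_one t))) (fun s hs => ?_)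
        (Continuous.intervalIntegrable (by fun_prop) _ _)
      have hs' : s ∈ Ioo (0 : ℝ) 1 := ⟨hs.1, hs.2.trans_le (clamp_le_one t)⟩
      have h2 := ((hη.2 s ⟨hs'.1.le, hs'.2.le⟩).hasDerivAt (Icc_mem_nhds hs'.1 hs'.2)).hasDerivWithinAt
        (s := Ioi s)
      simpa [hy₀a, clamp_of_mem ⟨hs'.1.le, hs'.2.le⟩] using h2
    rw [intervalIntegral.integral_smul, hη.1] at h1
    simp only [constCLM_apply, unitIntegral_apply, hy₀a,
      BoundedContinuousFunction.coe_add, Pi.add_apply, BoundedContinuousFunction.coe_smul]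
    rw [h1, add_sub_cancel]
  obtain ⟨S, S', h1, h2, h3, h4⟩ := exists_unitFlow hf hy₀
  refine ⟨S, S', h1, ?_, fun v => ⟨?_, fun s hs => ?_⟩⟩
  · filter_upwards [h3] with q hq
    have hunit : IsUnitCurve f q.1 q.2.2 q.2.1 (S q) := by
      refine ⟨?_, fun s hs => ?_⟩
      · rw [hq]; simp [unitIntegral_zero]
      · have h5 := ((hasDerivWithinAt_unitIntegral (fieldAlong f hf (S q, q.2.1)) hs).const_smul
          q.2.2).const_add q.1
        rw [fieldAlong_apply] at h5
        refine h5.congr (fun t _ => ?_) ?_ <;>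
        · conv_lhs => rw [hq]
          simp
    exact ⟨hunit.hasTrajectory, fun s hs => hunit.trajectory_eq hf hs⟩
  · rw [h4]; simp [unitIntegral_zero]
  · rw [hη.trajectory_eq hf hs]
    have h5 := ((hasDerivWithinAt_unitIntegral
      (pointwiseApply (jacobianAlong hf y₀ p₀) (S' (v, 0, 0))) hs).const_smul T).const_add v
    rw [pointwiseApply_apply, jacobianAlong_apply, hy₀a, clamp_of_mem hs] at h5
    refine h5.congr (fun t _ => ?_) ?_ <;>
    · conv_lhs => rw [h4]
      simp

end Trajectory

/-! ### Differentiable families of bounded solutions near the equilibrium. -/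

section PerronChart

open scoped BoundedContinuousFunction

variable {V : Type*} [NormedAddCommGroup V] [NormedSpace ℝ V] [ProperSpace V]
  {f : V → ℝ → V} (hf : ContDiff ℝ 1 fun z : V × ℝ => f z.1 z.2)
  {A : V →L[ℝ] V} {w : V →L[ℝ] ℝ} {r : V} {lam α K : ℝ}

include hf

/-- Near a bounded solution along which the Jacobian is close to `A`, the bounded solutions form a
smooth family, parametrized by the parameter and the initial value (only the stable component of
which is prescribed). -/
theorem UnstableSplitting.exists_perronChart (H : UnstableSplitting A w r lam α K) :
    ∃ ε : ℝ, 0 < ε ∧ ∀ (y₀ : ℝ →ᵇ V) (p₀ : ℝ), HasVelocity y₀ (fun t => f (y₀ t) p₀) →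
      (∀ t, ‖fderiv ℝ (fun x => f x p₀) (y₀ t) - A‖ ≤ ε) →
      ∃ (Y : V × ℝ → (ℝ →ᵇ V)) (Y' : (V × ℝ) →L[ℝ] (ℝ →ᵇ V)),
        HasStrictFDerivAt Y Y' (y₀ 0, p₀) ∧ Y (y₀ 0, p₀) = y₀ ∧
        (∀ᶠ q in 𝓝 (y₀ 0, p₀), HasVelocity (Y q) (fun t => f (Y q t) q.2) ∧
          stableProj w r (Y q 0) = stableProj w r q.1) ∧
        (∀ᶠ u in 𝓝 ((y₀ 0, p₀), y₀), HasVelocity u.2 (fun t => f (u.2 t) u.1.2) →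
          u.2 0 = u.1.1 → Y u.1 = u.2) ∧
        (∀ v : ℝ →ᵇ V, HasVelocity v (fun t => fderiv ℝ (fun x => f x p₀) (y₀ t) (v t)) →
          Y' (v 0, 0) = v) ∧
        ∀ v, stableProj w r (Y' (v, 0) 0) = stableProj w r v := by
  obtain ⟨S, hS⟩ := H.exists_solutionOperator
  refine ⟨1 / (2 * (‖S‖ + 1)), by positivity, fun y₀ p₀ hy₀ hε => ?_⟩
  let Ac : (ℝ →ᵇ V) →L[ℝ] (ℝ →ᵇ V) := A.compLeftContinuousBounded ℝ
  -- Writing `ẏ = A y + (f(y, p) - A y)` makes the bounded solutions the fixed points of `y ↦ S(ξ,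
  -- f(y, p) - A y)`.
  have hsol : ∀ (ξ : V) (y : (ℝ →ᵇ V)) (p : ℝ), S (ξ, fieldAlong f hf (y, p) - Ac y) = y ↔
      HasVelocity y (fun t => f (y t) p) ∧ stableProj w r (y 0) = stableProj w r ξ := by
    intro ξ y p
    rw [hS]
    simp [Ac]
  let ex : ((V × ℝ) × (ℝ →ᵇ V)) →L[ℝ] V :=
    (ContinuousLinearMap.fst ℝ V ℝ).comp (ContinuousLinearMap.fst ℝ (V × ℝ) (ℝ →ᵇ V))
  let ep : ((V × ℝ) × (ℝ →ᵇ V)) →L[ℝ] ℝ :=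
    (ContinuousLinearMap.snd ℝ V ℝ).comp (ContinuousLinearMap.fst ℝ (V × ℝ) (ℝ →ᵇ V))
  let ey : ((V × ℝ) × (ℝ →ᵇ V)) →L[ℝ] (ℝ →ᵇ V) := ContinuousLinearMap.snd ℝ (V × ℝ) (ℝ →ᵇ V)
  let G : (V × ℝ) × (ℝ →ᵇ V) → (ℝ →ᵇ V) := fun u => ey u - S (ex u, fieldAlong f hf (ey u, ep u) - Ac (ey u))
  let G' : ((V × ℝ) × (ℝ →ᵇ V)) →L[ℝ] (ℝ →ᵇ V) :=
    ey - S.comp (ex.prod ((fieldAlongDeriv f hf (y₀, p₀)).comp (ey.prod ep) - Ac.comp ey))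
  let u₀ : (V × ℝ) × (ℝ →ᵇ V) := ((y₀ 0, p₀), y₀)
  have hG0 : ∀ u, G u = 0 ↔ HasVelocity u.2 (fun t => f (u.2 t) u.1.2) ∧
      stableProj w r (u.2 0) = stableProj w r u.1.1 := by
    intro u
    rw [← hsol, sub_eq_zero]
    exact eq_comm
  have hG : HasStrictFDerivAt G G' u₀ := by
    have h1 : HasStrictFDerivAt (fun u : (V × ℝ) × (ℝ →ᵇ V) => fieldAlong f hf (ey u, ep u))
        ((fieldAlongDeriv f hf (y₀, p₀)).comp (ey.prod ep)) u₀ :=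
      (hasStrictFDerivAt_fieldAlong hf (y₀, p₀)).comp u₀ (ey.prod ep).hasStrictFDerivAt
    exact ey.hasStrictFDerivAt.sub (S.hasStrictFDerivAt.comp u₀
      (ex.hasStrictFDerivAt.prodMk (h1.sub (Ac.comp ey).hasStrictFDerivAt)))
  set J := jacobianAlong hf y₀ p₀ with hJ
  have hfJ : ∀ v : (ℝ →ᵇ V), fieldAlongDeriv f hf (y₀, p₀) (v, 0) = pointwiseApply J v := fun v =>
    congrArg (fun L : (ℝ →ᵇ V) →L[ℝ] (ℝ →ᵇ V) => L v) (fieldAlongDeriv_inl hf (y₀, p₀))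
  let B : ℝ →ᵇ (V →L[ℝ] V) := J - BoundedContinuousFunction.const ℝ A
  have hB : ∀ v : (ℝ →ᵇ V), pointwiseApply B v = pointwiseApply J v - Ac v := by
    intro v; ext t; simp [B, Ac]
  have hBn : ‖B‖ ≤ 1 / (2 * (‖S‖ + 1)) :=
    (BoundedContinuousFunction.norm_le (by positivity)).2 hε
  have hG'v : ∀ (ξ : V) (v : (ℝ →ᵇ V)), G' ((ξ, 0), v) = v - S (ξ, pointwiseApply B v) := by
    intro ξ v
    simp only [G', ex, ep, ey, sub_apply, ContinuousLinearMap.comp_apply,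
      ContinuousLinearMap.prod_apply, ContinuousLinearMap.coe_fst', ContinuousLinearMap.coe_snd',
      hfJ, hB]
  -- The partial derivative in the curve is `1 - S ∘ (J - A)`; the choice `ε = 1/(2(‖S‖+1))` keeps
  -- the subtracted operator below norm 1.
  have hinr : G'.comp (ContinuousLinearMap.inr ℝ (V × ℝ) (ℝ →ᵇ V))
      = 1 - (S.comp (ContinuousLinearMap.inr ℝ V (ℝ →ᵇ V))).comp (pointwiseApply B) := by
    refine ContinuousLinearMap.ext fun v => ?_
    exact hG'v 0 v
  have hunit : IsUnit (1 - (S.comp (ContinuousLinearMap.inr ℝ V (ℝ →ᵇ V))).comp (pointwiseApply B)) := by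
    refine isUnit_one_sub_of_norm_lt_one (lt_of_le_of_lt
      (ContinuousLinearMap.opNorm_le_bound _ (M := ‖S‖ * ‖B‖)
        (mul_nonneg (norm_nonneg S) (norm_nonneg B)) fun v => ?_) ?_)
    · refine (S.le_opNorm _).trans ?_
      rw [mul_assoc]
      refine mul_le_mul_of_nonneg_left ?_ (norm_nonneg S)
      change ‖((0 : V), pointwiseApply B v)‖ ≤ _
      rw [Prod.norm_mk, norm_zero, max_eq_right (norm_nonneg (pointwiseApply B v))]
      exact (ContinuousLinearMap.le_opNorm _ _).trans
        (mul_le_mul_of_nonneg_right (norm_pointwiseApply_le B) (norm_nonneg v))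
    · have h1 : ‖S‖ * ‖B‖ ≤ ‖S‖ * (1 / (2 * (‖S‖ + 1))) :=
        mul_le_mul_of_nonneg_left hBn (norm_nonneg S)
      refine h1.trans_lt ?_
      have := norm_nonneg S
      rw [mul_one_div, div_lt_one (by positivity)]
      linarith
  have hinv := hunit.isInvertible
  rw [← hinr] at hinv
  obtain ⟨Y, Y', h1, h2, h3, h4, h5⟩ := hG.exists_implicit hinv ((hG0 u₀).2 ⟨hy₀, rfl⟩)
  refine ⟨Y, Y', h1, h2, ?_, ?_, fun v hv => ?_, fun v => ?_⟩
  · filter_upwards [h3] with q hq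
    exact (hG0 _).1 hq
  · filter_upwards [h4] with u hu h6 h7
    exact hu ((hG0 u).2 ⟨h6, by rw [h7]⟩)
  -- Both `v` and `Y'(v(0), 0)` solve the linearized equation with the same data, so injectivity of
  -- the partial derivative identifies them.
  · have h6 : G' ((v 0, 0), v) = 0 := by
      rw [hG'v, sub_eq_zero, eq_comm, hS]
      refine ⟨?_, rfl⟩
      simpa [hB, Ac, hJ] using hv
    have h7 := h5 (v 0, 0)
    have h8 : (G'.comp (ContinuousLinearMap.inr ℝ (V × ℝ) (ℝ →ᵇ V))) (Y' (v 0, 0) - v) = 0 := by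
      have : ContinuousLinearMap.inr ℝ (V × ℝ) (ℝ →ᵇ V) (Y' (v 0, 0) - v)
          = ((v 0, 0), Y' (v 0, 0)) - ((v 0, 0), v) := by simp
      rw [ContinuousLinearMap.comp_apply, this, map_sub, h7, h6, sub_zero]
    exact sub_eq_zero.1 (hinv.injective (h8.trans (map_zero _).symm))
  · have h6 := h5 (v, 0)
    rw [hG'v, sub_eq_zero, eq_comm, hS] at h6
    exact h6.2

theorem exists_norm_fderiv_sub_lt (x₀ : V) (p₀ : ℝ) {ε : ℝ} (hε : 0 < ε) :
    ∃ ρ : ℝ, 0 < ρ ∧ ∀ x ∈ Metric.ball x₀ ρ, ∀ p ∈ Metric.ball p₀ ρ,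
      ‖fderiv ℝ (fun y => f y p) x - fderiv ℝ (fun y => f y p₀) x₀‖ < ε := by
  have hc : Continuous fun z : V × ℝ => fderiv ℝ (fun y => f y z.2) z.1 := by
    simp only [fderiv_field hf]
    exact (hf.continuous_fderiv one_ne_zero).clm_comp continuous_const
  obtain ⟨ρ, hρ, h⟩ := Metric.continuousAt_iff.1 (hc.continuousAt (x := (x₀, p₀))) ε hε
  refine ⟨ρ, hρ, fun x hx p hp => ?_⟩
  rw [← dist_eq_norm]
  exact h (x := (x, p)) (max_lt hx hp)

/-- Solutions that stay near the equilibrium converge to it, uniformly in the parameter. -/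
theorem UnstableSplitting.exists_tendsto_equilibrium (H : UnstableSplitting A w r lam α K)
    {e : ℝ → V} {p₀ : ℝ} (hA : fderiv ℝ (fun x => f x p₀) (e p₀) = A) (he : ContinuousAt e p₀)
    (he0 : ∀ᶠ p in 𝓝 p₀, f (e p) p = 0) :
    ∃ ρ : ℝ, 0 < ρ ∧ ∀ᶠ p in 𝓝 p₀, ∀ y : ℝ →ᵇ V, HasVelocity y (fun t => f (y t) p) →
      (∀ t, 0 ≤ t → y t ∈ Metric.ball (e p₀) ρ) → Tendsto y atTop (𝓝 (e p)) := by
  obtain ⟨ε, hε, hlim⟩ := H.exists_tendsto_zero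
  obtain ⟨ρ, hρ, hder⟩ := exists_norm_fderiv_sub_lt hf (e p₀) p₀ hε
  refine ⟨ρ, hρ, ?_⟩
  filter_upwards [he0, he.preimage_mem_nhds (Metric.ball_mem_nhds _ hρ),
    Metric.ball_mem_nhds p₀ hρ] with p hp0 hpe hp y hy hyρ
  -- Since `e(p)` lies in the ball too, the mean value inequality bounds the nonlinear remainder by
  -- `ε ‖y - e(p)‖`; the limit is therefore `e(p)` itself and not merely a point near `e(p₀)`.
  have hdiff := hlim (fun t => y t - e p) (fun t => f (y t) p - A (y t - e p)) (‖y‖ + ‖e p‖)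
    (fun t ht => ((hy.1 t ht).sub_const (e p)).congr_deriv (by abel))
    (fun t _ => (norm_sub_le _ _).trans (by gcongr; exact y.norm_coe_le_norm t))
    (fun t ht => by
      have key := (convex_ball (e p₀) ρ).norm_image_sub_le_of_norm_fderiv_le'
        (f := fun x => f x p) (φ := A) (C := ε)
        (fun x _ => (contDiff_field hf p).differentiable one_ne_zero x)
        (fun x hx => by rw [← hA]; exact (hder x hx p hp).le) hpe (hyρ t ht)
      simpa [hp0] using key)
  simpa using hdiff.add_const (e p)

end PerronChart

section LocalContinuity

/-- `stableManifoldTangent` asks for curves continuous near `0`; strict differentiability supplies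
this through a local Lipschitz bound. -/
theorem HasStrictFDerivAt.eventually_continuousAt {X Y : Type*} [NormedAddCommGroup X]
    [NormedSpace ℝ X] [NormedAddCommGroup Y] [NormedSpace ℝ Y] {g : X → Y} {g' : X →L[ℝ] Y} {x : X}
    (h : HasStrictFDerivAt g g' x) : ∀ᶠ y in 𝓝 x, ContinuousAt g y := by
  obtain ⟨C, s, hs, hL⟩ := h.exists_lipschitzOnWith
  filter_upwards [eventually_mem_nhds_iff.2 hs] with y hy
  exact hL.continuousOn.continuousAt hy

end LocalContinuity

/-! ### Reversing, extending and differentiating trajectories. -/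

section TrajectoryTools

open scoped BoundedContinuousFunction

variable {n : ℕ} {f : State n → ℝ → State n}

theorem IsUnitCurve.reverse {x : State n} {t p : ℝ} {η : ℝ → State n} (h : IsUnitCurve f x t p η) :
    IsUnitCurve f (η 1) (-t) p fun s => η (1 - s) := by
  refine ⟨by simp, fun s hs => ?_⟩
  have hm : ∀ y ∈ Icc (0 : ℝ) 1, 1 - y ∈ Icc (0 : ℝ) 1 := fun y hy =>
    ⟨by linarith [hy.2], by linarith [hy.1]⟩
  have h1 : HasDerivWithinAt (fun s : ℝ => 1 - s) (-1) (Icc 0 1) s :=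
    ((hasDerivAt_id s).const_sub 1).hasDerivWithinAt
  refine (HasDerivWithinAt.scomp s (h.2 (1 - s) (hm s hs)) h1 hm).congr_deriv ?_
  simp

variable (hf : ContDiff ℝ 1 fun z : State n × ℝ => f z.1 z.2)

theorem HasVelocity.isIntegralCurveOn {y : ℝ →ᵇ State n} {p : ℝ}
    (hy : HasVelocity y fun t => f (y t) p) :
    IsIntegralCurveOn y (fun _ x => f x p) (Ici 0) := hy.1

theorem IsIntegralCurveOn.hasTrajectory {γ : ℝ → State n} {p t : ℝ}
    (h : IsIntegralCurveOn γ (fun _ y => f y p) (Ici 0)) (ht : 0 ≤ t) :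
    HasTrajectory f (γ 0) t p :=
  ⟨γ, rfl, h.mono (by rw [uIcc_of_le ht]; exact Icc_subset_Ici_self)⟩

include hf

theorem hasTrajectory_neg {x : State n} {t p : ℝ} (h : HasTrajectory f x t p) :
    HasTrajectory f (trajectory f x t p) (-t) p ∧
      trajectory f (trajectory f x t p) (-t) p = x := by
  obtain ⟨η, hη⟩ := h.exists_isUnitCurve
  rw [hη.trajectory_eq_one hf]
  refine ⟨hη.reverse.hasTrajectory, ?_⟩
  rw [hη.reverse.trajectory_eq_one hf, sub_self, hη.1]

theorem exists_integralCurve_extending {x : State n} {T p : ℝ} (hT0 : 0 ≤ T)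
    (hT : HasTrajectory f x T p) {y : ℝ → State n} (hy0 : y 0 = trajectory f x T p)
    (hy : IsIntegralCurveOn y (fun _ z => f z p) (Ici 0)) :
    ∃ γ : ℝ → State n, γ 0 = x ∧ IsIntegralCurveOn γ (fun _ z => f z p) (Ici 0) ∧
      ∀ t, 0 ≤ t → γ (T + t) = y t := by
  obtain ⟨a, ha0, ha⟩ := hT
  have haT : a T = y 0 := by rw [hy0, trajectory_eq_of_isIntegralCurveOn hf ha0 ha]
  rw [uIcc_of_le hT0] at ha
  let γ : ℝ → State n := fun t => if t ≤ T then a t else y (t - T)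
  have hγa : ∀ t ≤ T, γ t = a t := fun t ht => if_pos ht
  have hγy : ∀ t, T ≤ t → γ t = y (t - T) := by
    intro t ht
    rcases ht.eq_or_lt with rfl | ht
    · rw [hγa _ le_rfl, haT, sub_self]
    · exact if_neg (not_le.2 ht)
  refine ⟨γ, (hγa 0 hT0).trans ha0, fun t ht => ?_, fun t ht => ?_⟩
  · rw [← Icc_union_Ici_eq_Ici hT0]
    refine HasDerivWithinAt.union ?_ ?_
    · by_cases htT : t ≤ T
      · rw [hγa t htT]
        exact (ha t ⟨ht, htT⟩).congr (fun s hs => hγa s hs.2) (hγa t htT)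
      · exact HasFDerivWithinAt.of_notMem_closure (by
          rw [closure_Icc]; exact fun h => htT h.2)
    · by_cases htT : T ≤ t
      · rw [hγy t htT]
        have h1 : HasDerivWithinAt (fun s : ℝ => s - T) 1 (Ici T) t :=
          ((hasDerivAt_id t).sub_const T).hasDerivWithinAt
        have h2 := HasDerivWithinAt.scomp (t' := Ici 0) t (hy (t - T) (sub_nonneg.2 htT)) h1
          (fun s hs => sub_nonneg.2 hs)
        rw [one_smul] at h2
        exact h2.congr (fun s hs => hγy s hs) (hγy t htT)
      · exact HasFDerivWithinAt.of_notMem_closure (by rw [closure_Ici]; exact htT)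
  · rw [hγy _ (le_add_of_nonneg_right ht), add_sub_cancel_left]

theorem mem_stableManifold_of_trajectory_mem {x e : State n} {T p : ℝ} (hT0 : 0 ≤ T)
    (hT : HasTrajectory f x T p) (h : trajectory f x T p ∈ stableManifold f p e) :
    x ∈ stableManifold f p e := by
  obtain ⟨y, hy0, hy, hlim⟩ := h
  obtain ⟨γ, h0, h1, h2⟩ := exists_integralCurve_extending hf hT0 hT hy0 hy
  refine ⟨γ, h0, h1, ?_⟩
  have h3 : Tendsto (fun t => y (t - T)) atTop (𝓝 e) :=
    hlim.comp (tendsto_atTop_add_const_right _ (-T) tendsto_id)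
  refine h3.congr' ?_
  filter_upwards [eventually_ge_atTop T] with t ht
  rw [← h2 (t - T) (sub_nonneg.2 ht), add_sub_cancel]

/-- The time derivative and the one-sided derivative given by the equation are compared at the right
end point of the rescaled curve; `T ≠ 0` allows the scale factor to be cancelled. -/
theorem sensitivityTime_eq {x d : State n} {T p : ℝ} (hT0 : T ≠ 0) (hT : HasTrajectory f x T p)
    (hd : HasDerivAt (fun s => trajectory f x s p) d T) : d = f (trajectory f x T p) p := by
  obtain ⟨η, hη⟩ := hT.exists_isUnitCurve
  have h1 := hη.2 1 (right_mem_Icc.2 zero_le_one)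
  rw [← hη.trajectory_eq_one hf] at h1
  have h2 : HasDerivWithinAt (fun s => trajectory f x (T * s) p) (T • d) (Icc 0 1) 1 := by
    have h3 : HasDerivAt (fun s : ℝ => T * s) T 1 := by
      simpa using (hasDerivAt_id (1 : ℝ)).const_mul T
    have hd' : HasDerivAt (fun s => trajectory f x s p) d (T * 1) := by rwa [mul_one]
    exact (HasDerivAt.scomp (1 : ℝ) hd' h3).hasDerivWithinAt
  have h3 := h2.congr (f₁ := η) (fun s hs => (hη.trajectory_eq hf hs).symm)
    (hη.trajectory_eq hf (right_mem_Icc.2 zero_le_one)).symm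
  have h4 := (uniqueDiffOn_Icc_zero_one 1 (right_mem_Icc.2 zero_le_one)).eq_deriv _ h3 h1
  exact smul_right_injective _ hT0 h4

/-- The trajectory is strictly differentiable in initial value, parameter and time, and its
derivative is made up of the trajectory sensitivities. -/
theorem exists_hasStrictFDerivAt_trajectory {x : State n} {T p : ℝ} (hT : HasTrajectory f x T p) :
    ∃ L : (State n × ℝ × ℝ) →L[ℝ] State n,
      HasStrictFDerivAt (fun q : State n × ℝ × ℝ => trajectory f q.1 q.2.2 q.2.1) L (x, p, T) ∧
      ∀ v b c, L (v, b, c) = sensitivityState f x T p v + b • sensitivityParam f x T p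
        + c • sensitivityTime f x T p := by
  obtain ⟨S, S', h1, h2, -⟩ := exists_trajectory_flow hf hT
  have h3 : HasStrictFDerivAt (fun q => S q 1)
      ((BoundedContinuousFunction.evalCLM ℝ (1 : ℝ)).comp S') (x, p, T) :=
    (BoundedContinuousFunction.evalCLM ℝ (1 : ℝ)).hasStrictFDerivAt.comp _ h1
  have h4 : HasStrictFDerivAt (fun q : State n × ℝ × ℝ => trajectory f q.1 q.2.2 q.2.1)
      ((BoundedContinuousFunction.evalCLM ℝ (1 : ℝ)).comp S') (x, p, T) := by
    refine h3.congr_of_eventuallyEq ?_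
    filter_upwards [h2] with q hq
    simpa using (hq.2 1 (right_mem_Icc.2 zero_le_one)).symm
  generalize (BoundedContinuousFunction.evalCLM ℝ (1 : ℝ)).comp S' = L at h4
  have e1 : HasFDerivAt (fun y => trajectory f y T p)
      (L.comp (ContinuousLinearMap.inl ℝ (State n) (ℝ × ℝ))) x :=
    HasFDerivAt.comp (g := fun q : State n × ℝ × ℝ => trajectory f q.1 q.2.2 q.2.1)
      (f := fun y => (y, p, T)) x h4.hasFDerivAt (hasFDerivAt_prodMk_left x (p, T))
  have e2 : HasDerivAt (fun q => trajectory f x T q) (L (0, 1, 0)) p :=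
    HasFDerivAt.comp_hasDerivAt (l := fun q : State n × ℝ × ℝ => trajectory f q.1 q.2.2 q.2.1)
      (f := fun q : ℝ => (x, q, T)) p h4.hasFDerivAt
      ((hasDerivAt_const p x).prodMk ((hasDerivAt_id p).prodMk (hasDerivAt_const p T)))
  have e3 : HasDerivAt (fun s => trajectory f x s p) (L (0, 0, 1)) T :=
    HasFDerivAt.comp_hasDerivAt (l := fun q : State n × ℝ × ℝ => trajectory f q.1 q.2.2 q.2.1)
      (f := fun s : ℝ => (x, p, s)) T h4.hasFDerivAt
      ((hasDerivAt_const T x).prodMk ((hasDerivAt_const T p).prodMk (hasDerivAt_id T)))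
  refine ⟨L, h4, fun v b c => ?_⟩
  rw [sensitivityState, sensitivityParam, sensitivityTime, e1.fderiv, e2.deriv, e3.deriv,
    ← map_smul, ← map_smul, ContinuousLinearMap.comp_apply, ← map_add, ← map_add]
  simp

theorem eventually_hasTrajectory {x : State n} {T p : ℝ} (hT : HasTrajectory f x T p) :
    ∀ᶠ q in 𝓝 (x, p, T), HasTrajectory f q.1 q.2.2 q.2.1 := by
  obtain ⟨S, S', h1, h2, -⟩ := exists_trajectory_flow hf hT
  exact h2.mono fun q hq => hq.1

theorem eventually_dist_trajectory_lt {x : State n} {T p : ℝ} (hT0 : 0 < T)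
    (hT : HasTrajectory f x T p) {ε : ℝ} (hε : 0 < ε) :
    ∀ᶠ q in 𝓝 (x, p), ∀ t ∈ Icc 0 T,
      dist (trajectory f q.1 t q.2) (trajectory f x t p) < ε := by
  obtain ⟨S, S', h1, h2, -⟩ := exists_trajectory_flow hf hT
  have h3 := h1.continuousAt.preimage_mem_nhds (Metric.ball_mem_nhds _ hε)
  have hc : Tendsto (fun q : State n × ℝ => (q.1, q.2, T)) (𝓝 (x, p)) (𝓝 (x, p, T)) := by
    refine Continuous.tendsto ?_ (x, p)
    fun_prop
  filter_upwards [hc.eventually h2, hc.eventually h3] with q hq hq' t ht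
  have ht' : t / T ∈ Icc (0 : ℝ) 1 := ⟨div_nonneg ht.1 hT0.le, (div_le_one hT0).2 ht.2⟩
  have e1 := hq.2 _ ht'
  have e2 := h2.self_of_nhds.2 _ ht'
  simp only [mul_div_cancel₀ t hT0.ne'] at e1 e2
  rw [e1, e2]
  exact (BoundedContinuousFunction.dist_coe_le_dist _).trans_lt hq'

/-- The variational equation along a trajectory. -/
theorem hasDerivWithinAt_sensitivityState {γ : ℝ → State n} {p : ℝ}
    (hγ : IsIntegralCurveOn γ (fun _ y => f y p) (Ici 0)) (v : State n) {t : ℝ} (ht : 0 ≤ t) :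
    HasDerivWithinAt (fun s => sensitivityState f (γ 0) s p v)
      (fderiv ℝ (fun x => f x p) (γ t) (sensitivityState f (γ 0) t p v)) (Ici 0) t := by
  have hT0 : 0 < t + 1 := by linarith
  -- The window reaches beyond `t`, so a derivative within `[0, T]` at `t` is also one within `[0,
  -- ∞)`.
  set T := t + 1 with hTdef
  obtain ⟨S, S', h1, h2, h3⟩ := exists_trajectory_flow hf (hγ.hasTrajectory hT0.le)
  have hsens : ∀ s ∈ Icc (0 : ℝ) 1, sensitivityState f (γ 0) (T * s) p v = S' (v, 0, 0) s := by
    intro s hs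
    have e0 : HasFDerivAt (fun q => S q s)
        ((BoundedContinuousFunction.evalCLM ℝ s).comp S') (γ 0, p, T) :=
      ((BoundedContinuousFunction.evalCLM ℝ s).hasStrictFDerivAt.comp _ h1).hasFDerivAt
    have e1 : HasFDerivAt (fun y => S (y, p, T) s)
        (((BoundedContinuousFunction.evalCLM ℝ s).comp S').comp
          (ContinuousLinearMap.inl ℝ (State n) (ℝ × ℝ))) (γ 0) :=
      HasFDerivAt.comp (g := fun q => S q s) (f := fun y => (y, p, T)) (γ 0)
        e0 (hasFDerivAt_prodMk_left (γ 0) (p, T))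
    have hc : Tendsto (fun y : State n => (y, p, T)) (𝓝 (γ 0)) (𝓝 (γ 0, p, T)) := by
      refine Continuous.tendsto ?_ (γ 0)
      fun_prop
    have e2 : (fun y => trajectory f y (T * s) p) =ᶠ[𝓝 (γ 0)] fun y => S (y, p, T) s := by
      filter_upwards [hc.eventually h2] with y hy
      exact hy.2 s hs
    rw [sensitivityState, e2.fderiv_eq, e1.fderiv]
    rfl
  have hm : ∀ s ∈ Icc 0 T, T⁻¹ * s ∈ Icc (0 : ℝ) 1 := fun s hs =>
    ⟨mul_nonneg (inv_nonneg.2 hT0.le) hs.1, by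
      rw [inv_mul_le_iff₀ hT0, mul_one]; exact hs.2⟩
  have hcancel : ∀ s, T * (T⁻¹ * s) = s := fun s => mul_inv_cancel_left₀ hT0.ne' s
  have htm : t ∈ Icc 0 T := ⟨ht, by linarith⟩
  have e3 := (h3 v).2 _ (hm t htm)
  have e4 : HasDerivWithinAt (fun s : ℝ => T⁻¹ * s) T⁻¹ (Icc 0 T) t := by
    simpa using ((hasDerivAt_id t).const_mul T⁻¹).hasDerivWithinAt
  have e5 := HasDerivWithinAt.scomp t e3 e4 hm
  rw [smul_smul, inv_mul_cancel₀ hT0.ne', one_smul, hcancel,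
    trajectory_eq_of_isIntegralCurveOn_Ici hf rfl hγ ht, ← hsens _ (hm t htm), hcancel] at e5
  have e6 := e5.congr (f₁ := fun s => sensitivityState f (γ 0) s p v)
    (fun s hs => by
      have := hsens _ (hm s hs)
      rwa [hcancel] at this)
    (by
      have := hsens _ (hm t htm)
      rwa [hcancel] at this)
  refine e6.mono_of_mem_nhdsWithin ?_
  exact mem_nhdsWithin.2 ⟨Iio T, isOpen_Iio, by simp [hTdef], fun s hs => ⟨hs.2, hs.1.le⟩⟩

end TrajectoryTools

section Equilibrium

variable {n : ℕ} {f : State n → ℝ → State n}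

/-- The family `e` is only continuous at `p₀`; local uniqueness of the zeros identifies it with the
differentiable implicit branch. -/
theorem hasDerivAt_equilibrium (hf : ContDiff ℝ 1 fun z : State n × ℝ => f z.1 z.2)
    {e : ℝ → State n} {p₀ : ℝ} (he : ContinuousAt e p₀) (he0 : ∀ᶠ p in 𝓝 p₀, f (e p) p = 0)
    (hinv : (stateJacobian f (e p₀) p₀).IsInvertible) :
    HasDerivAt e (equilibriumSensitivity f (e p₀) p₀) p₀ := by
  let G : ℝ × State n → State n := fun u => f u.2 u.1
  have hG1 : ContDiff ℝ 1 G := hf.comp (contDiff_snd.prodMk contDiff_fst)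
  have hG := hG1.hasStrictFDerivAt (x := (p₀, e p₀)) one_ne_zero
  set G' := fderiv ℝ G (p₀, e p₀)
  have h1 : G'.comp (ContinuousLinearMap.inr ℝ ℝ (State n)) = stateJacobian f (e p₀) p₀ :=
    ((HasFDerivAt.comp (g := G) (f := fun x => (p₀, x)) (e p₀) hG.hasFDerivAt
      (hasFDerivAt_prodMk_right p₀ (e p₀))).fderiv).symm
  have h2 : HasDerivAt (fun q => f (e p₀) q) (G' (1, 0)) p₀ :=
    HasFDerivAt.comp_hasDerivAt (l := G) (f := fun q => (q, e p₀)) p₀ hG.hasFDerivAt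
      ((hasDerivAt_id p₀).prodMk (hasDerivAt_const p₀ (e p₀)))
  obtain ⟨ψ, ψ', h3, -, -, h4, h5⟩ := hG.exists_implicit (h1 ▸ hinv) he0.self_of_nhds
  have h6 : e =ᶠ[𝓝 p₀] ψ := by
    have hc : Tendsto (fun p => (p, e p)) (𝓝 p₀) (𝓝 (p₀, e p₀)) := continuousAt_id.prodMk he
    filter_upwards [he0, hc.eventually h4] with p hp hp'
    exact (hp' hp).symm
  have h7 : ψ' 1 = equilibriumSensitivity f (e p₀) p₀ := by
    have h8 := h5 1
    have h9 : ((1 : ℝ), ψ' 1) = (1, 0) + ContinuousLinearMap.inr ℝ ℝ (State n) (ψ' 1) := by simp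
    rw [h9, map_add, ← ContinuousLinearMap.comp_apply, h1] at h8
    rw [equilibriumSensitivity, h2.deriv]
    obtain ⟨L, hL⟩ := hinv
    rw [← hL] at h8 ⊢
    rw [ContinuousLinearMap.inverse_equiv, eq_neg_of_add_eq_zero_left h8]
    simp
  rw [← h7]
  exact (h3.hasFDerivAt.hasDerivAt).congr_of_eventuallyEq h6

end Equilibrium

/-! ### The local stable manifold along the base post-fault trajectory. -/

section LocalStableManifold

open scoped BoundedContinuousFunction

variable {n : ℕ} {f : State n → ℝ → State n}

/-- The chart is centred at a late tail of `γ`, along which the Jacobian is close to that of the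
equilibrium. Since `Y(x, p)(0)` and `x` have the same component in `ker w`, comparing their values
under `w` decides whether they are equal. The clause with `Q` holds because a variational solution
whose unstable coordinate does not escape is bounded, and bounded ones are reproduced by `Y'`. -/
theorem exists_smooth_stableManifold (hf : ContDiff ℝ 1 fun z : State n × ℝ => f z.1 z.2)
    {e : ℝ → State n} {p₀ : ℝ} (he : ContinuousAt e p₀) (he0 : ∀ᶠ p in 𝓝 p₀, f (e p) p = 0)
    (htype : IsTypeOneUEP f (e p₀) p₀) {w : State n →L[ℝ] ℝ} {lam : ℝ} (hw : w ≠ 0)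
    (hlam : 0 < lam) (hw_eig : w.comp (stateJacobian f (e p₀) p₀) = lam • w)
    {γ : ℝ → State n} (hγ : IsIntegralCurveOn γ (fun _ y => f y p₀) (Ici 0))
    (hlim : Tendsto γ atTop (𝓝 (e p₀))) :
    ∃ (T₀ : ℝ) (Y : State n × ℝ → (ℝ →ᵇ State n)) (Y' : (State n × ℝ) →L[ℝ] (ℝ →ᵇ State n)) (δ : ℝ),
      0 < T₀ ∧ 0 < δ ∧ HasStrictFDerivAt Y Y' (γ T₀, p₀) ∧
      (∀ t, 0 ≤ t → Y (γ T₀, p₀) t = γ (T₀ + t)) ∧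
      (∀ᶠ q in 𝓝 (γ T₀, p₀), HasVelocity (Y q) (fun t => f (Y q t) q.2) ∧
        Tendsto (Y q) atTop (𝓝 (e q.2)) ∧ (w q.1 - w (Y q 0) = 0 → Y q 0 = q.1)) ∧
      (∀ᶠ q in 𝓝 (γ T₀, p₀), ∀ y : ℝ →ᵇ State n, HasVelocity y (fun t => f (y t) q.2) →
        y 0 = q.1 → (∀ t, 0 ≤ t → dist (y t) (γ (T₀ + t)) < δ) → Y q = y) ∧
      (∀ (v : ℝ → State n) (Q : ℝ), (∀ t, 0 ≤ t → HasDerivWithinAt v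
        (fderiv ℝ (fun x => f x p₀) (γ (T₀ + t)) (v t)) (Ici 0) t) →
        (∃ᶠ t in atTop, |w (v t)| ≤ Q) → Y' (v 0, 0) 0 = v 0) ∧
      ∀ v, w v - w (Y' (v, 0) 0) = 0 → Y' (v, 0) 0 = v := by
  obtain ⟨r, α, K, H⟩ := exists_unstableSplitting (stateJacobian f (e p₀) p₀) w hw hlam hw_eig
    htype.2.1 htype.2.2
  have hP : ∀ a b : State n, stableProj w r a = stableProj w r b → w b - w a = 0 → a = b := by
    intro a b h1 h2
    rw [← stableProj_add_smul w r a, h1, ← sub_eq_zero.1 h2, stableProj_add_smul]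
  obtain ⟨ε₁, hε₁, hchart⟩ := H.exists_perronChart hf
  obtain ⟨ε₂, hε₂, hfreq⟩ := H.exists_bounded_of_frequently
  obtain ⟨ρ₁, hρ₁, hconv⟩ := H.exists_tendsto_equilibrium hf rfl he he0
  obtain ⟨ρ₂, hρ₂, hder⟩ := exists_norm_fderiv_sub_lt hf (e p₀) p₀ (lt_min hε₁ hε₂)
  -- The other half of the radius is reserved for the distance between the tail of `γ` and a
  -- neighbouring curve of the family.
  have hρ : 0 < min ρ₁ ρ₂ / 2 := half_pos (lt_min hρ₁ hρ₂)
  obtain ⟨T₀, hT₀, hball⟩ : ∃ T₀ : ℝ, 0 < T₀ ∧ ∀ t, T₀ ≤ t → dist (γ t) (e p₀) < min ρ₁ ρ₂ / 2 := by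
    obtain ⟨T, hT⟩ := eventually_atTop.1 (Metric.tendsto_nhds.1 hlim _ hρ)
    exact ⟨max T 1, lt_max_of_lt_right one_pos, fun t ht => hT t ((le_max_left _ _).trans ht)⟩
  have hγ' : ∀ t, 0 ≤ t → HasDerivWithinAt (fun t => γ (T₀ + t)) (f (γ (T₀ + t)) p₀) (Ici 0) t :=
    fun t ht => (hγ (T₀ + t) (add_nonneg hT₀.le ht)).comp_const_add_Ici hT₀.le
  have hγc : ContinuousOn (fun t => γ (T₀ + t)) (Ici 0) := fun t ht => (hγ' t ht).continuousWithinAt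
  have hγb : ∀ t, 0 ≤ t → ‖γ (T₀ + t)‖ ≤ ‖e p₀‖ + min ρ₁ ρ₂ / 2 := by
    intro t ht
    have h1 := hball (T₀ + t) (by linarith)
    rw [dist_eq_norm] at h1
    have h2 := norm_sub_norm_le (γ (T₀ + t)) (e p₀)
    linarith
  let y₀ : ℝ →ᵇ State n := extendLeft _ hγc _ hγb
  have hy₀a : ∀ t, 0 ≤ t → y₀ t = γ (T₀ + t) := fun t ht => extendLeft_apply hγc hγb ht
  have hy₀n : ∀ t, t ≤ 0 → y₀ t = y₀ 0 := fun t ht => extendLeft_apply_of_nonpos hγc hγb ht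
  have hy₀z : y₀ 0 = γ T₀ := by rw [hy₀a 0 le_rfl, add_zero]
  have hy₀v : HasVelocity y₀ fun t => f (y₀ t) p₀ := by
    refine ⟨fun t ht => ?_, hy₀n⟩
    beta_reduce
    rw [hy₀a t ht]
    exact (hasVelocity_extendLeft hγc hγb hγ').1 t ht
  have hy₀d : ∀ t, 0 ≤ t → ‖fderiv ℝ (fun x => f x p₀) (γ (T₀ + t)) - stateJacobian f (e p₀) p₀‖
      < min ε₁ ε₂ := by
    intro t ht
    refine hder _ ?_ p₀ (Metric.mem_ball_self hρ₂)
    have := hball (T₀ + t) (by linarith)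
    have := min_le_right ρ₁ ρ₂
    rw [Metric.mem_ball]
    linarith
  obtain ⟨Y, Y', hY, hY0, hYsol, hYuniq, hYlin, hYproj⟩ := hchart y₀ p₀ hy₀v (fun t => by
    rcases le_total 0 t with ht | ht
    · rw [hy₀a t ht]; exact ((hy₀d t ht).trans_le (min_le_left _ _)).le
    · rw [hy₀n t ht, hy₀a 0 le_rfl]; exact ((hy₀d 0 le_rfl).trans_le (min_le_left _ _)).le)
  rw [hy₀z] at hY hY0 hYsol hYuniq
  rw [nhds_prod_eq, eventually_prod_iff] at hYuniq
  obtain ⟨pa, hpa, pb, hpb, hYu⟩ := hYuniq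
  obtain ⟨δ, hδ, hpb⟩ := Metric.eventually_nhds_iff.1 hpb
  -- Halving `δ` compensates that strict pointwise bounds give only a non-strict bound for the
  -- supremum.
  refine ⟨T₀, Y, Y', δ / 2, hT₀, half_pos hδ, hY, fun t ht => by rw [hY0, hy₀a t ht], ?_, ?_, ?_, ?_⟩
  · have h1 : ∀ᶠ q in 𝓝 (γ T₀, p₀), dist (Y q) y₀ < min ρ₁ ρ₂ / 2 := by
      have := hY.continuousAt.preimage_mem_nhds (Metric.ball_mem_nhds _ hρ)
      rw [hY0] at this
      exact this
    filter_upwards [hYsol, h1, continuousAt_snd.eventually hconv] with q hq hq1 hq2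
    refine ⟨hq.1, hq2 (Y q) hq.1 fun t ht => ?_, fun h => hP _ _ hq.2 h⟩
    have h2 := (BoundedContinuousFunction.dist_coe_le_dist (f := Y q) (g := y₀) t).trans_lt hq1
    rw [hy₀a t ht] at h2
    have h3 := hball (T₀ + t) (by linarith)
    have h4 := dist_triangle (Y q t) (γ (T₀ + t)) (e p₀)
    have h5 := min_le_left ρ₁ ρ₂
    rw [Metric.mem_ball]
    linarith
  · filter_upwards [hpa] with q hq y hy hy0 hyd
    refine hYu (x := q) (y := y) hq (hpb ?_) hy hy0
    refine lt_of_le_of_lt ((BoundedContinuousFunction.dist_le (half_pos hδ).le).2 fun t => ?_)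
      (half_lt_self hδ)
    rcases le_total 0 t with ht | ht
    · rw [hy₀a t ht]; exact (hyd t ht).le
    · rw [hy₀n t ht, hy.2 t ht, hy₀a 0 le_rfl]; exact (hyd 0 le_rfl).le
  · intro v Q hv hvQ
    obtain ⟨Q', hQ'⟩ := hfreq v (fun t => (fderiv ℝ (fun x => f x p₀) (γ (T₀ + t))
      - stateJacobian f (e p₀) p₀) (v t)) Q
      (fun t ht => (hv t ht).congr_deriv (by simp))
      (fun t ht => (ContinuousLinearMap.le_opNorm _ _).trans (by
        gcongr
        exact ((hy₀d t ht).trans_le (min_le_right _ _)).le)) hvQ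
    have hvc : ContinuousOn v (Ici 0) := fun t ht => (hv t ht).continuousWithinAt
    have h1 := hYlin (extendLeft v hvc Q' hQ') (by
      refine ⟨fun t ht => ?_, fun t ht => extendLeft_apply_of_nonpos hvc hQ' ht⟩
      beta_reduce
      rw [extendLeft_apply hvc hQ' ht, hy₀a t ht]
      exact (hasVelocity_extendLeft hvc hQ' hv).1 t ht)
    rw [extendLeft_apply hvc hQ' le_rfl] at h1
    rw [h1, extendLeft_apply hvc hQ' le_rfl]
  · exact fun v hv => hP _ _ (hYproj v) hv

end LocalStableManifold

/-! ### The clearing time: existence, uniqueness and derivative. -/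

section CriticalClearing

open scoped BoundedContinuousFunction

variable {n : ℕ}

theorem sensitivityTime_eq_field {f : State n → ℝ → State n}
    (hf : ContDiff ℝ 1 fun z : State n × ℝ => f z.1 z.2) {x : State n} {T p : ℝ} (hT0 : T ≠ 0)
    (hT : HasTrajectory f x T p) : sensitivityTime f x T p = f (trajectory f x T p) p := by
  obtain ⟨L, hL, -⟩ := exists_hasStrictFDerivAt_trajectory hf hT
  have h : HasDerivAt (fun s => trajectory f x s p) (L (0, 0, 1)) T :=
    HasFDerivAt.comp_hasDerivAt (l := fun q : State n × ℝ × ℝ => trajectory f q.1 q.2.2 q.2.1)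
      (f := fun s : ℝ => (x, p, s)) T hL.hasFDerivAt
      ((hasDerivAt_const T x).prodMk ((hasDerivAt_const T p).prodMk (hasDerivAt_id T)))
  rw [sensitivityTime, h.deriv]
  exact sensitivityTime_eq hf hT0 hT h

/-- Tangent vectors of the stable manifold can be pulled back along the flow. -/
theorem mem_stableManifoldTangent_of_flow {f : State n → ℝ → State n}
    (hf : ContDiff ℝ 1 fun z : State n × ℝ => f z.1 z.2) {x v e : State n} {T p : ℝ} (hT0 : 0 ≤ T)
    (hT : HasTrajectory f x T p) {c : ℝ → State n} (hc0 : c 0 = trajectory f x T p)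
    (hc : HasStrictDerivAt c (sensitivityState f x T p v) 0)
    (hcW : ∀ᶠ s in 𝓝 0, c s ∈ stableManifold f p e) : v ∈ stableManifoldTangent f p e x := by
  obtain ⟨hT', hx⟩ := hasTrajectory_neg hf hT
  obtain ⟨L, hL, -⟩ := exists_hasStrictFDerivAt_trajectory hf hT
  obtain ⟨L', hL', -⟩ := exists_hasStrictFDerivAt_trajectory hf hT'
  have e1 : HasFDerivAt (fun y => trajectory f y T p)
      (L.comp (ContinuousLinearMap.inl ℝ (State n) (ℝ × ℝ))) x :=
    HasFDerivAt.comp (g := fun q : State n × ℝ × ℝ => trajectory f q.1 q.2.2 q.2.1)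
      (f := fun y => (y, p, T)) x hL.hasFDerivAt (hasFDerivAt_prodMk_left x (p, T))
  have e2 : HasFDerivAt (fun y => trajectory f (trajectory f y T p) (-T) p)
      (L'.comp ((L.comp (ContinuousLinearMap.inl ℝ (State n) (ℝ × ℝ))).prod 0)) x :=
    HasFDerivAt.comp (g := fun q : State n × ℝ × ℝ => trajectory f q.1 q.2.2 q.2.1)
      (f := fun y => (trajectory f y T p, p, -T)) x hL'.hasFDerivAt
      (e1.prodMk (hasFDerivAt_const (p, -T) x))
  -- Flowing for time `T` and then `-T` is the identity near `x`; differentiating shows that the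
  -- backward flow returns the transported vector to `v`.
  have hid : (fun y => trajectory f (trajectory f y T p) (-T) p) =ᶠ[𝓝 x] id := by
    have hcy : Tendsto (fun y : State n => (y, p, T)) (𝓝 x) (𝓝 (x, p, T)) := by
      refine Continuous.tendsto ?_ x
      fun_prop
    filter_upwards [hcy.eventually (eventually_hasTrajectory hf hT)] with y hy
    exact (hasTrajectory_neg hf hy).2
  have e3 := (e2.congr_of_eventuallyEq hid.symm).unique (hasFDerivAt_id x)
  have e4 : L' (sensitivityState f x T p v, 0, 0) = v := by
    rw [sensitivityState, e1.fderiv]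
    exact congrArg (fun M : State n →L[ℝ] State n => M v) e3
  rw [← hc0] at hL' hT'
  have e5 : HasStrictDerivAt (fun s => trajectory f (c s) (-T) p) v 0 := by
    have h1 := HasStrictFDerivAt.comp_hasStrictDerivAt (f := fun s => (c s, p, -T)) 0 hL'
      (hc.prodMk (hasStrictDerivAt_const 0 (p, -T)))
    rw [Prod.zero_eq_mk, e4] at h1
    exact h1
  have hct : Tendsto (fun s => (c s, p, -T)) (𝓝 0) (𝓝 (c 0, p, -T)) :=
    hc.hasDerivAt.continuousAt.prodMk continuousAt_const
  refine ⟨_, by rw [hc0, hx], e5.hasDerivAt, ?_⟩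
  filter_upwards [HasStrictFDerivAt.eventually_continuousAt e5.hasStrictFDerivAt, hcW,
    hct.eventually (eventually_hasTrajectory hf hT')] with s hs hsW hsT
  refine ⟨hs, ?_⟩
  obtain ⟨h1, h2⟩ := hasTrajectory_neg hf hsT
  rw [neg_neg] at h1 h2
  exact mem_stableManifold_of_trajectory_mem hf hT0 h1 (h2.symm ▸ hsW)

theorem isInvertible_of_apply_one_ne_zero {L : ℝ →L[ℝ] ℝ} (h : L 1 ≠ 0) : L.IsInvertible := by
  have hL : ∀ x, L x = x * L 1 := fun x => by
    rw [← smul_eq_mul, ← map_smul, smul_eq_mul, mul_one]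
  refine IsUnit.isInvertible ⟨⟨L, (L 1)⁻¹ • 1, ?_, ?_⟩, rfl⟩ <;>
  · ext
    simp [h]

/-- The vector `O₆` may be arbitrary: a constant numerator is lost against a denominator that tends
to infinity in absolute value. -/
theorem exists_criticalClearingBranch {ffault fpost : State n → ℝ → State n}
    (hffault : ContDiff ℝ 1 fun z : State n × ℝ => ffault z.1 z.2)
    (hfpost : ContDiff ℝ 1 fun z : State n × ℝ => fpost z.1 z.2)
    {p₀ : ℝ} {xpre : ℝ → State n} {M₄ : State n} (hxpre : HasDerivAt xpre M₄ p₀)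
    {xcu : ℝ → State n} (hxcu_cont : ContinuousAt xcu p₀)
    (hxcu : ∀ᶠ p in 𝓝 p₀, fpost (xcu p) p = 0) (hxcu_type : IsTypeOneUEP fpost (xcu p₀) p₀)
    {w : State n →L[ℝ] ℝ} {lam : ℝ} (hw : w ≠ 0) (hlam : 0 < lam)
    (hw_eig : w.comp (stateJacobian fpost (xcu p₀) p₀) = lam • w)
    {tcr : ℝ} (htcr : 0 < tcr) (hT : HasTrajectory ffault (xpre p₀) tcr p₀)
    {xcr : State n} (hxcr : xcr = trajectory ffault (xpre p₀) tcr p₀)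
    (hexit : xcr ∈ stableManifold fpost p₀ (xcu p₀))
    (htrans : ffault xcr p₀ ∉ stableManifoldTangent fpost p₀ (xcu p₀) xcr) (O₆ : State n) :
    ∃ (tcl : ℝ → ℝ) (D : ℝ),
      IsCriticalClearingBranch ffault fpost xpre xcu p₀ tcr tcl ∧
      (∀ tcl' : ℝ → ℝ, IsCriticalClearingBranch ffault fpost xpre xcu p₀ tcr tcl' →
        tcl' =ᶠ[𝓝 p₀] tcl) ∧
      HasDerivAt tcl D p₀ ∧
      (∀ᶠ T in atTop, w (sensitivityState fpost xcr T p₀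
        (sensitivityTime ffault (xpre p₀) tcr p₀)) ≠ 0) ∧
      Tendsto (fun T => w (O₆ - sensitivityParam fpost xcr T p₀
          - sensitivityState fpost xcr T p₀ (sensitivityState ffault (xpre p₀) tcr p₀ M₄
            + sensitivityParam ffault (xpre p₀) tcr p₀))
        / w (sensitivityState fpost xcr T p₀ (sensitivityTime ffault (xpre p₀) tcr p₀)))
        atTop (𝓝 D) := by
  obtain ⟨γ, hγ0, hγ, hγlim⟩ := hexit
  obtain ⟨T₀, Y, Y', δ, hT₀, hδ, hY, hYγ, hYsol, hYuniq, hYfreq, hYtan⟩ :=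
    exists_smooth_stableManifold hfpost hxcu_cont hxcu hxcu_type hw hlam hw_eig hγ hγlim
  set M₂ := sensitivityTime ffault (xpre p₀) tcr p₀ with hM₂
  obtain ⟨Lf, hLf, hLfs⟩ := exists_hasStrictFDerivAt_trajectory hffault hT
  have hpT : ∀ t, 0 ≤ t → HasTrajectory fpost xcr t p₀ := fun t ht => hγ0 ▸ hγ.hasTrajectory ht
  have hptraj : ∀ t, 0 ≤ t → trajectory fpost xcr t p₀ = γ t := fun t ht =>
    trajectory_eq_of_isIntegralCurveOn_Ici hfpost hγ0 hγ ht
  obtain ⟨Lp, hLp, hLps⟩ := exists_hasStrictFDerivAt_trajectory hfpost (hpT T₀ hT₀.le)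
  have hM₂f : M₂ = ffault xcr p₀ := by
    rw [hM₂, sensitivityTime_eq_field hffault htcr.ne' hT, hxcr]
  -- transversality
  set v₀ := sensitivityState fpost xcr T₀ p₀ M₂ with hv₀
  -- Otherwise `Y'(v₀, 0)(0) = v₀`, so `s ↦ Y(γ(T₀) + s v₀, p₀)(0)` runs in the stable manifold with
  -- velocity `v₀`; pulled back by the flow it exhibits `M₂` as a tangent vector at `x_cr`.
  have hnd : w v₀ - w (Y' (v₀, 0) 0) ≠ 0 := by
    intro h
    have hy := hYtan v₀ h
    refine htrans (hM₂f ▸ mem_stableManifoldTangent_of_flow hfpost hT₀.le (hpT T₀ hT₀.le)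
      (c := fun s => Y (γ T₀ + s • v₀, p₀) 0) ?_ ?_ ?_)
    · rw [zero_smul, add_zero, hYγ 0 le_rfl, add_zero, hptraj T₀ hT₀.le]
    · have h1 : HasStrictDerivAt (fun s : ℝ => (γ T₀ + s • v₀, p₀)) (v₀, (0 : ℝ)) 0 := by
        have h2 : HasStrictDerivAt (fun s : ℝ => γ T₀ + s • v₀) v₀ 0 := by
          simpa using ((hasStrictDerivAt_id (0 : ℝ)).smul_const v₀).const_add (γ T₀)
        exact h2.prodMk (hasStrictDerivAt_const 0 p₀)
      have h3 : HasStrictFDerivAt Y Y' (γ T₀ + (0 : ℝ) • v₀, p₀) := by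
        rwa [zero_smul, add_zero]
      have h4 := (BoundedContinuousFunction.evalCLM ℝ (0 : ℝ)).hasStrictFDerivAt.comp_hasStrictDerivAt
        (0 : ℝ) (h3.comp_hasStrictDerivAt (0 : ℝ) h1)
      have h5 : BoundedContinuousFunction.evalCLM ℝ (0 : ℝ) (Y' (v₀, 0)) = v₀ := hy
      rw [h5] at h4
      exact h4
    · have h1 : Tendsto (fun s : ℝ => (γ T₀ + s • v₀, p₀)) (𝓝 0) (𝓝 (γ T₀, p₀)) := by
        have : Continuous fun s : ℝ => (γ T₀ + s • v₀, p₀) := by fun_prop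
        simpa using this.tendsto 0
      filter_upwards [h1.eventually hYsol] with s hs
      exact ⟨_, rfl, hs.1.isIntegralCurveOn, hs.2.1⟩
  -- the defining equation of the clearing time
  let A₁ : ((State n × ℝ) × ℝ) →L[ℝ] (State n × ℝ × ℝ) :=
    ((ContinuousLinearMap.fst ℝ (State n) ℝ).comp (ContinuousLinearMap.fst ℝ _ _)).prod
      (((ContinuousLinearMap.snd ℝ (State n) ℝ).comp (ContinuousLinearMap.fst ℝ _ _)).prod
        (ContinuousLinearMap.snd ℝ _ _))
  let ep : ((State n × ℝ) × ℝ) →L[ℝ] ℝ :=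
    (ContinuousLinearMap.snd ℝ (State n) ℝ).comp (ContinuousLinearMap.fst ℝ _ _)
  let u₀ : (State n × ℝ) × ℝ := ((xpre p₀, p₀), tcr)
  let Zcl : (State n × ℝ) × ℝ → State n := fun u => trajectory ffault u.1.1 u.2 u.1.2
  let Z : (State n × ℝ) × ℝ → State n := fun u => trajectory fpost (Zcl u) T₀ u.1.2
  have hZcl0 : Zcl u₀ = xcr := hxcr.symm
  have hZ0 : Z u₀ = γ T₀ := by
    change trajectory fpost (Zcl u₀) T₀ p₀ = γ T₀
    rw [hZcl0, hptraj T₀ hT₀.le]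
  have hZcl : HasStrictFDerivAt Zcl (Lf.comp A₁) u₀ :=
    HasStrictFDerivAt.comp (f := A₁) u₀ hLf A₁.hasStrictFDerivAt
  have hZ : HasStrictFDerivAt Z (Lp.comp ((Lf.comp A₁).prod (ep.prod 0))) u₀ := by
    refine HasStrictFDerivAt.comp (g := fun q : State n × ℝ × ℝ => trajectory fpost q.1 q.2.2 q.2.1)
      (f := fun u => (Zcl u, u.1.2, T₀)) u₀ ?_
      (hZcl.prodMk (ep.hasStrictFDerivAt.prodMk (hasStrictFDerivAt_const T₀ u₀)))
    rw [hZcl0]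
    exact hLp
  set Z' := Lp.comp ((Lf.comp A₁).prod (ep.prod 0)) with hZ'
  have hYZ : HasStrictFDerivAt (fun u => Y (Z u, u.1.2)) (Y'.comp (Z'.prod ep)) u₀ := by
    refine HasStrictFDerivAt.comp (g := Y) (f := fun u => (Z u, u.1.2)) u₀ ?_
      (hZ.prodMk ep.hasStrictFDerivAt)
    rw [hZ0]
    exact hY
  -- Near the base point, `g = 0` says that the bounded solution `Y(Z, p)` starts at `Z` itself.
  let g : (State n × ℝ) × ℝ → ℝ := fun u => w (Z u) - w (Y (Z u, u.1.2) 0)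
  let g' : ((State n × ℝ) × ℝ) →L[ℝ] ℝ :=
    w.comp Z' - (w.comp (BoundedContinuousFunction.evalCLM ℝ (0 : ℝ))).comp (Y'.comp (Z'.prod ep))
  have hg : HasStrictFDerivAt g g' u₀ :=
    (w.hasStrictFDerivAt.comp u₀ hZ).sub
      ((w.comp (BoundedContinuousFunction.evalCLM ℝ (0 : ℝ))).hasStrictFDerivAt.comp u₀ hYZ)
  have hg0 : g u₀ = 0 := by
    change w (Z u₀) - w (Y (Z u₀, p₀) 0) = 0
    rw [hZ0, hYγ 0 le_rfl, add_zero, sub_self]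
  have hZ'1 : Z' (0, 1) = v₀ := by
    have h1 : Lf (A₁ (0, 1)) = M₂ := by
      have : A₁ (0, 1) = (0, 0, 1) := rfl
      rw [this, hLfs]; simp [hM₂]
    have h2 : Z' (0, 1) = Lp (Lf (A₁ (0, 1)), 0, 0) := rfl
    rw [h2, h1, hLps]; simp [hv₀]
  have hinv : (g'.comp (ContinuousLinearMap.inr ℝ (State n × ℝ) ℝ)).IsInvertible := by
    refine isInvertible_of_apply_one_ne_zero ?_
    have h1 : (g'.comp (ContinuousLinearMap.inr ℝ (State n × ℝ) ℝ)) 1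
        = w (Z' (0, 1)) - w (Y' (Z' (0, 1), 0) 0) := rfl
    rw [h1, hZ'1]
    exact hnd
  obtain ⟨τ, τ', hτ, hτ0, hτz, hτu, -⟩ := hg.exists_implicit hinv hg0
  let tcl : ℝ → ℝ := fun p => τ (xpre p, p)
  set D := τ' (M₄, 1) with hD
  have hpair : HasDerivAt (fun p => (xpre p, p)) (M₄, (1 : ℝ)) p₀ := hxpre.prodMk (hasDerivAt_id p₀)
  have htcl : HasDerivAt tcl D p₀ :=
    HasFDerivAt.comp_hasDerivAt (l := τ) (f := fun p => (xpre p, p)) p₀ hτ.hasFDerivAt hpair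
  have htcl0 : tcl p₀ = tcr := hτ0
  let U : ℝ → (State n × ℝ) × ℝ := fun p => ((xpre p, p), tcl p)
  have hU0 : U p₀ = u₀ := by
    change ((xpre p₀, p₀), tcl p₀) = _
    rw [htcl0]
  have hU : HasDerivAt U ((M₄, 1), D) p₀ := hpair.prodMk htcl
  set X := Lf (M₄, 1, D) with hX
  have hxcl : HasDerivAt (fun p => Zcl (U p)) X p₀ :=
    HasFDerivAt.comp_hasDerivAt (l := Zcl) (f := U) (l' := Lf.comp A₁) p₀
      (by rw [hU0]; exact hZcl.hasFDerivAt) hU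
  have hz : HasDerivAt (fun p => Z (U p)) (Z' ((M₄, 1), D)) p₀ :=
    HasFDerivAt.comp_hasDerivAt (l := Z) (f := U) p₀ (by rw [hU0]; exact hZ.hasFDerivAt) hU
  have hYz : HasDerivAt (fun p => Y (Z (U p), p)) (Y' (Z' ((M₄, 1), D), 1)) p₀ := by
    refine HasFDerivAt.comp_hasDerivAt (l := Y) (f := fun p => (Z (U p), p)) p₀ ?_
      (hz.prodMk (hasDerivAt_id p₀))
    rw [hU0, hZ0]
    exact hY.hasFDerivAt
  -- the trajectories cleared at any branch of clearing times near the critical one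
  have hgen : ∀ t' : ℝ → ℝ, t' p₀ = tcr → ContinuousAt t' p₀ →
      Tendsto (fun p => ((xpre p, p), t' p)) (𝓝 p₀) (𝓝 u₀) ∧
      Tendsto (fun p => (Zcl ((xpre p, p), t' p), p)) (𝓝 p₀) (𝓝 (xcr, p₀)) ∧
      Tendsto (fun p => (Z ((xpre p, p), t' p), p)) (𝓝 p₀) (𝓝 (γ T₀, p₀)) := by
    intro t' h0 hc
    have h1 : Tendsto (fun p => ((xpre p, p), t' p)) (𝓝 p₀) (𝓝 u₀) := by
      have := hpair.continuousAt.prodMk hc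
      rw [ContinuousAt, h0] at this
      exact this
    refine ⟨h1, ?_, ?_⟩
    · have h2 := hZcl.continuousAt.tendsto.comp h1
      rw [hZcl0] at h2
      exact h2.prodMk_nhds tendsto_id
    · have h2 := hZ.continuousAt.tendsto.comp h1
      rw [hZ0] at h2
      exact h2.prodMk_nhds tendsto_id
  obtain ⟨hUt, hclt, hzt⟩ := hgen tcl htcl0 htcl.continuousAt
  have hclT : ∀ t, 0 ≤ t → ∀ᶠ q in 𝓝 (xcr, p₀), HasTrajectory fpost q.1 t q.2 := by
    intro t ht
    have hc : Tendsto (fun q : State n × ℝ => (q.1, q.2, t)) (𝓝 (xcr, p₀)) (𝓝 (xcr, p₀, t)) := by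
      refine Continuous.tendsto ?_ (xcr, p₀)
      fun_prop
    exact hc.eventually (eventually_hasTrajectory hfpost (hpT t ht))
  -- After time `T₀` the post-fault trajectory is the curve `Y(Z, p)`. One neighbourhood of `p₀`
  -- serves all `t`, which both the uniform convergence and the differentiation below rely on.
  have hmain : ∀ᶠ p in 𝓝 p₀, HasTrajectory ffault (xpre p) (tcl p) p ∧
      Zcl (U p) ∈ stableManifold fpost p (xcu p) ∧
      ∀ t, 0 ≤ t → trajectory fpost (Zcl (U p)) (T₀ + t) p = Y (Z (U p), p) t := by
    have hc : Tendsto (fun p => (xpre p, p, tcl p)) (𝓝 p₀) (𝓝 (xpre p₀, p₀, tcr)) := by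
      have := hxpre.continuousAt.prodMk (continuousAt_id.prodMk htcl.continuousAt)
      rw [ContinuousAt, htcl0] at this
      exact this
    filter_upwards [hc.eventually (eventually_hasTrajectory hffault hT), hzt.eventually hYsol,
      hclt.eventually (hclT T₀ hT₀.le), hpair.continuousAt.eventually hτz] with p h1 h2 h3 h4
    have h5 : Y (Z (U p), p) 0 = trajectory fpost (Zcl (U p)) T₀ p := h2.2.2 h4
    obtain ⟨θ, hθ0, hθ, hθy⟩ := exists_integralCurve_extending hfpost hT₀.le h3 h5
      h2.1.isIntegralCurveOn
    refine ⟨h1, mem_stableManifold_of_trajectory_mem hfpost hT₀.le h3 ?_, fun t ht => ?_⟩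
    · exact ⟨_, h5, h2.1.isIntegralCurveOn, h2.2.1⟩
    · rw [trajectory_eq_of_isIntegralCurveOn_Ici hfpost hθ0 hθ (add_nonneg hT₀.le ht), hθy t ht]
  have hbranch : IsCriticalClearingBranch ffault fpost xpre xcu p₀ tcr tcl := by
    refine ⟨htcl0, htcl.continuousAt, hmain.mono fun p hp => ⟨hp.1, hp.2.1⟩, fun B hB => ?_⟩
    obtain ⟨ε, hε, hεB⟩ := Metric.mem_nhds_iff.1 hB
    obtain ⟨T₁, hT₁⟩ := eventually_atTop.1 (Metric.tendsto_nhds.1 hγlim (ε / 2) (half_pos hε))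
    have h1 : ∀ᶠ p in 𝓝 p₀, dist (Y (Z (U p), p)) (Y (γ T₀, p₀)) < ε / 2 :=
      (hY.continuousAt.tendsto.comp hzt).eventually (Metric.ball_mem_nhds _ (half_pos hε))
    refine ⟨max T₀ T₁, ?_⟩
    filter_upwards [hmain, h1] with p hp hp1 t ht
    have ht₀ : T₀ ≤ t := (le_max_left _ _).trans ht
    have ht₁ : T₁ ≤ t := (le_max_right _ _).trans ht
    refine hεB ?_
    have h2 := hp.2.2 (t - T₀) (sub_nonneg.2 ht₀)
    rw [add_sub_cancel] at h2
    have h3 : dist (Y (Z (U p), p) (t - T₀)) (Y (γ T₀, p₀) (t - T₀)) < ε / 2 :=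
      (BoundedContinuousFunction.dist_coe_le_dist _).trans_lt hp1
    rw [hYγ _ (sub_nonneg.2 ht₀), add_sub_cancel] at h3
    change dist (trajectory fpost (Zcl (U p)) t p) (xcu p₀) < ε
    rw [h2]
    have h4 := dist_triangle (Y (Z (U p), p) (t - T₀)) (γ t) (xcu p₀)
    have h5 := hT₁ t ht₁
    linarith
  refine ⟨tcl, D, hbranch, ?_, htcl, ?_⟩
  · -- uniqueness
    rintro t' ⟨h0, hc, hW, hunif⟩
    obtain ⟨hUt', hclt', hzt'⟩ := hgen t' h0 hc
    obtain ⟨T₁, hT₁⟩ := hunif _ (Metric.ball_mem_nhds (xcu p₀) (half_pos hδ))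
    obtain ⟨T₂, hT₂⟩ := eventually_atTop.1 (Metric.tendsto_nhds.1 hγlim (δ / 2) (half_pos hδ))
    -- Up to `Tm` continuous dependence keeps the competing trajectory within `δ` of `γ`; later both
    -- are within `δ/2` of `x_cu(p₀)`. Hence its tail belongs to the family `Y` and satisfies the
    -- scalar equation.
    set Tm := max (max T₁ T₂) 1 with hTm
    have hTm0 : 0 < Tm := lt_max_of_lt_right one_pos
    filter_upwards [hW, hT₁, hclt'.eventually
      (eventually_dist_trajectory_lt hfpost hTm0 (hpT Tm hTm0.le) hδ), hzt'.eventually hYuniq,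
      hUt'.eventually hτu] with p hWp hT₁p hdist huniq hτp
    obtain ⟨θ, hθ0, hθ, -⟩ := hWp.2
    have hθt : ∀ t, 0 ≤ t → trajectory fpost (Zcl ((xpre p, p), t' p)) t p = θ t := fun t ht =>
      trajectory_eq_of_isIntegralCurveOn_Ici hfpost hθ0 hθ ht
    have hclose : ∀ t, 0 ≤ t → dist (θ t) (γ t) < δ := by
      intro t ht
      rw [← hθt t ht, ← hptraj t ht]
      rcases le_total t Tm with htm | htm
      · exact hdist t ⟨ht, htm⟩
      · have h1 := hT₁p t (((le_max_left _ _).trans (le_max_left _ _)).trans htm)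
        have h2 := hT₂ t (((le_max_right _ _).trans (le_max_left _ _)).trans htm)
        rw [hptraj t ht]
        have h3 := dist_triangle_right (trajectory fpost (Zcl ((xpre p, p), t' p)) t p) (γ t) (xcu p₀)
        have h4 : dist (trajectory fpost (Zcl ((xpre p, p), t' p)) t p) (xcu p₀) < δ / 2 := h1
        linarith
    have hθ' : ∀ t, 0 ≤ t → HasDerivWithinAt (fun t => θ (T₀ + t)) (fpost (θ (T₀ + t)) p) (Ici 0) t :=
      fun t ht => (hθ (T₀ + t) (add_nonneg hT₀.le ht)).comp_const_add_Ici hT₀.le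
    have hθc : ContinuousOn (fun t => θ (T₀ + t)) (Ici 0) := fun t ht =>
      (hθ' t ht).continuousWithinAt
    have hθb : ∀ t, 0 ≤ t → ‖θ (T₀ + t)‖ ≤ ‖Y (γ T₀, p₀)‖ + δ := by
      intro t ht
      have h1 := hclose (T₀ + t) (add_nonneg hT₀.le ht)
      have h2 := (Y (γ T₀, p₀)).norm_coe_le_norm t
      rw [hYγ t ht] at h2
      rw [dist_eq_norm] at h1
      have h3 := norm_sub_norm_le (θ (T₀ + t)) (γ (T₀ + t))
      linarith
    let y := extendLeft _ hθc _ hθb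
    have hya : ∀ t, 0 ≤ t → y t = θ (T₀ + t) := fun t ht => extendLeft_apply hθc hθb ht
    have hyv : HasVelocity y fun t => fpost (y t) p := by
      refine ⟨fun t ht => ?_, fun t ht => extendLeft_apply_of_nonpos hθc hθb ht⟩
      beta_reduce
      rw [hya t ht]
      exact (hasVelocity_extendLeft hθc hθb hθ').1 t ht
    have hy0 : y 0 = Z ((xpre p, p), t' p) := by
      rw [hya 0 le_rfl, add_zero, ← hθt T₀ hT₀.le]
    have hYy := huniq y hyv hy0 fun t ht => by
      rw [hya t ht]; exact hclose _ (add_nonneg hT₀.le ht)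
    refine (hτp ?_).symm
    change w (Z ((xpre p, p), t' p)) - w (Y (Z ((xpre p, p), t' p), p) 0) = 0
    rw [hYy, hy0, sub_self]
  · -- the formula for the derivative
    -- If the growth failed, the unstable coordinate would stay below some `Q` at arbitrarily late
    -- times, and `Y'` would reproduce `v₀`, contradicting `hnd`.
    have hgrow : Tendsto (fun t => |w (sensitivityState fpost xcr (T₀ + t) p₀ M₂)|) atTop atTop := by
      by_contra hcon
      rw [tendsto_atTop] at hcon
      push Not at hcon
      obtain ⟨Q, hQ⟩ := hcon
      have h1 := hYfreq (fun t => sensitivityState fpost xcr (T₀ + t) p₀ M₂) Q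
        (fun t ht => by
          have h2 := hasDerivWithinAt_sensitivityState hfpost hγ M₂ (add_nonneg hT₀.le ht)
          rw [hγ0] at h2
          exact h2.comp_const_add_Ici hT₀.le)
        (hQ.mono fun t ht => ht.le)
      simp only [add_zero] at h1
      rw [← hv₀] at h1
      exact hnd (by rw [h1, sub_self])
    have hgrow' : Tendsto (fun T => |w (sensitivityState fpost xcr T p₀ M₂)|) atTop atTop := by
      have h1 := hgrow.comp (tendsto_atTop_add_const_right atTop (-T₀) tendsto_id)
      refine h1.congr fun T => ?_
      simp
    have hne : ∀ᶠ T in atTop, w (sensitivityState fpost xcr T p₀ M₂) ≠ 0 :=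
      (hgrow'.eventually_gt_atTop 0).mono fun T hT => abs_pos.1 hT
    refine ⟨hne, ?_⟩
    set 𝒴 := Y' (Z' ((M₄, 1), D), 1) with h𝒴
    -- This is the derivative at `p₀` of `φ^post(x_cl(p), T₀ + t, p) = Y(Z, p)(t)`; the right side
    -- is a value of one bounded curve.
    have hb : ∀ t, 0 ≤ t → sensitivityState fpost xcr (T₀ + t) p₀ X
        + sensitivityParam fpost xcr (T₀ + t) p₀ = 𝒴 t := by
      intro t ht
      obtain ⟨L, hL, hLs⟩ := exists_hasStrictFDerivAt_trajectory hfpost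
        (hpT (T₀ + t) (add_nonneg hT₀.le ht))
      have h1 : HasDerivAt (fun p => trajectory fpost (Zcl (U p)) (T₀ + t) p) (L (X, 1, 0)) p₀ := by
        refine HasFDerivAt.comp_hasDerivAt
          (l := fun q : State n × ℝ × ℝ => trajectory fpost q.1 q.2.2 q.2.1)
          (f := fun p : ℝ => (Zcl (U p), p, T₀ + t)) p₀ ?_
          (hxcl.prodMk ((hasDerivAt_id p₀).prodMk (hasDerivAt_const p₀ (T₀ + t))))
        rw [hU0, hZcl0]
        exact hL.hasFDerivAt
      have h2 : HasDerivAt (fun p => Y (Z (U p), p) t) (𝒴 t) p₀ :=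
        HasFDerivAt.comp_hasDerivAt (l := fun y : ℝ →ᵇ State n => y t)
          (l' := BoundedContinuousFunction.evalCLM ℝ t) p₀
          (BoundedContinuousFunction.evalCLM (β := State n) ℝ t).hasFDerivAt hYz
      have h3 := h1.unique (h2.congr_of_eventuallyEq (hmain.mono fun p hp => hp.2.2 t ht))
      rw [← h3, hLs]
      simp
    have hXs : X = sensitivityState ffault (xpre p₀) tcr p₀ M₄
        + sensitivityParam ffault (xpre p₀) tcr p₀ + D • M₂ := by
      rw [hX, hLfs, one_smul]
    -- By `hb` the numerator in the formula equals `w O₆ - w 𝒴(T - T₀)` plus `D` times the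
    -- denominator.
    have hlim : Tendsto (fun T => (w O₆ - w (𝒴 (T - T₀))) /
        w (sensitivityState fpost xcr T p₀ M₂) + D) atTop (𝓝 (0 + D)) := by
      refine Tendsto.add_const D ?_
      refine squeeze_zero_norm (a := fun T => (‖w O₆‖ + ‖w‖ * ‖𝒴‖) /
        |w (sensitivityState fpost xcr T p₀ M₂)|) (fun T => ?_) (tendsto_const_nhds.div_atTop hgrow')
      rw [norm_div, Real.norm_eq_abs (w (sensitivityState fpost xcr T p₀ M₂))]
      gcongr
      refine (norm_sub_le _ _).trans (add_le_add le_rfl ((w.le_opNorm _).trans ?_))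
      gcongr
      exact 𝒴.norm_coe_le_norm _
    rw [zero_add] at hlim
    refine hlim.congr' ?_
    filter_upwards [hne, eventually_ge_atTop T₀] with T hTne hTge
    have h1 := congrArg w (hb (T - T₀) (sub_nonneg.2 hTge))
    rw [add_sub_cancel, hXs, map_add, map_add, map_add, map_smul, map_smul, smul_eq_mul] at h1
    rw [← h1, map_sub, map_sub]
    field_simp
    ring

end CriticalClearing

/-! ### Reduction to vector fields defined for all real parameters. -/

section LocalizeParameter

variable {n : ℕ} {f g : State n → ℝ → State n} {p : ℝ}

theorem hasTrajectory_congr (h : ∀ y, f y p = g y p) (x : State n) (t : ℝ) :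
    HasTrajectory f x t p ↔ HasTrajectory g x t p := by
  simp only [HasTrajectory, h]

theorem trajectory_congr (h : ∀ y, f y p = g y p) (x : State n) (t : ℝ) :
    trajectory f x t p = trajectory g x t p := by
  have hfg : (fun (_ : ℝ) y => f y p) = fun _ y => g y p := by
    simp only [h]
  unfold trajectory HasTrajectory
  rw [hfg]

theorem stableManifold_congr (h : ∀ y, f y p = g y p) (e : State n) :
    stableManifold f p e = stableManifold g p e := by
  simp only [stableManifold, h]

theorem stableManifoldTangent_congr (h : ∀ y, f y p = g y p) (e x : State n) :
    stableManifoldTangent f p e x = stableManifoldTangent g p e x := by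
  simp only [stableManifoldTangent, stableManifold_congr h]

theorem stateJacobian_congr (h : ∀ y, f y p = g y p) (x : State n) :
    stateJacobian f x p = stateJacobian g x p := by
  simp only [stateJacobian, h]

theorem isTypeOneUEP_congr (h : ∀ y, f y p = g y p) (x : State n) :
    IsTypeOneUEP f x p ↔ IsTypeOneUEP g x p := by
  simp only [IsTypeOneUEP, eigenvaluesAt, stateJacobian_congr h, h]

theorem sensitivityState_congr (h : ∀ y, f y p = g y p) (x : State n) (t : ℝ) :
    sensitivityState f x t p = sensitivityState g x t p := by
  simp only [sensitivityState, trajectory_congr h]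

theorem sensitivityTime_congr (h : ∀ y, f y p = g y p) (x : State n) (t : ℝ) :
    sensitivityTime f x t p = sensitivityTime g x t p := by
  simp only [sensitivityTime, trajectory_congr h]

/-- A derivative in the parameter requires agreement of the fields for all nearby parameters, not
only at `p`. -/
theorem sensitivityParam_congr (h : ∀ᶠ q in 𝓝 p, ∀ y, f y q = g y q) (x : State n) (t : ℝ) :
    sensitivityParam f x t p = sensitivityParam g x t p :=
  EventuallyEq.deriv_eq (h.mono fun _ hq => trajectory_congr hq x t)

theorem equilibriumSensitivity_congr (h : ∀ᶠ q in 𝓝 p, ∀ y, f y q = g y q) (x : State n) :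
    equilibriumSensitivity f x p = equilibriumSensitivity g x p := by
  have hd : deriv (fun q => f x q) p = deriv (fun q => g x q) p :=
    EventuallyEq.deriv_eq (h.mono fun _ hq => hq x)
  rw [equilibriumSensitivity, equilibriumSensitivity, stateJacobian_congr h.self_of_nhds, hd]

theorem IsCriticalClearingBranch.congr {f' g' : State n → ℝ → State n} {xpre xcu : ℝ → State n}
    {tcr : ℝ} {tcl : ℝ → ℝ} (hf : ∀ᶠ q in 𝓝 p, ∀ y, f y q = f' y q)
    (hg : ∀ᶠ q in 𝓝 p, ∀ y, g y q = g' y q)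
    (H : IsCriticalClearingBranch f g xpre xcu p tcr tcl) :
    IsCriticalClearingBranch f' g' xpre xcu p tcr tcl := by
  obtain ⟨h0, hc, hW, hB⟩ := H
  refine ⟨h0, hc, ?_, fun B hBn => ?_⟩
  · filter_upwards [hW, hf, hg] with q hq hfq hgq
    rwa [← hasTrajectory_congr hfq, ← trajectory_congr hfq, ← stableManifold_congr hgq]
  · obtain ⟨T, hT⟩ := hB B hBn
    refine ⟨T, ?_⟩
    filter_upwards [hT, hf, hg] with q hq hfq hgq
    intro t ht
    rw [← trajectory_congr hfq, ← trajectory_congr hgq]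
    exact hq t ht

/-- A `C¹` reparametrization of the line that is the identity near `p₀` and takes its values in a
given neighbourhood of `p₀`. -/
theorem exists_contDiff_retraction {P : Set ℝ} {p₀ : ℝ} (hP : P ∈ 𝓝 p₀) :
    ∃ ρ : ℝ → ℝ, ContDiff ℝ 1 ρ ∧ (∀ p, ρ p ∈ P) ∧ ∀ᶠ p in 𝓝 p₀, ρ p = p := by
  obtain ⟨ε, hε, hεP⟩ := Metric.mem_nhds_iff.1 hP
  let χ : ContDiffBump p₀ := ⟨ε / 2, ε, half_pos hε, half_lt_self hε⟩
  refine ⟨fun p => p₀ + χ p * (p - p₀), ?_, fun p => hεP ?_, ?_⟩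
  · exact contDiff_const.add (χ.contDiff.mul (contDiff_id.sub contDiff_const))
  · rw [Metric.mem_ball, Real.dist_eq, add_sub_cancel_left, abs_mul, abs_of_nonneg χ.nonneg]
    rcases lt_or_ge |p - p₀| ε with h | h
    · exact (mul_le_of_le_one_left (abs_nonneg _) χ.le_one).trans_lt h
    · rw [χ.zero_of_le_dist (by rwa [Real.dist_eq]), zero_mul]
      exact hε
  · filter_upwards [χ.eventuallyEq_one] with p hp
    rw [hp, Pi.one_apply, one_mul, add_sub_cancel]

/-- The system `f` with its parameter replaced by `ρ p`. -/
def reparam (f : State n → ℝ → State n) (ρ : ℝ → ℝ) : State n → ℝ → State n :=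
  fun y p => f y (ρ p)

theorem contDiff_reparam {P : Set ℝ}
    (hf : ContDiffOn ℝ 1 (fun z : State n × ℝ => f z.1 z.2) (univ ×ˢ P)) {ρ : ℝ → ℝ}
    (hρ : ContDiff ℝ 1 ρ) (hρP : ∀ p, ρ p ∈ P) :
    ContDiff ℝ 1 fun z : State n × ℝ => reparam f ρ z.1 z.2 :=
  hf.comp_contDiff (contDiff_fst.prodMk (hρ.comp contDiff_snd)) fun z => ⟨mem_univ _, hρP z.2⟩

end LocalizeParameter

theorem mainTheorem3 {n : ℕ}
    -- pre-fault, fault-on and post-fault vector fields, `C¹` for parameters in the open set `P`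
    (fpre ffault fpost : State n → ℝ → State n) (P : Set ℝ) (hP : IsOpen P)
    (hfpre : ContDiffOn ℝ 1 (fun z : State n × ℝ => fpre z.1 z.2) (univ ×ˢ P))
    (hffault : ContDiffOn ℝ 1 (fun z : State n × ℝ => ffault z.1 z.2) (univ ×ˢ P))
    (hfpost : ContDiffOn ℝ 1 (fun z : State n × ℝ => fpost z.1 z.2) (univ ×ˢ P))
    (p₀ : ℝ) (hp₀ : p₀ ∈ P)
    -- pre-fault equilibrium, with invertible Jacobian at the base value
    (xpre : ℝ → State n) (hxpre_cont : ContinuousAt xpre p₀)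
    (hxpre : ∀ᶠ p in 𝓝 p₀, fpre (xpre p) p = 0)
    (hxpre_inv : (stateJacobian fpre (xpre p₀) p₀).IsInvertible)
    -- post-fault SEP of the base system
    (xs : State n) (hxs : IsSEP fpost xs p₀)
    -- controlling UEP, of type 1 at the base value
    (xcu : ℝ → State n) (hxcu_cont : ContinuousAt xcu p₀)
    (hxcu : ∀ᶠ p in 𝓝 p₀, fpost (xcu p) p = 0)
    (hxcu_type : IsTypeOneUEP fpost (xcu p₀) p₀)
    -- left eigenvector for the unstable eigenvalue, as a row vector
    (w : State n →L[ℝ] ℝ) (lam : ℝ) (hw : w ≠ 0) (hlam : 0 < lam)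
    (hw_eig : w.comp (stateJacobian fpost (xcu p₀) p₀) = lam • w)
    -- the base critical trajectory exits the stability region through the stable manifold of the
    -- controlling UEP, transversally
    (tcr : ℝ) (htcr : IsCriticalClearingTime ffault fpost (xpre p₀) xs p₀ tcr)
    (xcr : State n) (hxcr : xcr = trajectory ffault (xpre p₀) tcr p₀)
    (hexit : xcr ∈ stableManifold fpost p₀ (xcu p₀))
    (htrans : ffault xcr p₀ ∉ stableManifoldTangent fpost p₀ (xcu p₀) xcr)
    -- the sensitivities in the formula
    (M₁ : State n →L[ℝ] State n) (hM₁ : M₁ = sensitivityState ffault (xpre p₀) tcr p₀)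
    (M₂ : State n) (hM₂ : M₂ = sensitivityTime ffault (xpre p₀) tcr p₀)
    (M₃ : State n) (hM₃ : M₃ = sensitivityParam ffault (xpre p₀) tcr p₀)
    (M₄ : State n) (hM₄ : M₄ = equilibriumSensitivity fpre (xpre p₀) p₀)
    (O₁ : ℝ → State n →L[ℝ] State n) (hO₁ : ∀ T, O₁ T = sensitivityState fpost xcr T p₀)
    (O₃ : ℝ → State n) (hO₃ : ∀ T, O₃ T = sensitivityParam fpost xcr T p₀)
    (O₆ : State n) (hO₆ : O₆ = equilibriumSensitivity fpost (xcu p₀) p₀) :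
    ∃ (tcl : ℝ → ℝ) (D : ℝ),
      IsCriticalClearingBranch ffault fpost xpre xcu p₀ tcr tcl ∧
      (∀ tcl' : ℝ → ℝ, IsCriticalClearingBranch ffault fpost xpre xcu p₀ tcr tcl' →
        tcl' =ᶠ[𝓝 p₀] tcl) ∧
      HasDerivAt tcl D p₀ ∧
      (∀ᶠ T in atTop, w (O₁ T M₂) ≠ 0) ∧
      Tendsto (fun T => w (O₆ - O₃ T - O₁ T (M₁ M₄ + M₃)) / w (O₁ T M₂)) atTop (𝓝 D) := by
  -- Composition with `ρ` makes the fields `C¹` for all real parameters and leaves them unchanged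
  -- near `p₀`; everything in the statement is local in `p`.
  obtain ⟨ρ, hρ, hρP, hρid⟩ := exists_contDiff_retraction (hP.mem_nhds hp₀)
  have hloc : ∀ f : State n → ℝ → State n, ∀ᶠ p in 𝓝 p₀, ∀ y, reparam f ρ y p = f y p := fun f =>
    hρid.mono fun p hp y => by rw [reparam, hp]
  have hloc' : ∀ f : State n → ℝ → State n, ∀ᶠ p in 𝓝 p₀, ∀ y, f y p = reparam f ρ y p := fun f =>
    (hloc f).mono fun p hp y => (hp y).symm
  have hpre := (hloc' fpre).self_of_nhds
  have hfault := (hloc' ffault).self_of_nhds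
  have hpost := (hloc' fpost).self_of_nhds
  have hderiv : HasDerivAt xpre M₄ p₀ := by
    rw [hM₄, equilibriumSensitivity_congr (hloc' fpre)]
    refine hasDerivAt_equilibrium (contDiff_reparam hfpre hρ hρP) hxpre_cont ?_ ?_
    · filter_upwards [hxpre, hloc fpre] with p hp hl
      rw [hl, hp]
    · rwa [← stateJacobian_congr hpre]
  rw [stateJacobian_congr hpost] at hw_eig
  rw [trajectory_congr hfault] at hxcr
  rw [stableManifold_congr hpost] at hexit
  rw [stableManifoldTangent_congr hpost, hfault] at htrans
  have hcu : ∀ᶠ p in 𝓝 p₀, reparam fpost ρ (xcu p) p = 0 := by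
    filter_upwards [hxcu, hloc fpost] with p hp hl
    rw [hl, hp]
  obtain ⟨tcl, D, hbr, huniq, hD, hne, hlim⟩ := exists_criticalClearingBranch
    (contDiff_reparam hffault hρ hρP) (contDiff_reparam hfpost hρ hρP) hderiv
    hxcu_cont hcu ((isTypeOneUEP_congr hpost _).1 hxcu_type) hw hlam hw_eig htcr.1
    ((hasTrajectory_congr hfault _ _).1 htcr.2.1) hxcr hexit htrans O₆
  rw [← sensitivityTime_congr hfault, ← hM₂] at hne hlim
  rw [← sensitivityState_congr hfault, ← hM₁, ← sensitivityParam_congr (hloc' ffault), ← hM₃]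
    at hlim
  simp only [← sensitivityState_congr hpost, ← hO₁] at hne hlim
  simp only [← sensitivityParam_congr (hloc' fpost), ← hO₃] at hlim
  exact ⟨tcl, D, hbr.congr (hloc ffault) (hloc fpost),
    fun t' ht' => huniq t' (ht'.congr (hloc' ffault) (hloc' fpost)), hD, hne, hlim⟩
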